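/- Let $\Sigma$ be a smooth (Hausdorff, second countable) manifold without boundary, with a Riemannian metric $g_\Sigma$ of class $C^2$. Let $\beta\in C^2(\Sigma)$ satisfy $C\le\beta\le C^{-1}$ for some constant $C>0$, let $V\in C^1(\Sigma)$ be real and bounded, let $A$ be a real $1$-form of class $C^1$ on $\Sigma$, and let $Y\in L^2_{\mathrm{loc}}(\Sigma)$ with $Y\ge 0$. (These are the data of the standard static spacetime $\mathbb R\times\Sigma$ with metric $g=-\beta\,dt^2+g_\Sigma$, the static electromagnetic potential $-V\,dt+A$ and the static scalar potential $Y$.) Write $|g|=\beta\,|\det g_\Sigma|$, $D=-\mathrm i\partial$, and $L^2(\Sigma)=L^2(\Sigma,\beta^{1/2}|g_\Sigma|^{1/2})$ with scalar product $(u\,|\,v)=\int\overline u\,v\,\beta^{1/2}|g_\Sigma|^{1/2}$. Let $L$ be the operator on $C_c^\infty(\Sigma)$ given in local coordinates by $$L=\beta^{1/2}|g|^{-1/2}(D_i-A_i)|g|^{1/2}g_\Sigma^{ij}(D_j-A_j)\beta^{1/2}+\beta Y .$$ Assume that $L$ is essentially self-adjoint on $C_c^\infty(\Sigma)$ in $L^2(\Sigma)$,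 and denote its closure again by $L$. Let $$H=\begin{pmatrix}L&V\\V&1\end{pmatrix}\quad\text{on } L^2(\Sigma)\oplus L^2(\Sigma),\qquad \operatorname{Dom}H=\operatorname{Dom}L\oplus L^2(\Sigma),$$ and assume $H>0$, that is, $(u\,|\,Hu)\ge 0$ for all $u\in\operatorname{Dom}H$ and $\operatorname{Ker}H=\{0\}$. Let $\mathcal H_{\mathrm{en}}$ be the energy space: the Hilbert space obtained from the form domain $\operatorname{Dom}H^{1/2}$ with the energy product $(u\,|\,v)_{\mathrm{en}}=(H^{1/2}u\,|\,H^{1/2}v)$, which extends $(u\,|\,Hv)$, by completion (if it is not already complete). Then $$B=\begin{pmatrix}V&1\\L&V\end{pmatrix}$$ is well defined as an operator in $\mathcal H_{\mathrm{en}}$ with domain $C_c^\infty(\Sigma)\oplus C_c^\infty(\Sigma)$, and it is essentially self-adjoint there. Denoting its closure in $\mathcal H_{\mathrm{en}}$ again by $B$, its resolvent set is $$\operatorname{rs}(B)=\bigl\{z\in\mathbb C\;:\;\bigl(L-(V-z)^2\bigr)(1+L)^{-1/2}\ \text{is boundedly invertible}\bigr\}.$$ Here $(L-(V-z)^2)(1+L)^{-1/2}$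 is the operator on $L^2(\Sigma)$ with its natural domain $\{f:(1+L)^{-1/2}f\in\operatorname{Dom}L\}$, an operator $T$ on a Hilbert space $\mathcal K$ is called boundedly invertible if it is a bijection from $\operatorname{Dom}T$ to $\mathcal K$ with bounded inverse, and $z\in\operatorname{rs}(B)$ means that $B-z$ is boundedly invertible. -/

import Mathlib

open MeasureTheory Bundle
open scoped Manifold ContDiff ENNReal Matrix InnerProductSpace

noncomputable section

namespace StaticKG

/-! ### Unbounded operators on a complex Hilbert space -/

section Operators

variable {K : Type*} [NormedAddCommGroup K] [InnerProductSpace ℂ K]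

/-- `T` is closable and its closure is self-adjoint. -/
def IsEssentiallySelfAdjoint [CompleteSpace K] (T : K →ₗ.[ℂ] K) : Prop :=
  T.IsClosable ∧ IsSelfAdjoint T.closure

/-- `T > 0`: `(u | T u) ≥ 0` for all `u` in the domain of `T`, and `Ker T = {0}`. -/
def IsPositiveInjective (T : K →ₗ.[ℂ] K) : Prop :=
  (∀ u : T.domain, 0 ≤ (⟪(u : K), T u⟫_ℂ).re ∧ (⟪(u : K), T u⟫_ℂ).im = 0) ∧
    ∀ u : T.domain, T u = 0 → (u : K) = 0

/-- The everywhere defined bounded operator `R` is a two-sided inverse of `T : Dom T → K`. -/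
def IsBoundedInverse (T : K →ₗ.[ℂ] K) (R : K →L[ℂ] K) : Prop :=
  (∀ f : K, ∃ h : R f ∈ T.domain, T ⟨R f, h⟩ = f) ∧ ∀ u : T.domain, R (T u) = u

def IsBoundedlyInvertible (T : K →ₗ.[ℂ] K) : Prop :=
  ∃ R : K →L[ℂ] K, IsBoundedInverse T R

/-- The set of `z : ℂ` such that `T - z : Dom T → K` is boundedly invertible. -/
def resolventSet (T : K →ₗ.[ℂ] K) : Set ℂ :=
  {z | IsBoundedlyInvertible ((-(z • (LinearMap.id : K →ₗ[ℂ] K))) +ᵥ T)}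

/-- The product `T S` of an operator `T` with a bounded operator `S`, on its natural domain
`{f | S f ∈ Dom T}`. -/
def compBounded (T : K →ₗ.[ℂ] K) (S : K →L[ℂ] K) : K →ₗ.[ℂ] K where
  domain := T.domain.comap (S : K →ₗ[ℂ] K)
  toFun := T.toFun ∘ₗ (S : K →ₗ[ℂ] K).restrict (p := T.domain.comap (S : K →ₗ[ℂ] K))
    (q := T.domain) (fun _ hx => hx)

/-- The bounded inverse `T⁻¹` (equal to `0` if `T` is not boundedly invertible). -/
def boundedInverse (T : K →ₗ.[ℂ] K) : K →L[ℂ] K :=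
  open Classical in if h : IsBoundedlyInvertible T then h.choose else 0

theorem IsBoundedInverse.unique {T : K →ₗ.[ℂ] K} {R R' : K →L[ℂ] K}
    (h : IsBoundedInverse T R) (h' : IsBoundedInverse T R') : R = R' := by
  ext f
  obtain ⟨hf, hTf⟩ := h'.1 f
  have := h.2 ⟨R' f, hf⟩
  rwa [hTf] at this

theorem boundedInverse_eq {T : K →ₗ.[ℂ] K} {R : K →L[ℂ] K} (h : IsBoundedInverse T R) :
    boundedInverse T = R := by
  have hT : IsBoundedlyInvertible T := ⟨R, h⟩
  rw [boundedInverse, dif_pos hT]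
  exact hT.choose_spec.unique h

/-- The resolvent `(1 + T)⁻¹`. -/
def resolventOne (T : K →ₗ.[ℂ] K) : K →L[ℂ] K :=
  boundedInverse ((LinearMap.id : K →ₗ[ℂ] K) +ᵥ T)

variable [CompleteSpace K]

/-- `(1 + T)^{-1/2}`, the positive square root of `(1 + T)⁻¹`, for `T` self-adjoint, `T ≥ 0`. -/
def invSqrtOneAdd (T : K →ₗ.[ℂ] K) : K →L[ℂ] K := CFC.sqrt (resolventOne T)

/-- The positive square root `T^{1/2}` of a positive self-adjoint operator `T`:
its domain is the range of `(1 + T)^{-1/2}`, and it sends `(1 + T)^{-1/2} f` to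
`(T (1 + T)⁻¹)^{1/2} f`, where `T (1 + T)⁻¹ = 1 - (1 + T)⁻¹`. -/
def sqrtOp (T : K →ₗ.[ℂ] K) : K →ₗ.[ℂ] K :=
  (LinearMap.range ((invSqrtOneAdd T : K →ₗ[ℂ] K).prod
    (CFC.sqrt (1 - resolventOne T) : K →L[ℂ] K).toLinearMap)).toLinearPMap

/-- The form domain `Dom T^{1/2}` of a positive self-adjoint operator `T`, as a space of its own. -/
def FormDomain (T : K →ₗ.[ℂ] K) : Type _ := (sqrtOp T).domain

instance (T : K →ₗ.[ℂ] K) : AddCommGroup (FormDomain T) :=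
  inferInstanceAs (AddCommGroup (sqrtOp T).domain)

instance (T : K →ₗ.[ℂ] K) : Module ℂ (FormDomain T) :=
  inferInstanceAs (Module ℂ (sqrtOp T).domain)

/-- The inclusion of the form domain of `T` in the ambient Hilbert space. -/
def FormDomain.val (T : K →ₗ.[ℂ] K) : FormDomain T →ₗ[ℂ] K := (sqrtOp T).domain.subtype

/-- `T^{1/2}` as a linear map on the form domain of `T`. -/
def FormDomain.sqrtMap (T : K →ₗ.[ℂ] K) : FormDomain T →ₗ[ℂ] K := (sqrtOp T).toFun

instance (T : K →ₗ.[ℂ] K) : SeminormedAddCommGroup (FormDomain T) :=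
  SeminormedAddCommGroup.induced _ _ (FormDomain.sqrtMap T)

instance (T : K →ₗ.[ℂ] K) : NormedSpace ℂ (FormDomain T) :=
  NormedSpace.induced ℂ (FormDomain T) K (FormDomain.sqrtMap T)

/-- The scalar product given by `T` on its form domain: `⟪u, v⟫ = (T^{1/2} u | T^{1/2} v)`, the
extension of `(u | T v)` from `Dom T` to the form domain. -/
instance (T : K →ₗ.[ℂ] K) : InnerProductSpace ℂ (FormDomain T) where
  inner u v := ⟪FormDomain.sqrtMap T u, FormDomain.sqrtMap T v⟫_ℂ
  norm_sq_eq_re_inner u := norm_sq_eq_re_inner (𝕜 := ℂ) (FormDomain.sqrtMap T u)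
  conj_inner_symm u v := inner_conj_symm _ _
  add_left u v w := by rw [map_add, inner_add_left]
  smul_left u v r := by rw [map_smul, inner_smul_left]

/-- The Hilbert space obtained from the form domain of `T` with the scalar product given by `T`
(its completion; nothing is added if the form domain is already complete). -/
abbrev EnergySpace (T : K →ₗ.[ℂ] K) : Type _ := UniformSpace.Completion (FormDomain T)

end Operators

/-! ### Static data -/

/-- Standard static data on a manifold `X` of dimension `n`, the Cauchy surface: they describe the
spacetime `ℝ × X` with metric `-β dt² + g`, the static electromagnetic potential `-V dt + A` and the
static scalar potential `Y`. -/
structure StaticData (n : ℕ) (X : Type*) [TopologicalSpace X]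
    [ChartedSpace (EuclideanSpace ℝ (Fin n)) X] [IsManifold (𝓡 n) ∞ X] where
  /-- the Riemannian metric of class `C²` -/
  g : ContMDiffRiemannianMetric (𝓡 n) 2 (EuclideanSpace ℝ (Fin n))
    (TangentSpace (𝓡 n) : X → Type _)
  β : X → ℝ
  β_contMDiff : ContMDiff (𝓡 n) 𝓘(ℝ, ℝ) 2 β
  β_bounds : ∃ C : ℝ, 0 < C ∧ ∀ x, C ≤ β x ∧ β x ≤ C⁻¹
  /-- minus the time component of the electromagnetic potential -/
  V : X → ℝ
  V_contMDiff : ContMDiff (𝓡 n) 𝓘(ℝ, ℝ) 1 V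
  V_bounded : ∃ C : ℝ, ∀ x, |V x| ≤ C
  /-- the spatial part of the electromagnetic potential, a `1`-form of class `C¹` -/
  A (x : X) : TangentSpace (𝓡 n) x →L[ℝ] Bundle.Trivial X ℝ x
  A_contMDiff : ContMDiff (𝓡 n) ((𝓡 n).prod 𝓘(ℝ, EuclideanSpace ℝ (Fin n) →L[ℝ] ℝ)) 1
    (fun x => TotalSpace.mk' (EuclideanSpace ℝ (Fin n) →L[ℝ] ℝ)
      (E := fun x : X => TangentSpace (𝓡 n) x →L[ℝ] Bundle.Trivial X ℝ x) x (A x))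
  /-- the scalar potential -/
  Y : X → ℝ

namespace StaticData

variable {n : ℕ} {X : Type*} [TopologicalSpace X]
  [ChartedSpace (EuclideanSpace ℝ (Fin n)) X] [IsManifold (𝓡 n) ∞ X]

/-- The coordinate vector field `∂ⱼ` of the chart `e`, at the point with coordinates `y`. -/
def coordVec (e : OpenPartialHomeomorph X (EuclideanSpace ℝ (Fin n)))
    (y : EuclideanSpace ℝ (Fin n)) (j : Fin n) : TangentSpace (𝓡 n) (e.symm y) :=
  mfderiv (𝓡 n) (𝓡 n) e.symm y (EuclideanSpace.single j (1 : ℝ))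

variable (D : StaticData n X)

/-- The matrix `g_ij` of the metric in the chart `e`. -/
def gram (e : OpenPartialHomeomorph X (EuclideanSpace ℝ (Fin n)))
    (y : EuclideanSpace ℝ (Fin n)) : Matrix (Fin n) (Fin n) ℝ :=
  Matrix.of fun i j => D.g.inner (e.symm y) (coordVec e y i) (coordVec e y j)

/-- The coordinate expression of `D_j - A_j`, where `D = -i∂`. -/
def magDeriv (e : OpenPartialHomeomorph X (EuclideanSpace ℝ (Fin n))) (j : Fin n)
    (w : EuclideanSpace ℝ (Fin n) → ℂ) (y : EuclideanSpace ℝ (Fin n)) : ℂ :=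
  -Complex.I * fderiv ℝ w y (EuclideanSpace.single j (1 : ℝ)) -
    ((D.A (e.symm y) (coordVec e y j) : ℝ) : ℂ) * w y

/-- `|det g|^{1/2}` in the chart `e`, for the determinant `-β det (g_ij)` of the spacetime
metric. -/
def sqrtDet (e : OpenPartialHomeomorph X (EuclideanSpace ℝ (Fin n)))
    (y : EuclideanSpace ℝ (Fin n)) : ℝ :=
  √(D.β (e.symm y) * (D.gram e y).det)

/-- `|g|^{1/2} g^{ij} (D_j - A_j) β^{1/2} φ` (sum over `j`) in the chart `e`. -/
def flux (e : OpenPartialHomeomorph X (EuclideanSpace ℝ (Fin n))) (φ : X → ℂ) (i : Fin n)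
    (y : EuclideanSpace ℝ (Fin n)) : ℂ :=
  (D.sqrtDet e y : ℂ) * ∑ j : Fin n, (((D.gram e y)⁻¹ i j : ℝ) : ℂ) *
    D.magDeriv e j (fun y' => ((√(D.β (e.symm y')) : ℝ) : ℂ) * φ (e.symm y')) y

/-- The differential expression
`β^{1/2} |g|^{-1/2} (D_i - A_i) |g|^{1/2} g^{ij} (D_j - A_j) β^{1/2} φ + β Y φ`,
evaluated at each point in the preferred chart at this point. -/
def applyL (φ : X → ℂ) (x : X) : ℂ :=
  let e := chartAt (EuclideanSpace ℝ (Fin n)) x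
  ((√(D.β x) : ℝ) : ℂ) * ((D.sqrtDet e (e x) : ℂ)⁻¹ *
    ∑ i : Fin n, D.magDeriv e i (D.flux e φ i) (e x)) + (D.β x : ℂ) * (D.Y x : ℂ) * φ x

/-- `C_c^∞(X)`, complex valued. -/
def IsTestFunction (φ : X → ℂ) : Prop :=
  ContMDiff (𝓡 n) 𝓘(ℝ, ℂ) ∞ φ ∧ HasCompactSupport φ

variable [MeasurableSpace X]

/-- The density `(det g_ij)^{1/2} dy` on the domain of the chart `e`, as a measure on `X` that
vanishes outside of this domain. -/
def chartVolume (e : OpenPartialHomeomorph X (EuclideanSpace ℝ (Fin n))) : Measure X :=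
  Measure.map e.symm
    ((volume.withDensity fun y => ENNReal.ofReal √((D.gram e y).det)).restrict e.target)

/-- The Riemannian volume measure of `g`. The chart densities agree on the overlaps of the charts,
and the smallest measure above all of them is the measure that restricts to each of them. -/
def riemannianVolume : Measure X :=
  ⨆ x : X, D.chartVolume (chartAt (EuclideanSpace ℝ (Fin n)) x)

/-- The measure `β^{1/2} |g_X|^{1/2}` that defines `L²(X)`. -/
def μ : Measure X := D.riemannianVolume.withDensity fun x => ENNReal.ofReal √(D.β x)

/-- The scalar potential is locally square integrable and `≥ 0`. -/
def ScalarPotentialAdmissible : Prop :=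
  (∀ s : Set X, IsCompact s → MemLp D.Y 2 (D.riemannianVolume.restrict s)) ∧
    ∀ᵐ x ∂D.riemannianVolume, 0 ≤ D.Y x

/-- `L²(X)`, with scalar product `∫ conj u * v dμ`. -/
abbrev L2 : Type _ := Lp ℂ 2 D.μ

/-- The Hilbert space `L²(X) ⊕ L²(X)`. -/
abbrev L2Sum : Type _ := WithLp 2 (D.L2 × D.L2)

/-- The operator `L` on `C_c^∞(X)`, given by its graph in `L²(X)`. (The set of pairs is a linear
subspace, so that taking its span adds nothing.) -/
def L₀ : D.L2 →ₗ.[ℂ] D.L2 :=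
  (Submodule.span ℂ {p : D.L2 × D.L2 | ∃ φ : X → ℂ, IsTestFunction (n := n) φ ∧
    p.1 =ᵐ[D.μ] φ ∧ p.2 =ᵐ[D.μ] D.applyL φ}).toLinearPMap

/-- The closure of `L₀`. -/
def L : D.L2 →ₗ.[ℂ] D.L2 := D.L₀.closure

variable [BorelSpace X]

theorem memLp_V : MemLp (fun x => (D.V x : ℂ)) ∞ D.μ := by
  obtain ⟨C, hC⟩ := D.V_bounded
  refine memLp_top_of_bound
    (Complex.measurable_ofReal.comp D.V_contMDiff.continuous.measurable).aestronglyMeasurable C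
    (Filter.Eventually.of_forall fun x => ?_)
  simpa using hC x

/-- Multiplication by `V` on `L²(X)`. -/
def mulV : D.L2 →L[ℂ] D.L2 :=
  (ContinuousLinearMap.mul ℂ ℂ).holderL D.μ ∞ 2 2 (D.memLp_V.toLp _)

/-- The classical Hamiltonian `H = (L V; V 1)` on `L²(X) ⊕ L²(X)`, with domain
`Dom L ⊕ L²(X)`. -/
def H : D.L2Sum →ₗ.[ℂ] D.L2Sum where
  domain := D.L.domain.comap (WithLp.fstₗ 2 ℂ D.L2 D.L2)
  toFun :=
    { toFun := fun u => WithLp.toLp 2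
        (D.L ⟨(u : D.L2Sum).fst, u.2⟩ + D.mulV (u : D.L2Sum).snd,
          D.mulV (u : D.L2Sum).fst + (u : D.L2Sum).snd)
      map_add' := fun u v => by
        have h : D.L ⟨(u + v : D.L2Sum).fst, (u + v).2⟩ =
            D.L ⟨(u : D.L2Sum).fst, u.2⟩ + D.L ⟨(v : D.L2Sum).fst, v.2⟩ :=
          D.L.map_add ⟨(u : D.L2Sum).fst, u.2⟩ ⟨(v : D.L2Sum).fst, v.2⟩
        rw [← WithLp.toLp_add]
        congr 1
        refine Prod.ext ?_ ?_
        · change D.L ⟨(u + v : D.L2Sum).fst, (u + v).2⟩ + D.mulV (u + v : D.L2Sum).snd = _ + _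
          rw [h, WithLp.add_snd, map_add]
          exact add_add_add_comm _ _ _ _
        · change D.mulV (u + v : D.L2Sum).fst + (u + v : D.L2Sum).snd = _ + _
          rw [WithLp.add_snd, WithLp.add_fst, map_add]
          exact add_add_add_comm _ _ _ _
      map_smul' := fun c u => by
        have h : D.L ⟨(c • u : D.L2Sum).fst, (c • u).2⟩ = c • D.L ⟨(u : D.L2Sum).fst, u.2⟩ :=
          D.L.map_smul c ⟨(u : D.L2Sum).fst, u.2⟩
        rw [← WithLp.toLp_smul]
        congr 1
        refine Prod.ext ?_ ?_
        · change D.L ⟨(c • u : D.L2Sum).fst, (c • u).2⟩ + D.mulV (c • u : D.L2Sum).snd = c • (_ + _)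
          rw [h, WithLp.smul_snd, map_smul, smul_add]
        · change D.mulV (c • u : D.L2Sum).fst + (c • u : D.L2Sum).snd = c • (_ + _)
          rw [WithLp.smul_snd, WithLp.smul_fst, map_smul, smul_add] }

/-- The energy space: the form domain of `H` with the scalar product given by `H`, as a Hilbert
space. -/
abbrev Hen : Type _ := EnergySpace D.H

/-- The pair of energy space vectors `(u, w)` is given by `u = (φ₁, φ₂)` and
`w = B u = (V φ₁ + φ₂, L φ₁ + V φ₂)`. -/
def RepresentsB (φ₁ φ₂ : X → ℂ) (p : D.Hen × D.Hen) : Prop :=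
  ∃ u w : FormDomain D.H,
    (FormDomain.val D.H u).fst =ᵐ[D.μ] φ₁ ∧ (FormDomain.val D.H u).snd =ᵐ[D.μ] φ₂ ∧
    (FormDomain.val D.H w).fst =ᵐ[D.μ] (fun x => (D.V x : ℂ) * φ₁ x + φ₂ x) ∧
    (FormDomain.val D.H w).snd =ᵐ[D.μ] (fun x => D.applyL φ₁ x + (D.V x : ℂ) * φ₂ x) ∧
    p = ((u : D.Hen), (w : D.Hen))

/-- The operator `B = (V 1; L V)` on `C_c^∞(X) ⊕ C_c^∞(X)` in the energy space, given by its graph.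
(The set of pairs is a linear subspace, so that taking its span adds nothing.) -/
def B₀ : D.Hen →ₗ.[ℂ] D.Hen :=
  (Submodule.span ℂ {p : D.Hen × D.Hen | ∃ φ₁ φ₂ : X → ℂ, IsTestFunction (n := n) φ₁ ∧
    IsTestFunction (n := n) φ₂ ∧ D.RepresentsB φ₁ φ₂ p}).toLinearPMap

/-- The closure of `B₀` in the energy space. -/
def B : D.Hen →ₗ.[ℂ] D.Hen := D.B₀.closure

/-- The operator `L - (V - z)²` on `L²(X)`, with domain `Dom L`. -/
def pencil (z : ℂ) : D.L2 →ₗ.[ℂ] D.L2 :=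
  (-((D.mulV - z • ContinuousLinearMap.id ℂ D.L2) ^ 2) : D.L2 →L[ℂ] D.L2).toLinearMap +ᵥ D.L

end StaticData

end StaticKG

end

/-! Write S = L − V², p(z) = L − (V − z)² and J = (1 + L)^{-1/2}. The operator B is H followed by
the exchange of the two components. So the energy product of f with u is the L² product of f with
the exchanged components of Bu, and B is symmetric because the exchange is (`inner_wavePair`,
`wavePair_symm`). Testing H on vectors (a, −Va) gives S ≥ 0 and Ker S = 0, hence also L ≥ V² ≥ 0.
Completing the square gives the energy norm ‖u‖² = (u₁ | S u₁) + ‖V u₁ + u₂‖².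

Essential self-adjointness follows once the closure of B₀ minus z has dense range for every
imaginary z ≠ 0. Eliminating u₂ from (B − z)u = f leaves p(z)u₁ = f₂ − (V − z)f₁. For non-real z the
operator p(z) is boundedly invertible, because the imaginary part of z̄ (u | p(z)u) is −Im z ((u |
Su) + |z|²‖u‖²) (`pencilOp_lower_bound`). This solves the equation for all f in Dom H, a dense set,
with a solution u in Dom H.

It remains to approximate such a pair (u, Bu) in the energy norm by pairs with u in C_c^∞ ⊕ C_c^∞
(`mem_closure_waveGraph`). The obstacle is that nothing bounds the derivatives of V: it maps C_c^∞
into the form domain of L, but without continuity in the form norm. The remedy is to approximate u₁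
first, in the graph norm of L, and only then to choose the second component so that the sum V x + v
is close to (Bu)₁ in the form norm.

For the resolvent set, non-real z belong to both sides. For real z both operators are self-adjoint,
so invertibility means a lower bound, and such bounds are carried over in both directions
(`exists_bound_wavePair`, `exists_bound_pencilOp`). The point z = 0 is special, since the energy
norm does not control the L² norm of the first component. The factor J does not affect invertibility
(`isBoundedlyInvertible_compBounded_iff`).

The geometry has to supply that L on C_c^∞ comes from a nonnegative hermitian form, and that Vφ lies
in the form domain of L for φ in C_c^∞. Both rest on integration by parts
(`integral_conj_mul_principal`) and the Cauchy–Schwarz inequality for the form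
(`norm_integral_conj_mul_applyL_le`). -/

namespace StaticKG

open LinearPMap

/-! ### Criteria for self-adjointness and bounded invertibility. -/

section SelfAdjointOperators

variable {K : Type*} [NormedAddCommGroup K] [InnerProductSpace ℂ K]

theorem mk_mem_graph_iff {T : K →ₗ.[ℂ] K} {u w : K} :
    (u, w) ∈ T.graph ↔ ∃ h : u ∈ T.domain, T ⟨u, h⟩ = w := by
  rw [mem_graph_iff]
  constructor
  · rintro ⟨⟨y, hy⟩, rfl, rfl⟩
    exact ⟨hy, rfl⟩
  · rintro ⟨h, rfl⟩
    exact ⟨⟨u, h⟩, rfl, rfl⟩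

theorem inner_graph_of_isFormalAdjoint {T : K →ₗ.[ℂ] K} (h : T.IsFormalAdjoint T) {u w u' w' : K}
    (hu : (u, w) ∈ T.graph) (hu' : (u', w') ∈ T.graph) : ⟪w, u'⟫_ℂ = ⟪u, w'⟫_ℂ := by
  obtain ⟨h₁, rfl⟩ := mk_mem_graph_iff.1 hu
  obtain ⟨h₂, rfl⟩ := mk_mem_graph_iff.1 hu'
  exact h ⟨u, h₁⟩ ⟨u', h₂⟩

variable [CompleteSpace K]

theorem isFormalAdjoint_of_isSelfAdjoint {T : K →ₗ.[ℂ] K} (hT : IsSelfAdjoint T) :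
    T.IsFormalAdjoint T := by
  have h := adjoint_isFormalAdjoint hT.dense_domain
  rwa [isSelfAdjoint_def.1 hT] at h

theorem mem_graph_of_isSelfAdjoint {T : K →ₗ.[ℂ] K} (hT : IsSelfAdjoint T) {x w : K}
    (h : ∀ u : T.domain, ⟪w, (u : K)⟫_ℂ = ⟪x, T u⟫_ℂ) : (x, w) ∈ T.graph := by
  have hx : x ∈ T†.domain := mem_adjoint_domain_of_exists x ⟨w, h⟩
  have : (x, w) ∈ T†.graph :=
    mk_mem_graph_iff.2 ⟨hx, adjoint_apply_eq hT.dense_domain ⟨x, hx⟩ h⟩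
  rwa [isSelfAdjoint_def.1 hT] at this

/-- Symmetry already makes the adjoint an extension of `T`, so only the inclusion of domains is
missing; density then forces equal values. -/
theorem isSelfAdjoint_of_mem_domain {T : K →ₗ.[ℂ] K} (hd : Dense (T.domain : Set K))
    (hs : T.IsFormalAdjoint T)
    (h : ∀ x w : K, (∀ u : T.domain, ⟪w, (u : K)⟫_ℂ = ⟪x, T u⟫_ℂ) → x ∈ T.domain) :
    IsSelfAdjoint T := by
  refine isSelfAdjoint_def.2 (le_antisymm ?_ (hs.le_adjoint hd))
  refine LinearPMap.le_of_le_graph ?_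
  rintro ⟨x, w⟩ hx
  obtain ⟨hx₀, rfl⟩ := mk_mem_graph_iff.1 hx
  have key := adjoint_isFormalAdjoint hd ⟨x, hx₀⟩
  have hx' := h x _ key
  refine mk_mem_graph_iff.2 ⟨hx', ?_⟩
  refine hd.eq_of_inner_left ℂ fun v hv => ?_
  rw [key ⟨v, hv⟩]
  exact hs ⟨x, hx'⟩ ⟨v, hv⟩

omit [CompleteSpace K] in
theorem isClosed_vadd {T : K →ₗ.[ℂ] K} (hT : T.IsClosed) (C : K →L[ℂ] K) :
    ((C : K →ₗ[ℂ] K) +ᵥ T).IsClosed := by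
  have : (((C : K →ₗ[ℂ] K) +ᵥ T).graph : Set (K × K)) =
      (fun p : K × K => (p.1, p.2 - C p.1)) ⁻¹' (T.graph : Set (K × K)) := by
    ext ⟨u, w⟩
    simp only [SetLike.mem_coe, Set.mem_preimage, mk_mem_graph_iff, vadd_domain]
    refine exists_congr fun h => ?_
    rw [eq_sub_iff_add_eq']
    exact Iff.rfl
  rw [LinearPMap.IsClosed, this]
  exact hT.preimage (by fun_prop)

omit [CompleteSpace K] in
theorem IsBoundedlyInvertible.exists_bound {T : K →ₗ.[ℂ] K} (h : IsBoundedlyInvertible T) :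
    ∃ c : ℝ, 0 < c ∧ ∀ u : T.domain, c * ‖(u : K)‖ ≤ ‖T u‖ := by
  obtain ⟨R, -, hR⟩ := h
  refine ⟨(‖R‖ + 1)⁻¹, by positivity, fun u => ?_⟩
  rw [inv_mul_le_iff₀ (by positivity)]
  calc ‖(u : K)‖ = ‖R (T u)‖ := by rw [hR]
    _ ≤ ‖R‖ * ‖T u‖ := R.le_opNorm _
    _ ≤ _ := by gcongr; linarith

/-- Closedness and the lower bound make the range closed; the last hypothesis says that its
orthogonal complement is trivial. -/
theorem isBoundedlyInvertible_of_bound {T : K →ₗ.[ℂ] K} (hT : T.IsClosed) {c : ℝ} (hc : 0 < c)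
    (hb : ∀ u : T.domain, c * ‖(u : K)‖ ≤ ‖T u‖)
    (hr : ∀ x : K, (∀ u : T.domain, ⟪x, T u⟫_ℂ = 0) → x = 0) : IsBoundedlyInvertible T := by
  have hinj : Function.Injective T.toFun := by
    rw [← LinearMap.ker_eq_bot, LinearMap.ker_eq_bot']
    intro u hu
    have h0 : ‖T u‖ = 0 := by rw [norm_eq_zero]; exact hu
    have := hb u
    rw [h0] at this
    have h1 : ‖(u : K)‖ ≤ 0 := by
      by_contra h
      push Not at h
      have := mul_pos hc h
      linarith
    exact Subtype.ext (norm_le_zero_iff.1 h1)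
  have hcl : IsClosed (LinearMap.range T.toFun : Set K) := by
    refine IsSeqClosed.isClosed fun y f hy hf => ?_
    choose u hu using hy
    have hcau : CauchySeq fun k => ((u k : T.domain) : K) := by
      have hyc := hf.cauchySeq
      rw [Metric.cauchySeq_iff'] at hyc ⊢
      intro ε hε
      obtain ⟨N, hN⟩ := hyc (c * ε) (by positivity)
      refine ⟨N, fun k hk => ?_⟩
      have h1 := hN k hk
      rw [← hu k, ← hu N, dist_eq_norm, ← _root_.map_sub] at h1
      have h2 := hb (u k - u N)
      rw [dist_eq_norm]
      have h3 : c * ‖((u k : T.domain) : K) - (u N : T.domain)‖ < c * ε := lt_of_le_of_lt h2 h1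
      exact lt_of_mul_lt_mul_left h3 hc.le
    obtain ⟨x, hx⟩ := cauchySeq_tendsto_of_complete hcau
    have hmem : (x, f) ∈ T.graph := by
      refine hT.mem_of_tendsto (hx.prodMk_nhds hf) (Filter.Eventually.of_forall fun k => ?_)
      exact mk_mem_graph_iff.2 ⟨(u k).2, hu k⟩
    obtain ⟨h, h'⟩ := mk_mem_graph_iff.1 hmem
    exact ⟨⟨x, h⟩, h'⟩
  have hsurj : LinearMap.range T.toFun = ⊤ := by
    have : CompleteSpace (LinearMap.range T.toFun) := hcl.completeSpace_coe
    rw [← Submodule.orthogonal_eq_bot_iff, Submodule.eq_bot_iff]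
    intro x hx
    refine hr x fun u => ?_
    rw [Submodule.mem_orthogonal'] at hx
    exact hx _ ⟨u, rfl⟩
  let e := LinearEquiv.ofBijective T.toFun ⟨hinj, LinearMap.range_eq_top.1 hsurj⟩
  refine ⟨LinearMap.mkContinuous (T.domain.subtype ∘ₗ e.symm.toLinearMap) c⁻¹ fun f => ?_,
    fun f => ?_, fun u => ?_⟩
  · have := hb (e.symm f)
    have h2 : T (e.symm f) = f := e.apply_symm_apply f
    rw [h2] at this
    rw [inv_mul_eq_div, le_div_iff₀ hc, mul_comm]
    exact this
  · exact ⟨(e.symm f).2, e.apply_symm_apply f⟩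
  · have : e.symm (T u) = u := e.symm_apply_apply u
    change ((e.symm (T u) : T.domain) : K) = u
    rw [this]

/-- A bounded perturbation `C + T` of a self-adjoint operator is boundedly invertible if it and
its adjoint are bounded from below. -/
theorem isBoundedlyInvertible_vadd {T : K →ₗ.[ℂ] K} (hT : IsSelfAdjoint T) {C C' : K →L[ℂ] K}
    (hC : ∀ x y, ⟪C x, y⟫_ℂ = ⟪x, C' y⟫_ℂ) {c : ℝ} (hc : 0 < c)
    (hb : ∀ u : T.domain, c * ‖(u : K)‖ ≤ ‖C u + T u‖)
    (hb' : ∀ u : T.domain, c * ‖(u : K)‖ ≤ ‖C' u + T u‖) :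
    IsBoundedlyInvertible ((C : K →ₗ[ℂ] K) +ᵥ T) := by
  refine isBoundedlyInvertible_of_bound (isClosed_vadd hT.isClosed C) hc hb fun x hx => ?_
  -- A vector orthogonal to the range of `C + T` lies in the kernel of the adjoint `C' + T`, where
  -- the second lower bound applies.
  have hmem : (x, -C' x) ∈ T.graph := by
    refine mem_graph_of_isSelfAdjoint hT fun u => ?_
    have h1 : ⟪x, C u + T u⟫_ℂ = 0 := hx u
    have h2 : ⟪C' x, (u : K)⟫_ℂ = ⟪x, C u⟫_ℂ := by
      rw [← inner_conj_symm, ← hC, inner_conj_symm]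
    rw [inner_neg_left, h2, neg_eq_iff_eq_neg, eq_neg_iff_add_eq_zero, ← inner_add_right, h1]
  obtain ⟨hx1, hx2⟩ := mk_mem_graph_iff.1 hmem
  have h3 := hb' ⟨x, hx1⟩
  rw [hx2] at h3
  simp only [add_neg_cancel, norm_zero] at h3
  have : ‖x‖ ≤ 0 := by
    by_contra h
    push Not at h
    have := mul_pos hc h
    linarith
  exact norm_le_zero_iff.1 this

omit [CompleteSpace K] in
theorem inner_graph_closure {T : K →ₗ.[ℂ] K} (h : T.IsFormalAdjoint T) {p q : K × K}
    (hp : p ∈ T.graph.topologicalClosure) (hq : q ∈ T.graph.topologicalClosure) :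
    ⟪p.2, q.1⟫_ℂ = ⟪p.1, q.2⟫_ℂ := by
  rw [← SetLike.mem_coe, Submodule.topologicalClosure_coe] at hp hq
  have hcl : ∀ a : K × K, IsClosed {b : K × K | ⟪a.2, b.1⟫_ℂ = ⟪a.1, b.2⟫_ℂ} := fun a =>
    isClosed_eq (by fun_prop) (by fun_prop)
  have hcl' : ∀ b : K × K, IsClosed {a : K × K | ⟪a.2, b.1⟫_ℂ = ⟪a.1, b.2⟫_ℂ} := fun a =>
    isClosed_eq (by fun_prop) (by fun_prop)
  have h1 : ∀ a ∈ T.graph, ⟪a.2, q.1⟫_ℂ = ⟪a.1, q.2⟫_ℂ := fun a ha =>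
    closure_minimal (fun b hb => inner_graph_of_isFormalAdjoint h ha hb) (hcl a) hq
  exact closure_minimal (fun a ha => h1 a ha) (hcl' q) hp

-- The inner product of `w` and `u` is real and `z` is imaginary, so the cross term vanishes. For a
-- symmetric `T` this bounds `T - z` from below by `‖z‖`.
omit [CompleteSpace K] in
theorem norm_sub_smul_sq_of_symm {u w : K} (h : ⟪w, u⟫_ℂ = ⟪u, w⟫_ℂ) {z : ℂ} (hz : z.re = 0) :
    ‖w - z • u‖ ^ 2 = ‖w‖ ^ 2 + (‖z‖ * ‖u‖) ^ 2 := by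
  have h1 : (⟪w, u⟫_ℂ).im = 0 := by
    have := inner_conj_symm (𝕜 := ℂ) w u
    rw [← h] at this
    exact Complex.conj_eq_iff_im.1 this
  rw [@norm_sub_sq ℂ, inner_smul_right, norm_smul]
  simp [hz, h1]

theorem isSelfAdjoint_vadd {T : K →ₗ.[ℂ] K} (hT : IsSelfAdjoint T) {C : K →L[ℂ] K}
    (hC : ∀ x y, ⟪C x, y⟫_ℂ = ⟪x, C y⟫_ℂ) : IsSelfAdjoint ((C : K →ₗ[ℂ] K) +ᵥ T) := by
  refine isSelfAdjoint_of_mem_domain hT.dense_domain (fun u v => ?_) fun x w h => ?_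
  · have h1 := isFormalAdjoint_of_isSelfAdjoint hT u v
    change ⟪C u + T u, (v : K)⟫_ℂ = ⟪(u : K), C v + T v⟫_ℂ
    rw [inner_add_left, inner_add_right, hC]
    congr 1
  · have hmem : (x, w - C x) ∈ T.graph := mem_graph_of_isSelfAdjoint hT fun u => by
      have h1 : ⟪w, (u : K)⟫_ℂ = ⟪x, C u + T u⟫_ℂ := h u
      rw [inner_sub_left, h1, inner_add_right, hC, add_sub_cancel_left]
    exact (mk_mem_graph_iff.1 hmem).1

theorem isClosable_of_isFormalAdjoint {T : K →ₗ.[ℂ] K} (hs : T.IsFormalAdjoint T)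
    (hd : Dense (T.domain : Set K)) : T.IsClosable :=
  (adjoint_isClosed hd).isClosable.leIsClosable (hs.le_adjoint hd)

/-- A symmetric operator `T` is essentially self-adjoint if the ranges of `T ± i` are dense (it
suffices to know this for elements of the closure of the graph). -/
theorem isEssentiallySelfAdjoint_of_dense_range {T : K →ₗ.[ℂ] K} (hs : T.IsFormalAdjoint T)
    (hd : Dense (T.domain : Set K))
    (hr : ∀ z : ℂ, z.re = 0 → z ≠ 0 →
      Dense {f : K | ∃ p ∈ T.graph.topologicalClosure, p.2 - z • p.1 = f}) :
    IsEssentiallySelfAdjoint T := by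
  have hcl := isClosable_of_isFormalAdjoint hs hd
  have hgraph : T.closure.graph = T.graph.topologicalClosure :=
    hcl.graph_closure_eq_closure_graph.symm
  have hd' : Dense (T.closure.domain : Set K) := hd.mono T.le_closure.1
  have hs' : T.closure.IsFormalAdjoint T.closure := fun u v =>
    inner_graph_closure hs (p := (u, T.closure u)) (q := (v, T.closure v))
      (hgraph ▸ T.closure.mem_graph u) (hgraph ▸ T.closure.mem_graph v)
  have hinv : ∀ z : ℂ, z.re = 0 → z ≠ 0 → IsBoundedlyInvertible
      (((-(z • ContinuousLinearMap.id ℂ K) : K →L[ℂ] K) : K →ₗ[ℂ] K) +ᵥ T.closure) := by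
    intro z hz hz0
    refine isBoundedlyInvertible_of_bound (isClosed_vadd hcl.closure_isClosed _)
      (norm_pos_iff.2 hz0) (fun u => ?_) fun x hx => ?_
    · have h1 := norm_sub_smul_sq_of_symm (hs' u u) hz
      have h2 : ‖z‖ * ‖(u : K)‖ ≤ ‖T.closure u - z • (u : K)‖ := by
        refine abs_le_of_sq_le_sq' ?_ (norm_nonneg _) |>.2
        rw [h1]
        nlinarith [sq_nonneg ‖T.closure u‖]
      refine h2.trans (le_of_eq ?_)
      rw [sub_eq_neg_add]
      rfl
    · refine (hr z hz hz0).eq_zero_of_inner_left ℂ fun f hf => ?_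
      obtain ⟨⟨u, w⟩, hp, rfl⟩ := hf
      rw [← hgraph] at hp
      obtain ⟨hu, rfl⟩ := mk_mem_graph_iff.1 hp
      have : ⟪x, -(z • u) + T.closure ⟨u, hu⟩⟫_ℂ = 0 := hx ⟨u, hu⟩
      rwa [← sub_eq_neg_add] at this
  refine ⟨hcl, isSelfAdjoint_of_mem_domain hd' hs' fun x w hxw => ?_⟩
  obtain ⟨R, hR, -⟩ := hinv Complex.I (by simp) (by simp)
  obtain ⟨R', hR', -⟩ := hinv (-Complex.I) (by simp) (by simp)
  obtain ⟨hu, hTu⟩ := hR (w - Complex.I • x)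
  set u := R (w - Complex.I • x)
  -- The difference `x - u` is annihilated by the adjoint minus i, hence orthogonal to the range of
  -- the closure plus i. That range is everything, so `x - u` can itself be written as such a value
  -- and is orthogonal to itself.
  have key : x - u = 0 := by
    obtain ⟨hv, hTv⟩ := hR' (x - u)
    set v := R' (x - u)
    rw [← inner_self_eq_zero (𝕜 := ℂ)]
    have e1 : T.closure ⟨v, hv⟩ + Complex.I • v = x - u := by
      have h1 : -(-Complex.I • v) + T.closure ⟨v, hv⟩ = x - u := hTv
      rw [← h1, neg_smul, neg_neg, add_comm]
    have e2 : T.closure ⟨u, hu⟩ - Complex.I • u = w - Complex.I • x := by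
      rw [← hTu, vadd_apply, sub_eq_neg_add]
      rfl
    calc ⟪x - u, x - u⟫_ℂ = ⟪x - u, T.closure ⟨v, hv⟩ + Complex.I • v⟫_ℂ := by rw [e1]
      _ = ⟪(w - Complex.I • x) - (T.closure ⟨u, hu⟩ - Complex.I • u), v⟫_ℂ := by
        have a1 : ⟪w, v⟫_ℂ = ⟪x, T.closure ⟨v, hv⟩⟫_ℂ := hxw ⟨v, hv⟩
        have a2 : ⟪T.closure ⟨u, hu⟩, v⟫_ℂ = ⟪u, T.closure ⟨v, hv⟩⟫_ℂ := hs' ⟨u, hu⟩ ⟨v, hv⟩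
        simp only [inner_sub_left, inner_add_right, inner_smul_left, inner_smul_right, a1, a2,
          Complex.conj_I]
        ring
      _ = 0 := by rw [e2, sub_self, inner_zero_left]
  rw [sub_eq_zero] at key
  rw [key]
  exact hu

end SelfAdjointOperators

end StaticKG

namespace StaticKG

/-! ### Resolvents and square roots of nonnegative self-adjoint operators. -/

section PositiveOperators

variable {K : Type*} [NormedAddCommGroup K] [InnerProductSpace ℂ K] [CompleteSpace K]

/-- A nonnegative self-adjoint operator. -/
structure IsNonnegSelfAdjoint (T : K →ₗ.[ℂ] K) : Prop where
  isSelfAdjoint : IsSelfAdjoint T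
  nonneg : ∀ u : T.domain, 0 ≤ (⟪(u : K), T u⟫_ℂ).re

namespace IsNonnegSelfAdjoint

variable {T : K →ₗ.[ℂ] K} (hT : IsNonnegSelfAdjoint T)
include hT

theorem symm (u v : T.domain) : ⟪T u, (v : K)⟫_ℂ = ⟪(u : K), T v⟫_ℂ :=
  isFormalAdjoint_of_isSelfAdjoint hT.isSelfAdjoint u v

/-- Pairing `(1 + T) u` with `u` gives the lower bound 1, so the default value 0 in `boundedInverse`
does not occur. -/
theorem isBoundedInverse_resolventOne :
    IsBoundedInverse ((LinearMap.id : K →ₗ[ℂ] K) +ᵥ T) (resolventOne T) := by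
  have hb : ∀ u : T.domain, 1 * ‖(u : K)‖ ≤ ‖ContinuousLinearMap.id ℂ K u + T u‖ := by
    intro u
    have h1 : ‖(u : K)‖ ^ 2 ≤ ‖(u : K)‖ * ‖(u : K) + T u‖ := by
      have h2 : (⟪(u : K), (u : K) + T u⟫_ℂ).re ≤ ‖(u : K)‖ * ‖(u : K) + T u‖ :=
        (Complex.re_le_norm _).trans (norm_inner_le_norm _ _)
      rw [inner_add_right, inner_self_eq_norm_sq_to_K, Complex.add_re] at h2
      have h3 : (((‖(u : K)‖ : ℝ) : ℂ) ^ 2).re = ‖(u : K)‖ ^ 2 := by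
        rw [← Complex.ofReal_pow, Complex.ofReal_re]
      have h4 := hT.nonneg u
      simp only [Complex.coe_algebraMap, h3] at h2
      linarith
    rw [one_mul]
    rcases (norm_nonneg (u : K)).eq_or_lt with h | h
    · rw [← h]; exact norm_nonneg _
    · rw [sq] at h1
      exact le_of_mul_le_mul_left h1 h
  have := isBoundedlyInvertible_vadd hT.isSelfAdjoint
    (C := ContinuousLinearMap.id ℂ K) (C' := ContinuousLinearMap.id ℂ K) (fun x y => rfl)
    one_pos hb hb
  obtain ⟨R, hR⟩ := this
  have hR' : IsBoundedInverse ((LinearMap.id : K →ₗ[ℂ] K) +ᵥ T) R := hR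
  rw [resolventOne, boundedInverse_eq hR']
  exact hR'

theorem resolventOne_mem (f : K) : resolventOne T f ∈ T.domain :=
  (hT.isBoundedInverse_resolventOne.1 f).1

theorem apply_resolventOne (f : K) :
    T ⟨resolventOne T f, hT.resolventOne_mem f⟩ = f - resolventOne T f := by
  obtain ⟨h, h'⟩ := hT.isBoundedInverse_resolventOne.1 f
  rw [eq_sub_iff_add_eq']
  exact h'

theorem resolventOne_apply (u : T.domain) : resolventOne T ((u : K) + T u) = u :=
  hT.isBoundedInverse_resolventOne.2 u

theorem exists_eq_resolventOne (u : T.domain) :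
    ∃ f : K, (u : K) = resolventOne T f ∧ T u = f - u ∧ f = u + T u :=
  ⟨u + T u, (hT.resolventOne_apply u).symm, by abel, rfl⟩

theorem inner_resolventOne_right (f g : K) : ⟪f, resolventOne T g⟫_ℂ =
    ⟪resolventOne T f, resolventOne T g⟫_ℂ +
      ⟪T ⟨resolventOne T f, hT.resolventOne_mem f⟩, resolventOne T g⟫_ℂ := by
  rw [← inner_add_left, hT.apply_resolventOne]
  simp

theorem inner_resolventOne_left (f g : K) : ⟪resolventOne T f, g⟫_ℂ = ⟪f, resolventOne T g⟫_ℂ := by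
  have h1 := hT.inner_resolventOne_right g f
  have h2 := hT.inner_resolventOne_right f g
  rw [hT.symm ⟨_, hT.resolventOne_mem f⟩ ⟨_, hT.resolventOne_mem g⟩] at h2
  have h3 := congrArg (starRingEnd ℂ) h1
  rw [inner_conj_symm, map_add, inner_conj_symm, inner_conj_symm] at h3
  rw [h3, h2]

theorem resolventOne_nonneg : 0 ≤ resolventOne T := by
  rw [ContinuousLinearMap.nonneg_iff_isPositive]
  refine ⟨fun f g => hT.inner_resolventOne_left f g, fun f => ?_⟩
  rw [ContinuousLinearMap.reApplyInnerSelf_apply, hT.inner_resolventOne_left,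
    hT.inner_resolventOne_right, hT.symm ⟨_, hT.resolventOne_mem f⟩ ⟨_, hT.resolventOne_mem f⟩]
  have h1 := hT.nonneg ⟨_, hT.resolventOne_mem f⟩
  have h2 : 0 ≤ (⟪resolventOne T f, resolventOne T f⟫_ℂ).re :=
    inner_self_nonneg (𝕜 := ℂ) (x := resolventOne T f)
  exact add_nonneg h2 h1

theorem one_sub_resolventOne_nonneg : 0 ≤ 1 - resolventOne T := by
  rw [ContinuousLinearMap.nonneg_iff_isPositive]
  have hs : ∀ f g : K, ⟪(1 - resolventOne T) f, g⟫_ℂ = ⟪f, (1 - resolventOne T) g⟫_ℂ := fun f g => by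
    simp [hT.inner_resolventOne_left]
  refine ⟨hs, fun f => ?_⟩
  rw [ContinuousLinearMap.reApplyInnerSelf_apply]
  have h1 : ⟪(1 - resolventOne T) f, f⟫_ℂ =
      ⟪(1 - resolventOne T) f, (1 - resolventOne T) f⟫_ℂ +
        ⟪T ⟨_, hT.resolventOne_mem f⟩, resolventOne T f⟫_ℂ := by
    have h2 : (1 - resolventOne T) f = T ⟨_, hT.resolventOne_mem f⟩ := by
      rw [hT.apply_resolventOne]; rfl
    rw [← h2, ← inner_add_right]
    congr 1
    simp
  rw [h1, hT.symm ⟨_, hT.resolventOne_mem f⟩ ⟨_, hT.resolventOne_mem f⟩]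
  exact add_nonneg (inner_self_nonneg (𝕜 := ℂ) (x := (1 - resolventOne T) f))
    (hT.nonneg ⟨_, hT.resolventOne_mem f⟩)

omit hT in
theorem inner_sqrt_left (R : K →L[ℂ] K) (f g : K) :
    ⟪CFC.sqrt R f, g⟫_ℂ = ⟪f, CFC.sqrt R g⟫_ℂ :=
  ((ContinuousLinearMap.nonneg_iff_isPositive _).1 (CFC.sqrt_nonneg R)).isSymmetric f g

omit hT in
theorem inner_sqrt_sqrt {R : K →L[ℂ] K} (hR : 0 ≤ R) (f g : K) :
    ⟪CFC.sqrt R f, CFC.sqrt R g⟫_ℂ = ⟪f, R g⟫_ℂ := by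
  rw [inner_sqrt_left]
  have := CFC.sqrt_mul_sqrt_self R hR
  conv_rhs => rw [← this]
  rfl

omit hT in
theorem inner_invSqrt_left (f g : K) : ⟪invSqrtOneAdd T f, g⟫_ℂ = ⟪f, invSqrtOneAdd T g⟫_ℂ :=
  inner_sqrt_left _ f g

theorem inner_invSqrt_invSqrt (f g : K) :
    ⟪invSqrtOneAdd T f, invSqrtOneAdd T g⟫_ℂ = ⟪f, resolventOne T g⟫_ℂ :=
  inner_sqrt_sqrt hT.resolventOne_nonneg f g

theorem invSqrt_invSqrt (f : K) : invSqrtOneAdd T (invSqrtOneAdd T f) = resolventOne T f := by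
  have := CFC.sqrt_mul_sqrt_self (resolventOne T) hT.resolventOne_nonneg
  conv_rhs => rw [← this]
  rfl

theorem resolventOne_injective {f : K} (h : resolventOne T f = 0) : f = 0 := by
  have h1 := hT.apply_resolventOne f
  have h2 : (⟨resolventOne T f, hT.resolventOne_mem f⟩ : T.domain) = 0 := Subtype.ext h
  rw [h2, LinearPMap.map_zero, h, sub_zero] at h1
  exact h1.symm

theorem invSqrt_eq_zero {f : K} (h : invSqrtOneAdd T f = 0) : f = 0 := by
  apply hT.resolventOne_injective
  rw [← hT.invSqrt_invSqrt, h, map_zero]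

omit hT in
theorem denseRange_of_symm {A : K →L[ℂ] K} (hA : ∀ f g, ⟪A f, g⟫_ℂ = ⟪f, A g⟫_ℂ)
    (h0 : ∀ f, A f = 0 → f = 0) : DenseRange A := by
  have : (LinearMap.range (A : K →ₗ[ℂ] K)).topologicalClosure = ⊤ := by
    rw [Submodule.topologicalClosure_eq_top_iff, Submodule.eq_bot_iff]
    intro x hx
    apply h0
    rw [← inner_self_eq_zero (𝕜 := ℂ), hA]
    rw [Submodule.mem_orthogonal'] at hx
    exact hx _ ⟨A x, rfl⟩
  have h := Submodule.dense_iff_topologicalClosure_eq_top.2 this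
  exact h

theorem denseRange_invSqrt : DenseRange (invSqrtOneAdd T) :=
  denseRange_of_symm inner_invSqrt_left fun _ => hT.invSqrt_eq_zero

/-- The form of `1 + T` in terms of the square root of the resolvent. -/
theorem norm_invSqrt_add_sq (v : T.domain) : ‖invSqrtOneAdd T ((v : K) + T v)‖ ^ 2 =
    ‖(v : K)‖ ^ 2 + (⟪(v : K), T v⟫_ℂ).re := by
  have h := hT.inner_invSqrt_invSqrt ((v : K) + T v) ((v : K) + T v)
  rw [hT.resolventOne_apply, inner_add_left, hT.symm] at h
  have h2 := congrArg Complex.re h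
  rw [Complex.add_re] at h2
  have h3 : ∀ x : K, (⟪x, x⟫_ℂ).re = ‖x‖ ^ 2 := fun x => inner_self_eq_norm_sq (𝕜 := ℂ) x
  rwa [h3, h3] at h2

theorem invSqrt_invSqrt_add (v : T.domain) :
    invSqrtOneAdd T (invSqrtOneAdd T ((v : K) + T v)) = v := by
  rw [hT.invSqrt_invSqrt, hT.resolventOne_apply]

/-- The form domain of `T` consists of the vectors `x` for which `(x | (1 + T) v)` is bounded in
the norm given by the form of `1 + T`. -/
theorem exists_invSqrt_eq_of_bound {x : K} {C : ℝ} (hC0 : 0 ≤ C)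
    (hC : ∀ v : T.domain, ‖⟪x, (v : K) + T v⟫_ℂ‖ ≤
      C * √(‖(v : K)‖ ^ 2 + (⟪(v : K), T v⟫_ℂ).re)) :
    ∃ f, invSqrtOneAdd T f = x ∧ ‖f‖ ≤ C := by
  set J := invSqrtOneAdd T
  have hbound : ∀ y : K, ‖⟪x, y⟫_ℂ‖ ≤ C * ‖J y‖ := by
    intro y
    have h1 := hC ⟨_, hT.resolventOne_mem y⟩
    have h2 : resolventOne T y + T ⟨_, hT.resolventOne_mem y⟩ = y := by
      rw [hT.apply_resolventOne]; abel
    rw [← hT.norm_invSqrt_add_sq, Real.sqrt_sq (norm_nonneg _)] at h1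
    simpa only [h2] using h1
  have hinj : ∀ y, J y = 0 → y = 0 := fun y => hT.invSqrt_eq_zero
  let e : K ≃ₗ[ℂ] LinearMap.range (J : K →ₗ[ℂ] K) :=
    LinearEquiv.ofInjective (J : K →ₗ[ℂ] K) (by
      rw [← LinearMap.ker_eq_bot, LinearMap.ker_eq_bot']
      exact hinj)
  -- The functional sends `J y` to the inner product of `x` and `y`; injectivity of `J` makes it
  -- well defined and `hbound` makes it bounded. A Hahn–Banach extension is represented by a vector
  -- `f` with (f | J y) = (x | y) for all `y`, that is, `J f = x`.
  let φ : LinearMap.range (J : K →ₗ[ℂ] K) →ₗ[ℂ] ℂ := (innerₛₗ ℂ x) ∘ₗ e.symm.toLinearMap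
  have hφ : ∀ w, ‖φ w‖ ≤ C * ‖w‖ := by
    intro w
    obtain ⟨y, rfl⟩ := e.surjective w
    have : φ (e y) = ⟪x, y⟫_ℂ := by simp [φ]
    rw [this]
    exact hbound y
  let Φ : StrongDual ℂ (LinearMap.range (J : K →ₗ[ℂ] K)) := φ.mkContinuous C hφ
  obtain ⟨g, hg, hgn⟩ := exists_extension_norm_eq _ Φ
  refine ⟨(InnerProductSpace.toDual ℂ K).symm g, ?_, ?_⟩
  swap
  · rw [LinearIsometryEquiv.norm_map, hgn]
    exact LinearMap.mkContinuous_norm_le _ hC0 _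
  refine ext_inner_right ℂ fun y => ?_
  rw [inner_invSqrt_left, InnerProductSpace.toDual_symm_apply]
  have h1 := hg (e y)
  have h2 : Φ (e y) = ⟪x, y⟫_ℂ := by
    change φ (e y) = _
    simp [φ]
  rw [h2] at h1
  exact h1

/-- The bound that characterizes the elements of the form domain. -/
theorem norm_inner_invSqrt_le (f : K) (v : T.domain) :
    ‖⟪invSqrtOneAdd T f, (v : K) + T v⟫_ℂ‖ ≤
      ‖f‖ * √(‖(v : K)‖ ^ 2 + (⟪(v : K), T v⟫_ℂ).re) := by
  rw [← hT.norm_invSqrt_add_sq, Real.sqrt_sq (norm_nonneg _), inner_invSqrt_left]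
  exact norm_inner_le_norm _ _

/-- An operator core is a form core. -/
theorem dense_invSqrt_add {D : Set K}
    (hcore : ∀ p ∈ T.graph, p ∈ closure {p : K × K | p ∈ T.graph ∧ p.1 ∈ D}) :
    Dense {f : K | ∃ v : T.domain, (v : K) ∈ D ∧ invSqrtOneAdd T ((v : K) + T v) = f} := by
  have h1 : Dense {g : K | ∃ v : T.domain, (v : K) ∈ D ∧ (v : K) + T v = g} := by
    intro g
    have hp : (resolventOne T g, g - resolventOne T g) ∈ T.graph :=
      mk_mem_graph_iff.2 ⟨hT.resolventOne_mem g, hT.apply_resolventOne g⟩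
    have hc := hcore _ hp
    have hcont : Continuous fun p : K × K => p.1 + p.2 := by fun_prop
    have := map_mem_closure hcont hc
      (t := {g : K | ∃ v : T.domain, (v : K) ∈ D ∧ (v : K) + T v = g}) (by
        rintro ⟨u, w⟩ ⟨hp, hu⟩
        obtain ⟨h, rfl⟩ := mk_mem_graph_iff.1 hp
        exact ⟨⟨u, h⟩, hu, rfl⟩)
    simpa using this
  have h2 := hT.denseRange_invSqrt.dense_image (invSqrtOneAdd T).continuous h1
  refine h2.mono ?_
  rintro _ ⟨_, ⟨v, hv, rfl⟩, rfl⟩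
  exact ⟨v, hv, rfl⟩

theorem norm_invSqrt_le (f : K) : ‖invSqrtOneAdd T f‖ ≤ ‖f‖ := by
  have h1 := hT.inner_invSqrt_invSqrt f f
  have h2 := ((ContinuousLinearMap.nonneg_iff_isPositive _).1
    hT.one_sub_resolventOne_nonneg).re_inner_nonneg_right f
  have h3 : ∀ x : K, (⟪x, x⟫_ℂ).re = ‖x‖ ^ 2 := fun x => inner_self_eq_norm_sq (𝕜 := ℂ) x
  have h4 : (1 - resolventOne T) f = f - resolventOne T f := by simp
  rw [h4, inner_sub_right, ← h1, map_sub] at h2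
  change 0 ≤ (⟪f, f⟫_ℂ).re - (⟪invSqrtOneAdd T f, invSqrtOneAdd T f⟫_ℂ).re at h2
  rw [h3, h3] at h2
  exact abs_le_of_sq_le_sq' (by linarith) (norm_nonneg _) |>.2

/-- If `T² ≥ c² T` in the sense of forms and `Ker T = 0`, then `T` is bounded from below. -/
theorem exists_bound_of_form_bound (hinj : ∀ v : T.domain, T v = 0 → (v : K) = 0) {c : ℝ}
    (hc : 0 < c) (hb : ∀ v : T.domain, c * (⟪(v : K), T v⟫_ℂ).re ≤ ‖T v‖ ^ 2) :
    ∃ d : ℝ, 0 < d ∧ ∀ v : T.domain, d * ‖(v : K)‖ ≤ ‖T v‖ := by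
  set A := 1 - resolventOne T with hA
  have hA0 : 0 ≤ A := hT.one_sub_resolventOne_nonneg
  have hAf : ∀ f, A f = T ⟨_, hT.resolventOne_mem f⟩ := fun f => by
    rw [hT.apply_resolventOne]; rfl
  set Q := CFC.sqrt A with hQ
  have hQQ : ∀ f, Q (Q f) = A f := fun f => by
    conv_rhs => rw [← CFC.sqrt_mul_sqrt_self A hA0]
    rfl
  have hQ0 : ∀ f, Q f = 0 → f = 0 := fun f hf => by
    have h1 : A f = 0 := by rw [← hQQ, hf, map_zero]
    rw [hAf] at h1
    exact hT.resolventOne_injective (hinj _ h1)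
  have h3 : ∀ x : K, (⟪x, x⟫_ℂ).re = ‖x‖ ^ 2 := fun x => inner_self_eq_norm_sq (𝕜 := ℂ) x
  -- With v = (1 + T)⁻¹ f one has T v = A f and (v | T v) = ‖Q f‖² − ‖A f‖². The hypothesis thus
  -- bounds `Q` from below on vectors `Q f`, and these are dense because `Q` is symmetric and
  -- injective.
  have hlow : ∀ y, c / (1 + c) * ‖y‖ ^ 2 ≤ ‖Q y‖ ^ 2 := by
    have hcl : IsClosed {y : K | c / (1 + c) * ‖y‖ ^ 2 ≤ ‖Q y‖ ^ 2} :=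
      isClosed_le (by fun_prop) (by fun_prop)
    refine fun y => (denseRange_of_symm (inner_sqrt_left A) hQ0).induction_on y hcl fun f => ?_
    have h1 := hb ⟨_, hT.resolventOne_mem f⟩
    rw [← hAf] at h1
    have h2 : resolventOne T f = f - A f := by simp [hA]
    have h4 : (⟪f, A f⟫_ℂ).re = ‖Q f‖ ^ 2 := by rw [← inner_sqrt_sqrt hA0, h3]
    simp only [h2] at h1
    rw [inner_sub_left, Complex.sub_re, h3, h4] at h1
    change c / (1 + c) * ‖Q f‖ ^ 2 ≤ ‖Q (Q f)‖ ^ 2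
    rw [hQQ, div_mul_eq_mul_div, div_le_iff₀ (by positivity)]
    linarith
  refine ⟨c / (1 + c), by positivity, fun v => ?_⟩
  obtain ⟨f, hf, hTf, -⟩ := hT.exists_eq_resolventOne v
  have h1 : T v = A f := by rw [hTf, hf]; rfl
  have h2 : ‖(v : K)‖ ≤ ‖f‖ := by
    rw [hf, ← hT.invSqrt_invSqrt]
    exact (hT.norm_invSqrt_le _).trans (hT.norm_invSqrt_le _)
  -- Since A = Q², the lower bound for `Q` is used twice, at `f` and at `Q f`.
  have h5 : c / (1 + c) * ‖f‖ ≤ ‖A f‖ := by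
    have e1 := hlow f
    have e2 := hlow (Q f)
    rw [hQQ] at e2
    refine abs_le_of_sq_le_sq' ?_ (norm_nonneg _) |>.2
    have h0 : 0 ≤ c / (1 + c) := by positivity
    calc (c / (1 + c) * ‖f‖) ^ 2 = c / (1 + c) * (c / (1 + c) * ‖f‖ ^ 2) := by ring
      _ ≤ c / (1 + c) * ‖Q f‖ ^ 2 := by gcongr
      _ ≤ _ := e2
  rw [h1]
  exact le_trans (by gcongr) h5

end IsNonnegSelfAdjoint

end PositiveOperators

/-! ### The form domain with its energy product. -/

section FormDomains

variable {K : Type*} [NormedAddCommGroup K] [InnerProductSpace ℂ K] [CompleteSpace K]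

namespace IsNonnegSelfAdjoint

variable {T : K →ₗ.[ℂ] K} (hT : IsNonnegSelfAdjoint T)
include hT

/-- `toLinearPMap` keeps the prescribed graph only if this is single valued; here that is the
injectivity of (1 + T)^{-1/2}. -/
theorem sqrtOp_graph : (sqrtOp T).graph = LinearMap.range ((invSqrtOneAdd T : K →ₗ[ℂ] K).prod
    (CFC.sqrt (1 - resolventOne T) : K →L[ℂ] K).toLinearMap) := by
  refine Submodule.toLinearPMap_graph_eq _ ?_
  rintro _ ⟨f, rfl⟩ hf
  have : f = 0 := hT.invSqrt_eq_zero hf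
  simp [this]

/-- The element `(1 + T)^{-1/2} f` of the form domain of `T`. -/
theorem exists_formDomain (f : K) : ∃ u : FormDomain T, FormDomain.val T u = invSqrtOneAdd T f ∧
    FormDomain.sqrtMap T u = CFC.sqrt (1 - resolventOne T) f := by
  have h : (invSqrtOneAdd T f, CFC.sqrt (1 - resolventOne T) f) ∈ (sqrtOp T).graph := by
    rw [hT.sqrtOp_graph]
    exact ⟨f, rfl⟩
  obtain ⟨h1, h2⟩ := mk_mem_graph_iff.1 h
  exact ⟨⟨_, h1⟩, rfl, h2⟩

theorem exists_eq_invSqrt (u : FormDomain T) : ∃ f : K, FormDomain.val T u = invSqrtOneAdd T f ∧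
    FormDomain.sqrtMap T u = CFC.sqrt (1 - resolventOne T) f := by
  have h : (FormDomain.val T u, FormDomain.sqrtMap T u) ∈ (sqrtOp T).graph :=
    (sqrtOp T).mem_graph u
  rw [hT.sqrtOp_graph] at h
  obtain ⟨f, hf⟩ := h
  exact ⟨f, (congrArg Prod.fst hf).symm, (congrArg Prod.snd hf).symm⟩

omit hT in
theorem _root_.StaticKG.FormDomain.inner_def (u v : FormDomain T) :
    ⟪u, v⟫_ℂ = ⟪FormDomain.sqrtMap T u, FormDomain.sqrtMap T v⟫_ℂ := rfl

omit hT in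
theorem _root_.StaticKG.FormDomain.val_injective {u v : FormDomain T}
    (h : FormDomain.val T u = FormDomain.val T v) : u = v :=
  Subtype.ext h

/-- The form of `1 + T` at (1 + T)^{-1/2} f and (1 + T)^{-1/2} g is (f | g), and the energy product
is this form minus the inner product of the ambient space. -/
theorem inner_formDomain {u v : FormDomain T} {f g : K}
    (hu : FormDomain.val T u = invSqrtOneAdd T f) (hv : FormDomain.val T v = invSqrtOneAdd T g) :
    ⟪u, v⟫_ℂ = ⟪f, g⟫_ℂ - ⟪FormDomain.val T u, FormDomain.val T v⟫_ℂ := by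
  have key : ∀ {w : FormDomain T} {h : K}, FormDomain.val T w = invSqrtOneAdd T h →
      FormDomain.sqrtMap T w = CFC.sqrt (1 - resolventOne T) h := by
    intro w h hw
    obtain ⟨h', h1, h2⟩ := hT.exists_eq_invSqrt w
    have : h - h' = 0 := by
      apply hT.invSqrt_eq_zero
      rw [map_sub, ← hw, ← h1, sub_self]
    rw [sub_eq_zero.1 this, h2]
  rw [FormDomain.inner_def, key hu, key hv, inner_sqrt_sqrt hT.one_sub_resolventOne_nonneg, hu, hv,
    hT.inner_invSqrt_invSqrt]
  simp

/-- The domain of `T` is contained in its form domain, and the energy product extends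
`(u | T v)`. -/
theorem exists_formDomain_of_mem (v : T.domain) : ∃ v' : FormDomain T,
    FormDomain.val T v' = v ∧ ∀ u : FormDomain T, ⟪u, v'⟫_ℂ = ⟪FormDomain.val T u, T v⟫_ℂ := by
  obtain ⟨v', h1, -⟩ := hT.exists_formDomain (invSqrtOneAdd T ((v : K) + T v))
  refine ⟨v', h1.trans (hT.invSqrt_invSqrt_add v), fun u => ?_⟩
  obtain ⟨f, hf, -⟩ := hT.exists_eq_invSqrt u
  rw [hT.inner_formDomain hf h1, ← inner_invSqrt_left, ← hf, h1, hT.invSqrt_invSqrt_add,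
    ← inner_sub_right]
  simp

theorem norm_formDomain_le {u : FormDomain T} {f : K}
    (hu : FormDomain.val T u = invSqrtOneAdd T f) : ‖u‖ ≤ ‖f‖ := by
  have h := hT.inner_formDomain hu hu
  have h2 := congrArg Complex.re h
  rw [Complex.sub_re] at h2
  have h3 : ∀ x : K, (⟪x, x⟫_ℂ).re = ‖x‖ ^ 2 := fun x => inner_self_eq_norm_sq (𝕜 := ℂ) x
  have h4 : (⟪u, u⟫_ℂ).re = ‖u‖ ^ 2 := inner_self_eq_norm_sq (𝕜 := ℂ) u
  rw [h3, h3, h4] at h2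
  refine abs_le_of_sq_le_sq' ?_ (norm_nonneg _) |>.2
  nlinarith [sq_nonneg ‖FormDomain.val T u‖]

/-- The domain of `T`, and more generally an operator core, is dense in the form domain. -/
theorem dense_formDomain {D : Set K}
    (hcore : ∀ p ∈ T.graph, p ∈ closure {p : K × K | p ∈ T.graph ∧ p.1 ∈ D}) :
    Dense {u : FormDomain T | FormDomain.val T u ∈ T.domain ∧ FormDomain.val T u ∈ D} := by
  intro u
  rw [Metric.mem_closure_iff]
  intro ε hε
  obtain ⟨f, hf, -⟩ := hT.exists_eq_invSqrt u
  obtain ⟨_, ⟨v, hv, rfl⟩, hx⟩ := Metric.mem_closure_iff.1 (hT.dense_invSqrt_add hcore f) ε hε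
  obtain ⟨w, hw, -⟩ := hT.exists_formDomain (invSqrtOneAdd T ((v : K) + T v))
  rw [hT.invSqrt_invSqrt_add] at hw
  refine ⟨w, ⟨hw ▸ v.2, hw ▸ hv⟩, ?_⟩
  rw [dist_eq_norm] at hx ⊢
  refine lt_of_le_of_lt (hT.norm_formDomain_le (f := f - invSqrtOneAdd T (v + T v)) ?_) hx
  rw [map_sub, map_sub, hf, hw, hT.invSqrt_invSqrt_add]

/-- The inclusion of the domain of `T` in its form domain. -/
noncomputable def toForm (v : T.domain) : FormDomain T := (hT.exists_formDomain_of_mem v).choose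

theorem val_toForm (v : T.domain) : FormDomain.val T (hT.toForm v) = v :=
  (hT.exists_formDomain_of_mem v).choose_spec.1

theorem inner_toForm (u : FormDomain T) (v : T.domain) :
    ⟪u, hT.toForm v⟫_ℂ = ⟪FormDomain.val T u, T v⟫_ℂ :=
  (hT.exists_formDomain_of_mem v).choose_spec.2 u

theorem norm_toForm_sq (v : T.domain) : ‖hT.toForm v‖ ^ 2 = (⟪(v : K), T v⟫_ℂ).re := by
  have h := inner_self_eq_norm_sq (𝕜 := ℂ) (hT.toForm v)
  rw [← h, hT.inner_toForm, hT.val_toForm]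
  rfl

/-- If `T` is injective then the seminorm of the form domain is a norm. -/
theorem eq_zero_of_norm_formDomain (hinj : ∀ v : T.domain, T v = 0 → (v : K) = 0)
    {u : FormDomain T} (hu : ‖u‖ = 0) : u = 0 := by
  obtain ⟨f, h1, h2⟩ := hT.exists_eq_invSqrt u
  have h3 : ‖FormDomain.sqrtMap T u‖ = 0 := hu
  rw [norm_eq_zero, h2] at h3
  have h4 : f - resolventOne T f = 0 := by
    have := CFC.sqrt_mul_sqrt_self (1 - resolventOne T) hT.one_sub_resolventOne_nonneg
    have h5 : (1 - resolventOne T) f = 0 := by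
      rw [← this]
      change CFC.sqrt (1 - resolventOne T) (CFC.sqrt (1 - resolventOne T) f) = 0
      rw [h3, map_zero]
    simpa using h5
  have h5 : f = 0 := by
    rw [sub_eq_zero.1 h4]
    refine hinj ⟨_, hT.resolventOne_mem f⟩ ?_
    rw [hT.apply_resolventOne, h4]
  apply FormDomain.val_injective
  rw [h1, h5, map_zero, map_zero]

end IsNonnegSelfAdjoint

end FormDomains

end StaticKG

namespace StaticKG

/-! ### The Hamiltonian H and its comparison with L. -/

section Hamiltonian

variable {K : Type*} [NormedAddCommGroup K] [InnerProductSpace ℂ K] [CompleteSpace K]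

/-- `H` is the positive injective operator `(L V; V 1)` with domain `Dom L ⊕ K`, where `L` is
self-adjoint and `V` is bounded and self-adjoint. -/
structure IsHamiltonian (L : K →ₗ.[ℂ] K) (V : K →L[ℂ] K)
    (H : WithLp 2 (K × K) →ₗ.[ℂ] WithLp 2 (K × K)) : Prop where
  isSelfAdjoint : IsSelfAdjoint L
  inner_V : ∀ x y, ⟪V x, y⟫_ℂ = ⟪x, V y⟫_ℂ
  mem_graph_iff : ∀ u w, (u, w) ∈ H.graph ↔
    (u.fst, w.fst - V u.snd) ∈ L.graph ∧ w.snd = V u.fst + u.snd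
  pos : IsPositiveInjective H

namespace IsHamiltonian

variable {L : K →ₗ.[ℂ] K} {V : K →L[ℂ] K} {H : WithLp 2 (K × K) →ₗ.[ℂ] WithLp 2 (K × K)}
  (h : IsHamiltonian L V H)
include h

omit [CompleteSpace K] h in
theorem re_inner_self (x : K) : (⟪x, x⟫_ℂ).re = ‖x‖ ^ 2 := inner_self_eq_norm_sq (𝕜 := ℂ) x

omit [CompleteSpace K] h in
theorem inner_prod (u w : WithLp 2 (K × K)) :
    ⟪u, w⟫_ℂ = ⟪u.fst, w.fst⟫_ℂ + ⟪u.snd, w.snd⟫_ℂ := rfl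

theorem mem_graph {x y : K} {a : L.domain} {g : K} (hx : x = L a + V g) (hy : y = V a + g) :
    (WithLp.toLp 2 ((a : K), g), WithLp.toLp 2 (x, y)) ∈ H.graph := by
  rw [h.mem_graph_iff]
  refine ⟨?_, hy⟩
  have : x - V g = L a := by rw [hx, add_sub_cancel_right]
  change ((a : K), x - V g) ∈ L.graph
  rw [this]
  exact L.mem_graph a

theorem mem_domain_iff (u : WithLp 2 (K × K)) : u ∈ H.domain ↔ u.fst ∈ L.domain := by
  constructor
  · intro hu
    have := (h.mem_graph_iff u _).1 (H.mem_graph ⟨u, hu⟩)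
    exact (mk_mem_graph_iff.1 this.1).1
  · intro hu
    have := h.mem_graph (a := ⟨u.fst, hu⟩) (g := u.snd) rfl rfl
    exact (mk_mem_graph_iff.1 this).1

theorem dense_domain : Dense (H.domain : Set (WithLp 2 (K × K))) := by
  have h1 : Dense ((L.domain : Set K) ×ˢ (Set.univ : Set K)) :=
    h.isSelfAdjoint.dense_domain.prod dense_univ
  have h2 := (WithLp.prodContinuousLinearEquiv 2 ℂ K K).symm.surjective.denseRange.dense_image
    (WithLp.prodContinuousLinearEquiv 2 ℂ K K).symm.continuous h1
  refine h2.mono ?_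
  rintro _ ⟨⟨a, b⟩, hab, rfl⟩
  exact (h.mem_domain_iff _).2 hab.1

theorem inner_L {a a' b b' : K} (ha : (a, a') ∈ L.graph) (hb : (b, b') ∈ L.graph) :
    ⟪a', b⟫_ℂ = ⟪a, b'⟫_ℂ :=
  inner_graph_of_isFormalAdjoint (isFormalAdjoint_of_isSelfAdjoint h.isSelfAdjoint) ha hb

/-- Testing an element of the domain of the adjoint against vectors (a, 0) puts its first component
in the domain of the adjoint of `L`, which is `L` itself. The remaining entries of H are bounded and
symmetric. -/
theorem isNonnegSelfAdjoint_H : IsNonnegSelfAdjoint H := by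
  refine ⟨isSelfAdjoint_of_mem_domain h.dense_domain (fun u v => ?_) fun x w hxw => ?_,
    fun u => (h.pos.1 u).1⟩
  · obtain ⟨hu, hu'⟩ := (h.mem_graph_iff _ _).1 (H.mem_graph u)
    obtain ⟨hv, hv'⟩ := (h.mem_graph_iff _ _).1 (H.mem_graph v)
    have := h.inner_L hu hv
    rw [inner_sub_left, inner_sub_right] at this
    rw [inner_prod, inner_prod, hu', hv', inner_add_left, inner_add_right]
    linear_combination this + h.inner_V (u : WithLp 2 (K × K)).snd (v : WithLp 2 (K × K)).fst +
      h.inner_V (u : WithLp 2 (K × K)).fst (v : WithLp 2 (K × K)).snd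
  · rw [h.mem_domain_iff]
    have : (x.fst, w.fst - V x.snd) ∈ L.graph :=
      mem_graph_of_isSelfAdjoint h.isSelfAdjoint fun a => by
        obtain ⟨ha, ha'⟩ := mk_mem_graph_iff.1 (h.mem_graph (a := a) (g := 0) rfl rfl)
        have := hxw ⟨_, ha⟩
        rw [ha', inner_prod, inner_prod] at this
        simp only [WithLp.toLp_fst, WithLp.toLp_snd, map_zero, add_zero, inner_zero_right] at this
        rw [inner_sub_left, this, h.inner_V, add_sub_cancel_right]
    exact (mk_mem_graph_iff.1 this).1

/-- The form of `L - V²` is nonnegative. -/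
theorem form_nonneg (a : L.domain) : 0 ≤ (⟪(a : K), L a - V (V a)⟫_ℂ).re := by
  -- The second component −Va minimises the form of H for given first component a, and H(a, −Va) =
  -- (La − V²a, 0).
  obtain ⟨hu, hu'⟩ := mk_mem_graph_iff.1 (h.mem_graph (a := a) (g := -V a) rfl rfl)
  have := (h.pos.1 ⟨_, hu⟩).1
  rw [hu', inner_prod] at this
  simpa [← sub_eq_add_neg] using this

theorem form_im (a : L.domain) : (⟪(a : K), L a - V (V a)⟫_ℂ).im = 0 := by
  obtain ⟨hu, hu'⟩ := mk_mem_graph_iff.1 (h.mem_graph (a := a) (g := -V a) rfl rfl)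
  have := (h.pos.1 ⟨_, hu⟩).2
  rw [hu', inner_prod] at this
  simpa [← sub_eq_add_neg] using this

theorem eq_zero_of_sub_eq_zero (a : L.domain) (ha : L a - V (V a) = 0) : (a : K) = 0 := by
  obtain ⟨hu, hu'⟩ := mk_mem_graph_iff.1 (h.mem_graph (a := a) (g := -V a) rfl rfl)
  have := h.pos.2 ⟨_, hu⟩ (by
    rw [hu']
    simp only [map_neg, add_neg_cancel, ← sub_eq_add_neg, ha]
    rfl)
  exact congrArg WithLp.fst this

/-- The form of `L` dominates that of V², which is a square. -/
theorem isNonnegSelfAdjoint_L : IsNonnegSelfAdjoint L := by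
  refine ⟨h.isSelfAdjoint, fun a => ?_⟩
  have h1 := h.form_nonneg a
  rw [inner_sub_right, ← h.inner_V, Complex.sub_re, re_inner_self] at h1
  nlinarith [sq_nonneg ‖V (a : K)‖]

/-- The form of `L` is bounded by the form of `H`. -/
theorem form_L_le (v : H.domain) (a : L.domain) (ha : (v : WithLp 2 (K × K)).fst = a) :
    ‖(a : K)‖ ^ 2 + (⟪(a : K), L a⟫_ℂ).re ≤
      (1 + ‖V‖) ^ 2 * (‖(v : WithLp 2 (K × K))‖ ^ 2 + (⟪(v : WithLp 2 (K × K)), H v⟫_ℂ).re) := by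
  obtain ⟨hv, hv'⟩ := (h.mem_graph_iff _ _).1 (H.mem_graph v)
  obtain ⟨ha', hL⟩ := mk_mem_graph_iff.1 hv
  have ea : (⟨(v : WithLp 2 (K × K)).fst, ha'⟩ : L.domain) = a := Subtype.ext ha
  rw [ea] at hL
  set g := (v : WithLp 2 (K × K)).snd with hg
  have e1 : (H v).fst = L a + V g := by rw [hL]; abel
  -- Completing the square in the second component. Only −‖Va‖² has the wrong sign, and it is
  -- absorbed by ‖V‖²‖a‖².
  have h0 : (⟪(v : WithLp 2 (K × K)), H v⟫_ℂ).re =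
      (⟪(a : K), L a⟫_ℂ).re - ‖V a‖ ^ 2 + ‖V a + g‖ ^ 2 := by
    rw [inner_prod, hv', e1, ha, ← hg, ← re_inner_self, ← re_inner_self]
    simp only [inner_add_right, inner_add_left, Complex.add_re]
    rw [← h.inner_V]
    have : (⟪g, g⟫_ℂ).re = ‖g‖ ^ 2 := re_inner_self g
    ring
  have h1 : ‖(v : WithLp 2 (K × K))‖ ^ 2 = ‖(a : K)‖ ^ 2 + ‖g‖ ^ 2 := by
    rw [← re_inner_self, inner_prod, Complex.add_re, re_inner_self, re_inner_self, ha]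
  have h2 : ‖V a‖ ^ 2 ≤ ‖V‖ ^ 2 * ‖(a : K)‖ ^ 2 := by
    rw [← mul_pow]
    gcongr
    exact V.le_opNorm _
  have h3 := (h.pos.1 v).1
  have h4 : 0 ≤ ‖V‖ := norm_nonneg V
  rw [h1]
  nlinarith [sq_nonneg ‖V a + g‖, sq_nonneg ‖g‖, sq_nonneg ‖(a : K)‖, mul_nonneg h4 h3,
    mul_nonneg (mul_nonneg h4 h4) h3, mul_nonneg h4 (sq_nonneg ‖(a : K)‖),
    mul_nonneg h4 (sq_nonneg ‖g‖), mul_nonneg (mul_nonneg h4 h4) (sq_nonneg ‖g‖)]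

/-- The form domain of `H` contains the form domain of `L` in the first component. -/
theorem exists_formDomain_H (f g : K) : ∃ u : FormDomain H,
    FormDomain.val H u = WithLp.toLp 2 (invSqrtOneAdd L f, g) ∧
    ‖u‖ ≤ (3 + 2 * ‖V‖) * (‖f‖ + ‖g‖) := by
  have hL := h.isNonnegSelfAdjoint_L
  have hH := h.isNonnegSelfAdjoint_H
  -- Membership in the form domain of H, together with the norm bound, is obtained by duality
  -- against Dom H.
  obtain ⟨y, hy, hyn⟩ := hH.exists_invSqrt_eq_of_bound
    (x := WithLp.toLp 2 (invSqrtOneAdd L f, g)) (C := (3 + 2 * ‖V‖) * (‖f‖ + ‖g‖))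
    (by positivity) (fun v => by
      obtain ⟨hv, hv'⟩ := (h.mem_graph_iff _ _).1 (H.mem_graph v)
      obtain ⟨ha, hLa⟩ := mk_mem_graph_iff.1 hv
      have hle := h.form_L_le v ⟨_, ha⟩ rfl
      set a : L.domain := ⟨_, ha⟩ with hadef
      set b := (v : WithLp 2 (K × K)).snd with hb
      have e1 : (H v).fst = L a + V b := by rw [hLa]; abel
      set N := √(‖(v : WithLp 2 (K × K))‖ ^ 2 + (⟪(v : WithLp 2 (K × K)), H v⟫_ℂ).re) with hN
      have hN0 : 0 ≤ N := Real.sqrt_nonneg _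
      have hNv : ‖(v : WithLp 2 (K × K))‖ ≤ N := by
        refine Real.le_sqrt_of_sq_le ?_
        have := (h.pos.1 v).1
        linarith
      have hsq : ‖(v : WithLp 2 (K × K))‖ ^ 2 = ‖(a : K)‖ ^ 2 + ‖b‖ ^ 2 := by
        rw [← re_inner_self, inner_prod, Complex.add_re, re_inner_self, re_inner_self]
      have hNa : ‖(a : K)‖ ≤ N := by
        refine (abs_le_of_sq_le_sq' ?_ (norm_nonneg _)).2.trans hNv
        rw [hsq]; nlinarith [sq_nonneg ‖b‖]
      have hNb : ‖b‖ ≤ N := by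
        refine (abs_le_of_sq_le_sq' ?_ (norm_nonneg _)).2.trans hNv
        rw [hsq]; nlinarith [sq_nonneg ‖(a : K)‖]
      have hNL : √(‖(a : K)‖ ^ 2 + (⟪(a : K), L a⟫_ℂ).re) ≤ (1 + ‖V‖) * N := by
        rw [hN, ← Real.sqrt_sq (by positivity : 0 ≤ 1 + ‖V‖), ← Real.sqrt_mul (by positivity)]
        exact Real.sqrt_le_sqrt hle
      have h1 : ‖⟪invSqrtOneAdd L f, (a : K) + L a⟫_ℂ‖ ≤ ‖f‖ * ((1 + ‖V‖) * N) :=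
        (hL.norm_inner_invSqrt_le f a).trans (by gcongr)
      have h2 : ‖⟪invSqrtOneAdd L f, V b⟫_ℂ‖ ≤ ‖f‖ * (‖V‖ * N) :=
        (norm_inner_le_norm _ _).trans (by
          gcongr
          · exact hL.norm_invSqrt_le f
          · exact (V.le_opNorm b).trans (by gcongr))
      have h3 : ‖⟪g, V a⟫_ℂ‖ ≤ ‖g‖ * (‖V‖ * N) :=
        (norm_inner_le_norm _ _).trans (by
          gcongr
          exact (V.le_opNorm _).trans (by gcongr))
      have h4 : ‖⟪g, b⟫_ℂ‖ ≤ ‖g‖ * N := (norm_inner_le_norm _ _).trans (by gcongr)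
      -- Of the five terms, those with `f` contribute at most (1 + 2‖V‖)‖f‖N and those with `g` at
      -- most (2 + ‖V‖)‖g‖N. The pairing of `g` with `b` occurs twice, once from `v` and once from
      -- `H v`.
      have e : ⟪WithLp.toLp 2 (invSqrtOneAdd L f, g), (v : WithLp 2 (K × K)) + H v⟫_ℂ =
          ⟪invSqrtOneAdd L f, (a : K) + L a⟫_ℂ + ⟪invSqrtOneAdd L f, V b⟫_ℂ + ⟪g, V a⟫_ℂ +
            ⟪g, b⟫_ℂ + ⟪g, b⟫_ℂ := by
        rw [inner_prod, WithLp.add_fst, WithLp.add_snd, hv', e1]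
        change ⟪invSqrtOneAdd L f, (a : K) + (L a + V b)⟫_ℂ + ⟪g, b + (V a + b)⟫_ℂ = _
        simp only [inner_add_right]
        ring
      rw [e]
      refine (norm_add_le _ _).trans ?_
      have t1 := norm_add_le (⟪invSqrtOneAdd L f, (a : K) + L a⟫_ℂ + ⟪invSqrtOneAdd L f, V b⟫_ℂ +
        ⟪g, V a⟫_ℂ) ⟪g, b⟫_ℂ
      have t2 := norm_add_le (⟪invSqrtOneAdd L f, (a : K) + L a⟫_ℂ + ⟪invSqrtOneAdd L f, V b⟫_ℂ)
        ⟪g, V a⟫_ℂ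
      have t3 := norm_add_le ⟪invSqrtOneAdd L f, (a : K) + L a⟫_ℂ ⟪invSqrtOneAdd L f, V b⟫_ℂ
      have p1 : 0 ≤ ‖f‖ * N := by positivity
      have p2 : 0 ≤ ‖g‖ * (‖V‖ * N) := by positivity
      have p3 : 0 ≤ ‖g‖ * N := by positivity
      nlinarith)
  obtain ⟨u, hu, -⟩ := hH.exists_formDomain y
  exact ⟨u, hu.trans hy, (hH.norm_formDomain_le hu).trans hyn⟩

end IsHamiltonian

end Hamiltonian

end StaticKG

namespace StaticKG

/-! ### The operator B in the energy space and the closure of its graph. -/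

section WaveOperator

variable {K : Type*} [NormedAddCommGroup K] [InnerProductSpace ℂ K] [CompleteSpace K]

/-- `w = (V 1; A V) u` for elements `u`, `w` of the form domain of `H`. -/
def IsWavePair (A : K →ₗ.[ℂ] K) (V : K →L[ℂ] K) {H : WithLp 2 (K × K) →ₗ.[ℂ] WithLp 2 (K × K)}
    (u w : FormDomain H) : Prop :=
  ((FormDomain.val H u).fst, (FormDomain.val H w).snd - V (FormDomain.val H u).snd) ∈ A.graph ∧
    (FormDomain.val H w).fst = V (FormDomain.val H u).fst + (FormDomain.val H u).snd

/-- The graph of the operator `(V 1; A V)` with domain `Dom A ⊕ Dom A` in the form domain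
of `H`. -/
def wavePairs (A : K →ₗ.[ℂ] K) (V : K →L[ℂ] K)
    (H : WithLp 2 (K × K) →ₗ.[ℂ] WithLp 2 (K × K)) :
    Submodule ℂ (FormDomain H × FormDomain H) where
  carrier := {p | IsWavePair A V p.1 p.2 ∧ (FormDomain.val H p.1).snd ∈ A.domain}
  zero_mem' := by
    refine ⟨⟨?_, ?_⟩, ?_⟩
    · convert A.graph.zero_mem using 1
      simp
    · simp
    · simp
  add_mem' := by
    rintro ⟨u, w⟩ ⟨u', w'⟩ ⟨⟨h1, h2⟩, h3⟩ ⟨⟨h1', h2'⟩, h3'⟩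
    refine ⟨⟨?_, ?_⟩, ?_⟩
    · convert A.graph.add_mem h1 h1' using 1
      simp [add_sub_add_comm]
    · simp only [Prod.mk_add_mk, map_add, WithLp.add_fst, WithLp.add_snd, h2, h2']
      abel
    · simpa using A.domain.add_mem h3 h3'
  smul_mem' := by
    rintro c ⟨u, w⟩ ⟨⟨h1, h2⟩, h3⟩
    refine ⟨⟨?_, ?_⟩, ?_⟩
    · convert A.graph.smul_mem c h1 using 1
      simp [smul_sub]
    · simp [h2]
    · simpa using A.domain.smul_mem c h3

/-- The graph of the operator `(V 1; A V)` with domain `Dom A ⊕ Dom A` in the energy space. -/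
noncomputable def waveGraph (A : K →ₗ.[ℂ] K) (V : K →L[ℂ] K)
    (H : WithLp 2 (K × K) →ₗ.[ℂ] WithLp 2 (K × K)) :
    Submodule ℂ (EnergySpace H × EnergySpace H) :=
  (wavePairs A V H).map ((UniformSpace.Completion.toComplL (𝕜 := ℂ) (E := FormDomain H)).prodMap
    (UniformSpace.Completion.toComplL (𝕜 := ℂ) (E := FormDomain H))).toLinearMap

theorem mem_waveGraph_iff {A : K →ₗ.[ℂ] K} {V : K →L[ℂ] K}
    {H : WithLp 2 (K × K) →ₗ.[ℂ] WithLp 2 (K × K)} {p : EnergySpace H × EnergySpace H} :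
    p ∈ waveGraph A V H ↔ ∃ u w : FormDomain H, IsWavePair A V u w ∧
      (FormDomain.val H u).snd ∈ A.domain ∧ p = ((u : EnergySpace H), (w : EnergySpace H)) := by
  constructor
  · rintro ⟨⟨u, w⟩, ⟨h1, h2⟩, rfl⟩
    exact ⟨u, w, h1, h2, rfl⟩
  · rintro ⟨u, w, h1, h2, rfl⟩
    exact ⟨(u, w), ⟨h1, h2⟩, rfl⟩

/-- The data of the abstract Klein-Gordon equation: `L` is the closure of `L₀`, and `V` maps the
domain of `L₀` to the form domain of `L`. -/
structure IsWaveSystem (L₀ L : K →ₗ.[ℂ] K) (V : K →L[ℂ] K)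
    (H : WithLp 2 (K × K) →ₗ.[ℂ] WithLp 2 (K × K)) : Prop extends IsHamiltonian L V H where
  graph_eq : L.graph = L₀.graph.topologicalClosure
  V_mem : ∀ φ ∈ L₀.domain, ∃ f, invSqrtOneAdd L f = V φ

namespace IsHamiltonian

variable {L : K →ₗ.[ℂ] K} {V : K →L[ℂ] K} {H : WithLp 2 (K × K) →ₗ.[ℂ] WithLp 2 (K × K)}
  (h : IsHamiltonian L V H)
include h

/-- Exchanging the components of `w` gives `H u`, so the energy product with `u` becomes an ordinary
inner product with the exchanged `w`. -/
theorem inner_wavePair {u w : FormDomain H} (hp : IsWavePair L V u w) (f : FormDomain H) :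
    ⟪f, u⟫_ℂ = ⟪(FormDomain.val H f).fst, (FormDomain.val H w).snd⟫_ℂ +
      ⟪(FormDomain.val H f).snd, (FormDomain.val H w).fst⟫_ℂ := by
  have hg : (FormDomain.val H u, WithLp.toLp 2 ((FormDomain.val H w).snd,
      (FormDomain.val H w).fst)) ∈ H.graph := (h.mem_graph_iff _ _).2 hp
  obtain ⟨h1, h2⟩ := mk_mem_graph_iff.1 hg
  have : u = h.isNonnegSelfAdjoint_H.toForm ⟨_, h1⟩ :=
    FormDomain.val_injective (h.isNonnegSelfAdjoint_H.val_toForm ⟨_, h1⟩).symm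
  conv_lhs => rw [this]
  rw [h.isNonnegSelfAdjoint_H.inner_toForm, h2]
  rfl

/-- Both sides reduce to the pairing of `w` with the exchanged components of `w'`, and the exchange
is symmetric. -/
theorem wavePair_symm {u w u' w' : FormDomain H} (hp : IsWavePair L V u w)
    (hp' : IsWavePair L V u' w') : ⟪w, u'⟫_ℂ = ⟪u, w'⟫_ℂ := by
  rw [h.inner_wavePair hp', ← inner_conj_symm u w', h.inner_wavePair hp, map_add, inner_conj_symm,
    inner_conj_symm, add_comm]

/-- By this estimate, L² convergence of the components of `u` and of `B u` suffices for convergence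
of `u` in the energy norm. -/
theorem wavePair_norm_sq {u w : FormDomain H} (hp : IsWavePair L V u w) :
    ‖u‖ ^ 2 ≤ ‖(FormDomain.val H u).fst‖ * ‖(FormDomain.val H w).snd‖ +
      ‖(FormDomain.val H u).snd‖ * ‖(FormDomain.val H w).fst‖ := by
  have h1 : ‖u‖ ^ 2 = (⟪u, u⟫_ℂ).re := (inner_self_eq_norm_sq (𝕜 := ℂ) u).symm
  rw [h1, h.inner_wavePair hp, Complex.add_re]
  exact add_le_add ((Complex.re_le_norm _).trans (norm_inner_le_norm _ _))
    ((Complex.re_le_norm _).trans (norm_inner_le_norm _ _))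

end IsHamiltonian

namespace IsWaveSystem

variable {L₀ L : K →ₗ.[ℂ] K} {V : K →L[ℂ] K} {H : WithLp 2 (K × K) →ₗ.[ℂ] WithLp 2 (K × K)}
  (h : IsWaveSystem L₀ L V H)
include h

theorem graph_le : L₀.graph ≤ L.graph := h.graph_eq ▸ L₀.graph.le_topologicalClosure

theorem isWavePair {u w : FormDomain H} (hp : IsWavePair L₀ V u w) : IsWavePair L V u w :=
  ⟨h.graph_le hp.1, hp.2⟩

theorem exists_invSqrt_eq {φ : K} (hφ : φ ∈ L.domain) : ∃ f, invSqrtOneAdd L f = φ :=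
  ⟨_, h.isNonnegSelfAdjoint_L.invSqrt_invSqrt_add ⟨φ, hφ⟩⟩

theorem domain_le : L₀.domain ≤ L.domain := (LinearPMap.le_of_le_graph h.graph_le).1

/-- The operator `(V 1; L₀ V)` maps `Dom L₀ ⊕ Dom L₀` to the form domain of `H`. -/
theorem exists_isWavePair {φ₁ φ₂ : K} (h₁ : φ₁ ∈ L₀.domain) (h₂ : φ₂ ∈ L₀.domain) :
    ∃ u w : FormDomain H, IsWavePair L₀ V u w ∧ FormDomain.val H u = WithLp.toLp 2 (φ₁, φ₂) := by
  obtain ⟨f, hf⟩ := h.exists_invSqrt_eq (h.domain_le h₁)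
  -- The image has first component `V φ₁ + φ₂`, which need only lie in the form domain of `L`, not
  -- in its domain.
  obtain ⟨f', hf'⟩ := h.V_mem φ₁ h₁
  obtain ⟨f'', hf''⟩ := h.exists_invSqrt_eq (h.domain_le h₂)
  obtain ⟨u, hu, -⟩ := h.exists_formDomain_H f φ₂
  obtain ⟨w, hw, -⟩ := h.exists_formDomain_H (f' + f'') (L₀ ⟨φ₁, h₁⟩ + V φ₂)
  refine ⟨u, w, ⟨?_, ?_⟩, by rw [hu, hf]⟩
  · rw [hu, hw, hf, mk_mem_graph_iff]
    exact ⟨h₁, by simp⟩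
  · rw [hu, hw, hf, map_add, hf', hf'']
    rfl

/-- Injectivity of `H` makes the energy seminorm a norm, so the form domain embeds in its completion
and B is single valued there. -/
theorem waveGraph_fst_eq_zero (p : EnergySpace H × EnergySpace H) (hp : p ∈ waveGraph L₀ V H)
    (hp0 : p.1 = 0) : p.2 = 0 := by
  obtain ⟨u, w, ⟨h1, h2⟩, -, rfl⟩ := mem_waveGraph_iff.1 hp
  have hu : u = 0 := by
    refine h.isNonnegSelfAdjoint_H.eq_zero_of_norm_formDomain h.pos.2 ?_
    rw [← UniformSpace.Completion.norm_coe, norm_eq_zero]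
    exact hp0
  subst hu
  have hw : w = 0 := by
    refine FormDomain.val_injective ?_
    have e1 : (FormDomain.val H w).snd = 0 := by
      have := L₀.graph_fst_eq_zero_snd h1 (by simp)
      simpa using this
    have e2 : (FormDomain.val H w).fst = 0 := by simpa using h2
    rw [map_zero]
    exact (WithLp.ofLp_injective 2) (Prod.ext e2 e1)
  rw [hw]
  rfl

theorem waveOp_graph : (waveGraph L₀ V H).toLinearPMap.graph = waveGraph L₀ V H :=
  Submodule.toLinearPMap_graph_eq _ h.waveGraph_fst_eq_zero

theorem mem_closure_L (p : K × K) (hp : p ∈ L.graph) :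
    p ∈ closure {p : K × K | p ∈ L.graph ∧ p.1 ∈ (L₀.domain : Set K)} := by
  rw [h.graph_eq, ← SetLike.mem_coe, Submodule.topologicalClosure_coe] at hp
  refine closure_mono ?_ hp
  rintro ⟨u, w⟩ hq
  exact ⟨h.graph_le hq, (mk_mem_graph_iff.1 hq).1⟩

/-- Every pair `(u, (V 1; L V) u)` of elements of `Dom H` is in the closure of the operator on
`Dom L₀ ⊕ Dom L₀`. -/
theorem mem_closure_waveGraph {u w : FormDomain H} (hp : IsWavePair L V u w)
    (hw : (FormDomain.val H w).fst ∈ L.domain) :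
    ((u : EnergySpace H), (w : EnergySpace H)) ∈ (waveGraph L₀ V H).topologicalClosure := by
  have hL := h.isNonnegSelfAdjoint_L
  obtain ⟨u₁, hu₁⟩ : ∃ y, y = (FormDomain.val H u).fst := ⟨_, rfl⟩
  obtain ⟨u₂, hu₂⟩ : ∃ y, y = (FormDomain.val H u).snd := ⟨_, rfl⟩
  obtain ⟨w₁, hw₁⟩ : ∃ y, y = (FormDomain.val H w).fst := ⟨_, rfl⟩
  obtain ⟨w₂, hw₂⟩ : ∃ y, y = (FormDomain.val H w).snd := ⟨_, rfl⟩
  rw [← hw₁] at hw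
  have hp1 : (u₁, w₂ - V u₂) ∈ L.graph := by rw [hu₁, hu₂, hw₂]; exact hp.1
  have hp2 : w₁ = V u₁ + u₂ := by rw [hu₁, hu₂, hw₁]; exact hp.2
  have hcl := hp1
  rw [h.graph_eq, ← SetLike.mem_coe, Submodule.topologicalClosure_coe,
    mem_closure_iff_seq_limit] at hcl
  obtain ⟨x, hx, hxlim⟩ := hcl
  have hx1 : Filter.Tendsto (fun k => (x k).1) Filter.atTop (nhds u₁) :=
    (continuous_fst.tendsto (u₁, w₂ - V u₂)).comp hxlim
  have hx2 : Filter.Tendsto (fun k => (x k).2) Filter.atTop (nhds (w₂ - V u₂)) :=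
    (continuous_snd.tendsto (u₁, w₂ - V u₂)).comp hxlim
  have hxd : ∀ k, (x k).1 ∈ L₀.domain := fun k => (mk_mem_graph_iff.1 (hx k)).1
  obtain ⟨a, ha⟩ := h.exists_invSqrt_eq hw
  choose b hb using fun k => h.V_mem _ (hxd k)
  have hdense := hL.dense_invSqrt_add h.mem_closure_L
  -- The vectors `V x_k` converge in L², but their form norms are not controlled. Hence `v k` is
  -- chosen after `x k`, in the core, close to `w₁ - V x_k`, which is J(a − b_k), in the form norm
  -- of `1 + L`. In L² these vectors still tend to w₁ − V u₁ = u₂.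
  have hg : ∀ k : ℕ, ∃ v : L.domain, (v : K) ∈ L₀.domain ∧
      ‖(a - b k) - invSqrtOneAdd L ((v : K) + L v)‖ < 1 / ((k : ℝ) + 1) := fun k => by
    obtain ⟨_, ⟨v, hv, rfl⟩, hd⟩ :=
      Metric.mem_closure_iff.1 (hdense (a - b k)) (1 / ((k : ℝ) + 1)) (by positivity)
    exact ⟨v, hv, by rwa [dist_eq_norm] at hd⟩
  choose v hv hvlt using hg
  set d : ℕ → K := fun k => (a - b k) - invSqrtOneAdd L ((v k : K) + L (v k)) with hd
  have hdlim : Filter.Tendsto d Filter.atTop (nhds 0) :=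
    squeeze_zero_norm (fun k => (hvlt k).le) tendsto_one_div_add_atTop_nhds_zero_nat
  have hJd : ∀ k, invSqrtOneAdd L (d k) = w₁ - V (x k).1 - v k := fun k => by
    rw [hd]
    simp only [map_sub, hL.invSqrt_invSqrt_add, ha, hb]
  choose U W hUW hU using fun k => h.exists_isWavePair (hxd k) (hv k)
  have hUfst : ∀ k, (FormDomain.val H (U k)).fst = (x k).1 := fun k => by rw [hU]; rfl
  have hUsnd : ∀ k, (FormDomain.val H (U k)).snd = v k := fun k => by rw [hU]; rfl
  have hWfst : ∀ k, (FormDomain.val H (W k)).fst = V (x k).1 + v k := fun k => by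
    rw [(hUW k).2, hUfst, hUsnd]
  have hWsnd : ∀ k, (FormDomain.val H (W k)).snd = (x k).2 + V (v k) := fun k => by
    have h1 := (hUW k).1
    rw [hUfst, hUsnd] at h1
    have h2 := L₀.mem_graph_snd_inj h1 (hx k) rfl
    exact sub_eq_iff_eq_add.1 h2
  have hvlim : Filter.Tendsto (fun k => (v k : K)) Filter.atTop (nhds u₂) := by
    have h1 : ∀ k, (v k : K) = w₁ - V (x k).1 - invSqrtOneAdd L (d k) := fun k => by
      rw [hJd]; abel
    have h2 : u₂ = w₁ - V u₁ - invSqrtOneAdd L 0 := by rw [hp2, map_zero]; abel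
    rw [h2, funext h1]
    exact ((tendsto_const_nhds.sub ((V.continuous.tendsto _).comp hx1))).sub
      (((invSqrtOneAdd L).continuous.tendsto _).comp hdlim)
  have hsndlim : Filter.Tendsto (fun k => w₂ - ((x k).2 + V (v k))) Filter.atTop (nhds 0) := by
    have := tendsto_const_nhds (x := w₂) (f := Filter.atTop) |>.sub
      (hx2.add ((V.continuous.tendsto _).comp hvlim))
    simpa using this
  -- The differences are again wave pairs, and `wavePair_norm_sq` needs only the L² limits of the
  -- four components.
  have hUlim : Filter.Tendsto U Filter.atTop (nhds u) := by
    rw [tendsto_iff_norm_sub_tendsto_zero]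
    have hpair : ∀ k, IsWavePair L V (U k - u) (W k - w) := fun k => by
      have h1 := h.isWavePair (hUW k)
      refine ⟨?_, ?_⟩
      · convert L.graph.sub_mem h1.1 hp.1 using 1
        simp [sub_sub_sub_comm]
      · rw [map_sub, map_sub, WithLp.sub_fst, WithLp.sub_fst, WithLp.sub_snd, h1.2, hp.2, map_sub]
        abel
    have hbd := fun k => h.wavePair_norm_sq (hpair k)
    have h0 : Filter.Tendsto (fun k => ‖U k - u‖ ^ 2) Filter.atTop (nhds 0) := by
      refine squeeze_zero (fun k => sq_nonneg _) hbd ?_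
      simp only [map_sub, WithLp.sub_fst, WithLp.sub_snd, hUfst, hUsnd, hWfst, hWsnd, ← hu₁, ← hu₂,
        ← hw₁, ← hw₂]
      have t1 := (hx1.sub_const u₁).norm
      have t2 := (hsndlim.neg).norm
      have t3 := (hvlim.sub_const u₂).norm
      have t4 := ((((V.continuous.tendsto _).comp hx1).add hvlim).sub_const w₁).norm
      have := (t1.mul t2).add (t3.mul t4)
      simpa only [sub_self, norm_zero, zero_mul, mul_zero, add_zero, neg_zero, neg_sub, ← hp2,
        Function.comp_def] using this
    have h1 := (Real.continuous_sqrt.tendsto _).comp h0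
    simpa [Function.comp_def, Real.sqrt_sq (norm_nonneg _)] using h1
  -- Here `w - W k` has first component `J (d k)`, so smallness of `d k`, which is smallness in the
  -- form norm, enters through `exists_formDomain_H`.
  have hWlim : Filter.Tendsto W Filter.atTop (nhds w) := by
    rw [tendsto_iff_norm_sub_tendsto_zero]
    have hbd : ∀ k, ‖W k - w‖ ≤
        (3 + 2 * ‖V‖) * (‖d k‖ + ‖w₂ - ((x k).2 + V (v k))‖) := fun k => by
      obtain ⟨y, hy, hyn⟩ := h.exists_formDomain_H (d k) (w₂ - ((x k).2 + V (v k)))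
      have : y = w - W k := by
        refine FormDomain.val_injective ((WithLp.ofLp_injective 2) (Prod.ext ?_ ?_))
        · change (FormDomain.val H y).fst = (FormDomain.val H (w - W k)).fst
          rw [map_sub, WithLp.sub_fst, hWfst, hy, ← hw₁]
          change invSqrtOneAdd L (d k) = _
          rw [hJd]; abel
        · change (FormDomain.val H y).snd = (FormDomain.val H (w - W k)).snd
          rw [map_sub, WithLp.sub_snd, hWsnd, hy, ← hw₂]
          rfl
      rw [this] at hyn
      rwa [norm_sub_rev]
    refine squeeze_zero (fun k => norm_nonneg _) hbd ?_
    have := ((hdlim.norm.add hsndlim.norm).const_mul (3 + 2 * ‖V‖))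
    simpa using this
  rw [← SetLike.mem_coe, Submodule.topologicalClosure_coe, mem_closure_iff_seq_limit]
  refine ⟨fun k => ((U k : EnergySpace H), (W k : EnergySpace H)), fun k => ?_, ?_⟩
  · refine mem_waveGraph_iff.2 ⟨U k, W k, hUW k, ?_, rfl⟩
    rw [hUsnd]
    exact hv k
  · exact (((UniformSpace.Completion.continuous_coe _).tendsto _).comp hUlim).prodMk_nhds
      (((UniformSpace.Completion.continuous_coe _).tendsto _).comp hWlim)

/-- The graph of `H` is the continuous image of the graph of `L` times `K`. In the first factor the
pairs over `Dom L₀` are dense, and in the second `Dom L₀` is dense, so `Dom L₀ ⊕ Dom L₀` is a core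
of `H`. -/
theorem mem_closure_H (p : WithLp 2 (K × K) × WithLp 2 (K × K)) (hp : p ∈ H.graph) :
    p ∈ closure {p | p ∈ H.graph ∧ p.1 ∈ {u : WithLp 2 (K × K) |
      u.fst ∈ L₀.domain ∧ u.snd ∈ L₀.domain}} := by
  obtain ⟨u, w⟩ := p
  obtain ⟨h1, h2⟩ := (h.mem_graph_iff _ _).1 hp
  have hd : Dense (L₀.domain : Set K) := by
    have hd := h.isSelfAdjoint.dense_domain
    refine dense_closure.1 (hd.mono fun x hx => ?_)
    have := h.mem_closure_L _ (L.mem_graph ⟨x, hx⟩)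
    exact map_mem_closure continuous_fst this fun p hp => hp.2
  have h3 : ((u.fst, w.fst - V u.snd), u.snd) ∈
      closure ({p : K × K | p ∈ L.graph ∧ p.1 ∈ (L₀.domain : Set K)} ×ˢ (L₀.domain : Set K)) := by
    rw [closure_prod_eq]
    exact ⟨h.mem_closure_L _ h1, hd _⟩
  have hcont : Continuous fun q : (K × K) × K =>
      (WithLp.toLp 2 (q.1.1, q.2), WithLp.toLp 2 (q.1.2 + V q.2, V q.1.1 + q.2)) :=
    Continuous.prodMk ((WithLp.prod_continuous_toLp 2 K K).comp (by fun_prop))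
      ((WithLp.prod_continuous_toLp 2 K K).comp (by fun_prop))
  have := map_mem_closure hcont h3 (t := {p | p ∈ H.graph ∧ p.1 ∈ {u : WithLp 2 (K × K) |
      u.fst ∈ L₀.domain ∧ u.snd ∈ L₀.domain}}) (by
    rintro ⟨⟨x, y⟩, g⟩ ⟨⟨hq1, hq2⟩, hq3⟩
    refine ⟨(h.mem_graph_iff _ _).2 ⟨?_, rfl⟩, hq2, hq3⟩
    simpa using hq1)
  convert this using 1
  refine Prod.ext rfl ?_
  refine (WithLp.ofLp_injective 2) (Prod.ext ?_ h2)
  simp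

theorem dense_waveOp_domain :
    Dense ((waveGraph L₀ V H).toLinearPMap.domain : Set (EnergySpace H)) := by
  have h1 := h.isNonnegSelfAdjoint_H.dense_formDomain h.mem_closure_H
  have h2 := UniformSpace.Completion.denseRange_coe.dense_image
    (UniformSpace.Completion.continuous_coe (FormDomain H)) h1
  refine h2.mono ?_
  rintro _ ⟨u, ⟨-, hu1, hu2⟩, rfl⟩
  obtain ⟨u', w, hp, hu'⟩ := h.exists_isWavePair hu1 hu2
  have : u' = u := FormDomain.val_injective hu'
  subst this
  exact ⟨((u' : EnergySpace H), (w : EnergySpace H)),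
    mem_waveGraph_iff.2 ⟨u', w, hp, hu2, rfl⟩, rfl⟩

theorem waveOp_symm : (waveGraph L₀ V H).toLinearPMap.IsFormalAdjoint
    (waveGraph L₀ V H).toLinearPMap := by
  intro x y
  have hx := (waveGraph L₀ V H).toLinearPMap.mem_graph x
  have hy := (waveGraph L₀ V H).toLinearPMap.mem_graph y
  rw [h.waveOp_graph, mem_waveGraph_iff] at hx hy
  obtain ⟨u, w, hp, -, e⟩ := hx
  obtain ⟨u', w', hp', -, e'⟩ := hy
  rw [Prod.mk.injEq] at e e'
  rw [e.1, e.2, e'.1, e'.2, UniformSpace.Completion.inner_coe, UniformSpace.Completion.inner_coe]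
  exact h.wavePair_symm (h.isWavePair hp) (h.isWavePair hp')

end IsWaveSystem

end WaveOperator

end StaticKG

namespace StaticKG

/-! ### The quadratic pencil L − (V − z)². -/

section Pencil

variable {K : Type*} [NormedAddCommGroup K] [InnerProductSpace ℂ K]

/-- The operator `L - (V - z)²` with domain `Dom L`. -/
def pencilOp (L : K →ₗ.[ℂ] K) (V : K →L[ℂ] K) (z : ℂ) : K →ₗ.[ℂ] K :=
  (-((V - z • ContinuousLinearMap.id ℂ K) ^ 2) : K →L[ℂ] K).toLinearMap +ᵥ L

theorem pencilOp_apply (L : K →ₗ.[ℂ] K) (V : K →L[ℂ] K) (z : ℂ) (u : L.domain) :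
    pencilOp L V z u = L u - V (V u) + (2 * z) • V u - z ^ 2 • (u : K) := by
  change -((V - z • ContinuousLinearMap.id ℂ K) ^ 2) (u : K) + L u = _
  rw [pow_two, mul_apply_eq_comp]
  simp only [sub_apply, smul_apply, ContinuousLinearMap.id_apply, map_sub, map_smul]
  module

variable [CompleteSpace K]

namespace IsHamiltonian

variable {L : K →ₗ.[ℂ] K} {V : K →L[ℂ] K} {H : WithLp 2 (K × K) →ₗ.[ℂ] WithLp 2 (K × K)}
  (h : IsHamiltonian L V H)
include h

theorem inner_sub_smul (z : ℂ) (x y : K) :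
    ⟪(-((V - z • ContinuousLinearMap.id ℂ K) ^ 2) : K →L[ℂ] K) x, y⟫_ℂ =
      ⟪x, (-((V - (starRingEnd ℂ z) • ContinuousLinearMap.id ℂ K) ^ 2) : K →L[ℂ] K) y⟫_ℂ := by
  have h1 : ∀ a b : K, ⟪(V - z • ContinuousLinearMap.id ℂ K) a, b⟫_ℂ =
      ⟪a, (V - (starRingEnd ℂ z) • ContinuousLinearMap.id ℂ K) b⟫_ℂ := fun a b => by
    simp only [sub_apply, smul_apply, ContinuousLinearMap.id_apply, inner_sub_left,
      inner_sub_right, h.inner_V, inner_smul_left, inner_smul_right]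
  simp only [neg_apply, pow_two, mul_apply_eq_comp, inner_neg_left, inner_neg_right, h1]

/-- The form of the pencil at `u` is a + 2zb − z²c with a, b, c real and a, c ≥ 0. After
multiplication by z̄ the middle term is real, and the two others have imaginary parts −a Im z and
−c|z|² Im z of the same sign, so they cannot cancel. -/
theorem pencilOp_lower_bound {z : ℂ} (hz : z.im ≠ 0) (u : L.domain) :
    |z.im| * ‖z‖ * ‖(u : K)‖ ≤ ‖pencilOp L V z u‖ := by
  have hz0 : 0 < ‖z‖ := norm_pos_iff.2 fun h => hz (by rw [h]; rfl)
  have ha := h.form_nonneg u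
  have ha' := h.form_im u
  have hb' : (⟪(u : K), V u⟫_ℂ).im = 0 := by
    have := inner_conj_symm (𝕜 := ℂ) (u : K) (V u)
    rw [h.inner_V] at this
    exact Complex.conj_eq_iff_im.1 this
  have hc' : (⟪(u : K), (u : K)⟫_ℂ).im = 0 := inner_self_im (𝕜 := ℂ) (u : K)
  have hc : (⟪(u : K), (u : K)⟫_ℂ).re = ‖(u : K)‖ ^ 2 := re_inner_self (u : K)
  set a := ⟪(u : K), L u - V (V u)⟫_ℂ
  set b := ⟪(u : K), V u⟫_ℂ
  set c := ⟪(u : K), (u : K)⟫_ℂ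
  have e : ⟪(u : K), pencilOp L V z u⟫_ℂ = a + 2 * z * b - z ^ 2 * c := by
    rw [pencilOp_apply, inner_sub_right, inner_add_right, inner_smul_right, inner_smul_right]
  have hn : ‖z‖ ^ 2 = z.re ^ 2 + z.im ^ 2 := by
    rw [Complex.sq_norm, Complex.normSq_apply]; ring
  have him : ((starRingEnd ℂ z) * (a + 2 * z * b - z ^ 2 * c)).im =
      -z.im * (a.re + ‖z‖ ^ 2 * ‖(u : K)‖ ^ 2) := by
    rw [hn, ← hc]
    simp only [pow_two, Complex.mul_im, Complex.mul_re, Complex.add_im, Complex.add_re,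
      Complex.sub_im, Complex.sub_re, Complex.conj_re, Complex.conj_im, ha', hb', hc',
      Complex.re_ofNat, Complex.im_ofNat]
    ring
  have h1 : |z.im| * (‖z‖ ^ 2 * ‖(u : K)‖ ^ 2) ≤ ‖z‖ * (‖(u : K)‖ * ‖pencilOp L V z u‖) := by
    calc |z.im| * (‖z‖ ^ 2 * ‖(u : K)‖ ^ 2) ≤ |z.im| * (a.re + ‖z‖ ^ 2 * ‖(u : K)‖ ^ 2) := by
          gcongr; linarith
      _ = |((starRingEnd ℂ z) * (a + 2 * z * b - z ^ 2 * c)).im| := by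
          rw [him, abs_mul, abs_neg, abs_of_nonneg (a := a.re + _) (by positivity)]
      _ ≤ ‖(starRingEnd ℂ z) * (a + 2 * z * b - z ^ 2 * c)‖ := Complex.abs_im_le_norm _
      _ = ‖z‖ * ‖⟪(u : K), pencilOp L V z u⟫_ℂ‖ := by rw [norm_mul, RCLike.norm_conj, e]
      _ ≤ _ := by gcongr; exact norm_inner_le_norm _ _
  rcases (norm_nonneg (u : K)).eq_or_lt with h0 | h0
  · rw [← h0, mul_zero]; exact norm_nonneg _
  · have : (‖z‖ * ‖(u : K)‖) * (|z.im| * ‖z‖ * ‖(u : K)‖) ≤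
        (‖z‖ * ‖(u : K)‖) * ‖pencilOp L V z u‖ := by
      calc _ = |z.im| * (‖z‖ ^ 2 * ‖(u : K)‖ ^ 2) := by ring
        _ ≤ _ := h1
        _ = _ := by ring
    exact le_of_mul_le_mul_left this (by positivity)

theorem isBoundedlyInvertible_pencilOp_of_im_ne_zero {z : ℂ} (hz : z.im ≠ 0) :
    IsBoundedlyInvertible (pencilOp L V z) := by
  have hz0 : 0 < ‖z‖ := norm_pos_iff.2 fun h => hz (by rw [h]; rfl)
  refine isBoundedlyInvertible_vadd h.isSelfAdjoint (c := |z.im| * ‖z‖) (h.inner_sub_smul z)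
    (by positivity) (h.pencilOp_lower_bound hz) fun u => ?_
  have := h.pencilOp_lower_bound (z := starRingEnd ℂ z) (by simpa using hz) u
  rw [Complex.conj_im, abs_neg, RCLike.norm_conj] at this
  exact this

theorem isBoundedlyInvertible_pencilOp_of_bound {z : ℂ} (hz : z.im = 0) {c : ℝ} (hc : 0 < c)
    (hb : ∀ u : L.domain, c * ‖(u : K)‖ ≤ ‖pencilOp L V z u‖) :
    IsBoundedlyInvertible (pencilOp L V z) := by
  have hzz : starRingEnd ℂ z = z := Complex.conj_eq_iff_im.2 hz
  have := h.inner_sub_smul z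
  rw [hzz] at this
  exact isBoundedlyInvertible_vadd h.isSelfAdjoint this hc hb hb

/-- Composing with `(1 + L)^{-1/2}` does not affect the bounded invertibility of
`L - (V - z)²`. -/
theorem isBoundedlyInvertible_compBounded_iff (z : ℂ) :
    IsBoundedlyInvertible (compBounded (pencilOp L V z) (invSqrtOneAdd L)) ↔
      IsBoundedlyInvertible (pencilOp L V z) := by
  have hL := h.isNonnegSelfAdjoint_L
  set J := invSqrtOneAdd L with hJ
  constructor
  · rintro ⟨S, hS1, hS2⟩
    refine ⟨J ∘L S, fun f => ?_, fun u => ?_⟩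
    · obtain ⟨hf, hf'⟩ := hS1 f
      exact ⟨hf, hf'⟩
    · have hu : J (J ((u : K) + L u)) = u := hL.invSqrt_invSqrt_add u
      have hmem : J ((u : K) + L u) ∈ (compBounded (pencilOp L V z) J).domain := by
        change J (J ((u : K) + L u)) ∈ L.domain
        rw [hu]; exact u.2
      have h1 := hS2 ⟨_, hmem⟩
      have h2 : compBounded (pencilOp L V z) J ⟨_, hmem⟩ = pencilOp L V z u := by
        change pencilOp L V z ⟨J (J ((u : K) + L u)), _⟩ = _
        congr 1
        exact Subtype.ext hu
      rw [h2] at h1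
      rw [ContinuousLinearMap.comp_apply, h1, hu]
  · rintro ⟨N, hN1, hN2⟩
    -- `P` is (1 + L)N, which is bounded because LN = 1 + (V − z)²N. As J² = (1 + L)⁻¹, it follows
    -- that J(JP) = N, and `J P` is the inverse sought.
    set P : K →L[ℂ] K := 1 + (1 + (V - z • ContinuousLinearMap.id ℂ K) ^ 2) * N with hP
    have hPN : ∀ f, P f = N f + L ⟨N f, (hN1 f).1⟩ := fun f => by
      obtain ⟨hf, hf'⟩ := hN1 f
      have h1 : -((V - z • ContinuousLinearMap.id ℂ K) ^ 2) (N f) + L ⟨N f, hf⟩ = f := hf'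
      have h2 : L ⟨N f, hf⟩ = f + ((V - z • ContinuousLinearMap.id ℂ K) ^ 2) (N f) := by
        rw [neg_add_eq_iff_eq_add] at h1
        rw [h1, add_comm]
      rw [h2]
      change f + (N f + ((V - z • ContinuousLinearMap.id ℂ K) ^ 2) (N f)) = _
      abel
    have hJJ : ∀ f, J (J (P f)) = N f := fun f => by
      rw [hPN]
      exact hL.invSqrt_invSqrt_add ⟨N f, _⟩
    refine ⟨J ∘L P, fun f => ?_, fun u => ?_⟩
    · obtain ⟨hf, hf'⟩ := hN1 f
      have hmem : J (J (P f)) ∈ L.domain := by rw [hJJ]; exact hf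
      refine ⟨hmem, ?_⟩
      refine Eq.trans ?_ hf'
      change pencilOp L V z ⟨J (J (P f)), hmem⟩ = _
      congr 1
      exact Subtype.ext (hJJ f)
    · have h1 : J (u : K) ∈ (pencilOp L V z).domain := u.2
      have h2 := hN2 ⟨_, h1⟩
      have h3 : compBounded (pencilOp L V z) J u = pencilOp L V z ⟨J u, h1⟩ := rfl
      have h4 : J (J (P (compBounded (pencilOp L V z) J u))) = J u := by
        rw [hJJ, h3, h2]
      have h5 : J (J (P (compBounded (pencilOp L V z) J u)) - u) = 0 := by
        rw [map_sub, h4, sub_self]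
      exact sub_eq_zero.1 (hL.invSqrt_eq_zero h5)

/-- If `L - (V - z)²` is boundedly invertible, then `B u - z u = f` can be solved for `f ∈ Dom H`,
with `u, B u ∈ Dom H`. -/
theorem exists_isWavePair_sub_smul {z : ℂ} (hz : IsBoundedlyInvertible (pencilOp L V z))
    {f : FormDomain H} (hf : FormDomain.val H f ∈ H.domain) :
    ∃ u w : FormDomain H, IsWavePair L V u w ∧ (FormDomain.val H w).fst ∈ L.domain ∧
      w - z • u = f := by
  obtain ⟨N, hN1, -⟩ := hz
  have hH := h.isNonnegSelfAdjoint_H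
  obtain ⟨f₁, hf₁⟩ : ∃ y, y = (FormDomain.val H f).fst := ⟨_, rfl⟩
  obtain ⟨f₂, hf₂⟩ : ∃ y, y = (FormDomain.val H f).snd := ⟨_, rfl⟩
  have hfd : f₁ ∈ L.domain := hf₁ ▸ (h.mem_domain_iff _).1 hf
  -- The first row of (B − z)u = f gives u₂ = f₁ − (V − z)u₁. Insertion in the second row leaves
  -- p(z)u₁ = f₂ − (V − z)f₁.
  obtain ⟨hd, hM⟩ := hN1 (f₂ - (V f₁ - z • f₁))
  obtain ⟨a, ha⟩ : ∃ a : L.domain, a = ⟨_, hd⟩ := ⟨_, rfl⟩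
  have hM' : pencilOp L V z a = f₂ - (V f₁ - z • f₁) := by rw [ha]; exact hM
  rw [pencilOp_apply] at hM'
  have hu := (h.mem_domain_iff (WithLp.toLp 2 ((a : K), f₁ - (V a - z • (a : K))))).2 a.2
  obtain ⟨u, hu⟩ : ∃ u, u = hH.toForm ⟨_, hu⟩ := ⟨_, rfl⟩
  have huval : FormDomain.val H u = WithLp.toLp 2 ((a : K), f₁ - (V a - z • (a : K))) := by
    rw [hu, hH.val_toForm]
  have hw1 : (FormDomain.val H (f + z • u)).fst = f₁ + z • (a : K) := by
    rw [map_add, map_smul, huval, hf₁]; rfl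
  have hw2 : (FormDomain.val H (f + z • u)).snd = f₂ + z • (f₁ - (V a - z • (a : K))) := by
    rw [map_add, map_smul, huval, hf₂]; rfl
  refine ⟨u, f + z • u, ⟨?_, ?_⟩, ?_, by abel⟩
  · rw [hw2, huval]
    have : f₂ + z • (f₁ - (V a - z • (a : K))) - V (f₁ - (V a - z • (a : K))) = L a := by
      have e : f₂ = L a - V (V a) + (2 * z) • V a - z ^ 2 • (a : K) + (V f₁ - z • f₁) := by
        rw [hM', sub_add_cancel]
      rw [e]
      simp only [map_sub, map_smul]
      module
    change ((a : K), f₂ + z • (f₁ - (V a - z • (a : K))) - V (f₁ - (V a - z • (a : K)))) ∈ L.graph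
    rw [this]
    exact L.mem_graph a
  · rw [hw1, huval]
    change f₁ + z • (a : K) = V a + (f₁ - (V a - z • (a : K)))
    abel
  · rw [hw1]
    exact L.domain.add_mem hfd (L.domain.smul_mem z a.2)

end IsHamiltonian

end Pencil

end StaticKG

namespace StaticKG

/-! ### Transfer of lower bounds between B − z and the pencil. -/

section Resolvent

variable {K : Type*} [NormedAddCommGroup K] [InnerProductSpace ℂ K]

theorem bound_topologicalClosure {z : ℂ} {c : ℝ} (G : Submodule ℂ (K × K))
    (hG : ∀ p ∈ G, c * ‖p.1‖ ≤ ‖p.2 - z • p.1‖) :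
    ∀ p ∈ G.topologicalClosure, c * ‖p.1‖ ≤ ‖p.2 - z • p.1‖ := by
  intro p hp
  rw [← SetLike.mem_coe, Submodule.topologicalClosure_coe] at hp
  have hcl : IsClosed {p : K × K | c * ‖p.1‖ ≤ ‖p.2 - z • p.1‖} :=
    isClosed_le (by fun_prop) (by fun_prop)
  exact closure_minimal hG hcl hp

theorem neg_smul_id_add (T : K →ₗ.[ℂ] K) (z : ℂ) (u : T.domain) :
    (-(z • ContinuousLinearMap.id ℂ K) : K →L[ℂ] K) u + T u = T u - z • (u : K) := by
  rw [sub_eq_neg_add]; rfl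

theorem inner_neg_smul_id (z : ℂ) (x y : K) :
    ⟪(-(z • ContinuousLinearMap.id ℂ K) : K →L[ℂ] K) x, y⟫_ℂ =
      ⟪x, (-((starRingEnd ℂ z) • ContinuousLinearMap.id ℂ K) : K →L[ℂ] K) y⟫_ℂ := by
  simp only [neg_apply, smul_apply, ContinuousLinearMap.id_apply, inner_neg_left, inner_neg_right,
    inner_smul_left, inner_smul_right]

variable [CompleteSpace K]

/-- A real number is in the resolvent set of a self-adjoint operator `T` if and only if `T - z` is
bounded from below. -/
theorem mem_resolventSet_iff_of_im_eq_zero {T : K →ₗ.[ℂ] K} (hT : IsSelfAdjoint T) {z : ℂ}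
    (hz : z.im = 0) : z ∈ resolventSet T ↔
      ∃ c : ℝ, 0 < c ∧ ∀ p ∈ T.graph, c * ‖p.1‖ ≤ ‖p.2 - z • p.1‖ := by
  change IsBoundedlyInvertible
    (((-(z • ContinuousLinearMap.id ℂ K) : K →L[ℂ] K) : K →ₗ[ℂ] K) +ᵥ T) ↔ _
  constructor
  · intro hinv
    obtain ⟨c, hc, hb⟩ := hinv.exists_bound
    refine ⟨c, hc, ?_⟩
    rintro ⟨u, w⟩ hp
    obtain ⟨hu, rfl⟩ := mk_mem_graph_iff.1 hp
    rw [← neg_smul_id_add T z ⟨u, hu⟩]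
    exact hb ⟨u, hu⟩
  · rintro ⟨c, hc, hb⟩
    have hb' : ∀ u : T.domain, c * ‖(u : K)‖ ≤
        ‖(-(z • ContinuousLinearMap.id ℂ K) : K →L[ℂ] K) u + T u‖ := fun u => by
      rw [neg_smul_id_add]
      exact hb _ (T.mem_graph u)
    have hs := inner_neg_smul_id (K := K) z
    rw [Complex.conj_eq_iff_im.2 hz] at hs
    exact isBoundedlyInvertible_vadd hT hs hc hb' hb'

theorem mem_resolventSet_of_im_ne_zero {T : K →ₗ.[ℂ] K} (hT : IsSelfAdjoint T) {z : ℂ}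
    (hz : z.im ≠ 0) : z ∈ resolventSet T := by
  change IsBoundedlyInvertible
    (((-(z • ContinuousLinearMap.id ℂ K) : K →L[ℂ] K) : K →ₗ[ℂ] K) +ᵥ T)
  have hbd : ∀ (z : ℂ) (u : T.domain), |z.im| * ‖(u : K)‖ ≤
      ‖(-(z • ContinuousLinearMap.id ℂ K) : K →L[ℂ] K) u + T u‖ := fun z u => by
    rw [neg_smul_id_add]
    have h1 : (⟪(u : K), T u⟫_ℂ).im = 0 := by
      have h2 := inner_conj_symm (𝕜 := ℂ) (u : K) (T u)
      rw [isFormalAdjoint_of_isSelfAdjoint hT u u] at h2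
      exact Complex.conj_eq_iff_im.1 h2
    have h2 : (⟪(u : K), (u : K)⟫_ℂ).re = ‖(u : K)‖ ^ 2 := inner_self_eq_norm_sq (𝕜 := ℂ) _
    have h3 : |z.im| * ‖(u : K)‖ ^ 2 ≤ ‖(u : K)‖ * ‖T u - z • (u : K)‖ := by
      calc |z.im| * ‖(u : K)‖ ^ 2 = |(⟪(u : K), T u - z • (u : K)⟫_ℂ).im| := by
            have h5 : (⟪(u : K), (u : K)⟫_ℂ).im = 0 := inner_self_im (𝕜 := ℂ) _
            rw [inner_sub_right, inner_smul_right, Complex.sub_im, h1, Complex.mul_im, h5, h2,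
              mul_zero, zero_add, zero_sub, abs_neg, abs_mul, abs_of_nonneg (sq_nonneg ‖(u : K)‖)]
        _ ≤ _ := (Complex.abs_im_le_norm _).trans (norm_inner_le_norm _ _)
    rcases (norm_nonneg (u : K)).eq_or_lt with h0 | h0
    · rw [← h0, mul_zero]; exact norm_nonneg _
    · have : ‖(u : K)‖ * (|z.im| * ‖(u : K)‖) ≤ ‖(u : K)‖ * ‖T u - z • (u : K)‖ := by
        refine le_trans (le_of_eq ?_) h3; ring
      exact le_of_mul_le_mul_left this h0
  refine isBoundedlyInvertible_vadd hT (inner_neg_smul_id z) (abs_pos.2 hz) (hbd z) fun u => ?_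
  have := hbd (starRingEnd ℂ z) u
  rwa [Complex.conj_im, abs_neg] at this

namespace IsHamiltonian

variable {L : K →ₗ.[ℂ] K} {V : K →L[ℂ] K} {H : WithLp 2 (K × K) →ₗ.[ℂ] WithLp 2 (K × K)}
  (h : IsHamiltonian L V H)
include h

theorem inner_sub_V_V (a b : L.domain) :
    ⟪L a - V (V a), (b : K)⟫_ℂ = ⟪(a : K), L b - V (V b)⟫_ℂ := by
  have h1 := h.inner_L (L.mem_graph a) (L.mem_graph b)
  rw [inner_sub_left, inner_sub_right, h1, h.inner_V, h.inner_V]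

/-- The square is completed in (u | Hu), with `w.fst` equal to V u₁ + u₂. -/
theorem norm_wavePair_sq {u w : FormDomain H} (hp : IsWavePair L V u w) (a : L.domain)
    (ha : (FormDomain.val H u).fst = a) :
    ‖u‖ ^ 2 = (⟪(a : K), L a - V (V a)⟫_ℂ).re + ‖(FormDomain.val H w).fst‖ ^ 2 := by
  have h1 : ‖u‖ ^ 2 = (⟪u, u⟫_ℂ).re := (inner_self_eq_norm_sq (𝕜 := ℂ) u).symm
  obtain ⟨hp1, hp2⟩ := hp
  have h0 := h.inner_wavePair ⟨hp1, hp2⟩ u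
  rw [ha] at h0 hp1 hp2
  obtain ⟨ha', hL⟩ := mk_mem_graph_iff.1 hp1
  have hL' : L a = (FormDomain.val H w).snd - V (FormDomain.val H u).snd := hL
  have e1 : (FormDomain.val H w).snd = L a + V (FormDomain.val H u).snd := by rw [hL']; abel
  have e2 : (FormDomain.val H u).snd = (FormDomain.val H w).fst - V a := by rw [hp2]; abel
  rw [h1, h0, e1, e2, ← re_inner_self, ← Complex.add_re]
  congr 1
  simp only [map_sub, inner_add_right, inner_sub_left, inner_sub_right, h.inner_V]
  ring

/-- The energy norm controls `V f₁ + f₂`. -/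
theorem norm_V_add_le (f : FormDomain H) :
    ‖V (FormDomain.val H f).fst + (FormDomain.val H f).snd‖ ≤ ‖f‖ := by
  obtain ⟨g, hg⟩ : ∃ g, g = V (FormDomain.val H f).fst + (FormDomain.val H f).snd := ⟨_, rfl⟩
  -- The test vector is (0, g): H(0, g) = (Vg, g), and its energy norm is ‖g‖.
  obtain ⟨hd, hH⟩ := mk_mem_graph_iff.1 (h.mem_graph (a := 0) (g := g) rfl rfl)
  have hn := h.isNonnegSelfAdjoint_H.norm_toForm_sq ⟨_, hd⟩
  have hi := h.isNonnegSelfAdjoint_H.inner_toForm f ⟨_, hd⟩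
  rw [hH, inner_prod] at hn hi
  simp only [WithLp.toLp_fst, WithLp.toLp_snd, LinearPMap.map_zero, ZeroMemClass.coe_zero, map_zero,
    zero_add, inner_zero_left, re_inner_self] at hn hi
  rw [← h.inner_V, ← inner_add_left, ← hg] at hi
  rw [← hg]
  have h1 : ‖g‖ ^ 2 ≤ ‖f‖ * ‖g‖ := by
    rw [← re_inner_self, ← hi, ← (sq_eq_sq₀ (norm_nonneg _) (norm_nonneg _)).1 hn]
    exact (Complex.re_le_norm _).trans (norm_inner_le_norm _ _)
  rcases (norm_nonneg g).eq_or_lt with h0 | h0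
  · rw [← h0]; exact norm_nonneg _
  · rw [sq] at h1
    exact le_of_mul_le_mul_right h1 h0

/-- The energy norm controls the form of `L - V²` in the first component. -/
theorem norm_inner_sub_V_V_le (f : FormDomain H) (a : L.domain) :
    ‖⟪L a - V (V a), (FormDomain.val H f).fst⟫_ℂ‖ ≤
      √(⟪(a : K), L a - V (V a)⟫_ℂ).re * ‖f‖ := by
  -- The test vector is (a, −Va): its image under H has vanishing second component, so only the
  -- first component of `f` is seen.
  obtain ⟨hd, hH⟩ := mk_mem_graph_iff.1 (h.mem_graph (a := a) (g := -V a) rfl rfl)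
  have hn := h.isNonnegSelfAdjoint_H.norm_toForm_sq ⟨_, hd⟩
  have hi := h.isNonnegSelfAdjoint_H.inner_toForm f ⟨_, hd⟩
  rw [hH, inner_prod] at hn hi
  simp only [WithLp.toLp_fst, WithLp.toLp_snd, map_neg, add_neg_cancel, inner_zero_right, add_zero,
    ← sub_eq_add_neg] at hn hi
  rw [← hn, Real.sqrt_sq (norm_nonneg _), norm_inner_symm, ← hi, mul_comm]
  exact norm_inner_le_norm _ _

omit [CompleteSpace K] h in
theorem sub_V_V_eq (z : ℂ) (a : L.domain) :
    L a - V (V a) = pencilOp L V z a - (2 * z) • V a + z ^ 2 • (a : K) := by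
  rw [pencilOp_apply]; abel

/-- If `L - (V - z)²` is bounded from below for a real `z`, then so is `B - z` in the energy
space. -/
theorem exists_bound_wavePair {z : ℂ} (hz : z.im = 0) {c : ℝ} (hc : 0 < c)
    (hb : ∀ u : L.domain, c * ‖(u : K)‖ ≤ ‖pencilOp L V z u‖) :
    ∃ C : ℝ, 0 < C ∧ ∀ u w : FormDomain H, IsWavePair L V u w → ‖u‖ ≤ C * ‖w - z • u‖ := by
  have hzz : starRingEnd ℂ z = z := Complex.conj_eq_iff_im.2 hz
  have hb' : ∀ a : L.domain, ‖(a : K)‖ ≤ c⁻¹ * ‖pencilOp L V z a‖ := fun a => by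
    rw [← div_eq_inv_mul, le_div_iff₀ hc, mul_comm]; exact hb a
  -- The operator p(z) − S is bounded with norm at most `k`, so a lower bound for p(z) also controls
  -- S a by p(z) a.
  obtain ⟨k, hk⟩ : ∃ k, k = 2 * ‖z‖ * ‖V‖ + ‖z‖ ^ 2 := ⟨_, rfl⟩
  have hk0 : 0 ≤ k := by rw [hk]; positivity
  have hS : ∀ a : L.domain, ‖L a - V (V a)‖ ≤ (1 + k * c⁻¹) * ‖pencilOp L V z a‖ := fun a => by
    rw [sub_V_V_eq (L := L) (V := V) z]
    have h1 : ‖(2 * z) • V a‖ ≤ 2 * ‖z‖ * ‖V‖ * ‖(a : K)‖ := by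
      rw [norm_smul, norm_mul, RCLike.norm_ofNat, mul_assoc _ ‖V‖]
      gcongr
      exact V.le_opNorm _
    have h2 : ‖z ^ 2 • (a : K)‖ = ‖z‖ ^ 2 * ‖(a : K)‖ := by rw [norm_smul, norm_pow]
    have h3 := norm_add_le (pencilOp L V z a - (2 * z) • V a) (z ^ 2 • (a : K))
    have h4 := norm_sub_le (pencilOp L V z a) ((2 * z) • V a)
    have h5 : k * ‖(a : K)‖ ≤ k * (c⁻¹ * ‖pencilOp L V z a‖) := by gcongr; exact hb' a
    rw [hk] at h5 ⊢
    linarith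
  obtain ⟨k₁, hk₁⟩ : ∃ k₁, k₁ = √(c⁻¹ * (1 + k * c⁻¹)) := ⟨_, rfl⟩
  have hk₁0 : 0 ≤ k₁ := by rw [hk₁]; positivity
  have hq' : ∀ a : L.domain, (⟪(a : K), L a - V (V a)⟫_ℂ).re ≤ ‖(a : K)‖ * ‖L a - V (V a)‖ :=
    fun a => (Complex.re_le_norm _).trans (norm_inner_le_norm _ _)
  have hq : ∀ a : L.domain, √(⟪(a : K), L a - V (V a)⟫_ℂ).re ≤ k₁ * ‖pencilOp L V z a‖ := fun a => by
    rw [hk₁, Real.sqrt_le_left (by positivity), mul_pow, Real.sq_sqrt (by positivity)]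
    refine (hq' a).trans ?_
    calc ‖(a : K)‖ * ‖L a - V (V a)‖
        ≤ (c⁻¹ * ‖pencilOp L V z a‖) * ((1 + k * c⁻¹) * ‖pencilOp L V z a‖) :=
          mul_le_mul (hb' a) (hS a) (norm_nonneg _) (by positivity)
      _ = _ := by ring
  obtain ⟨N, hN1, -⟩ := h.isBoundedlyInvertible_pencilOp_of_bound hz hc hb
  obtain ⟨k₂, hk₂⟩ : ∃ k₂, k₂ = ‖z‖ * c⁻¹ + k₁ := ⟨_, rfl⟩
  have hk₂0 : 0 ≤ k₂ := by rw [hk₂]; positivity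
  obtain ⟨k₃, hk₃⟩ : ∃ k₃, k₃ = 1 + (2 * ‖V‖ + ‖z‖) * k₂ := ⟨_, rfl⟩
  have hk₃0 : 0 ≤ k₃ := by rw [hk₃]; positivity
  have key : ∀ u w : FormDomain H, IsWavePair L V u w → ∀ a : L.domain,
      (FormDomain.val H u).fst = a → ‖(FormDomain.val H w).fst‖ ≤ k₂ * ‖w - z • u‖ ∧
      ‖L a - V (V a)‖ ≤ k₃ * ‖w - z • u‖ := by
    intro u w hp a ha
    obtain ⟨hp1, hp2⟩ := hp
    obtain ⟨v, hv⟩ : ∃ v, v = (FormDomain.val H w).fst := ⟨_, rfl⟩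
    obtain ⟨w₂, hw₂⟩ : ∃ v, v = (FormDomain.val H w).snd := ⟨_, rfl⟩
    obtain ⟨u₂, hu₂⟩ : ∃ v, v = (FormDomain.val H u).snd := ⟨_, rfl⟩
    rw [ha, ← hw₂, ← hu₂] at hp1
    rw [ha, ← hv, ← hu₂] at hp2
    have hL : L a = w₂ - V u₂ := (mk_mem_graph_iff.1 hp1).2
    obtain ⟨f, hf⟩ : ∃ f, f = w - z • u := ⟨_, rfl⟩
    have hf1 : (FormDomain.val H f).fst = v - z • (a : K) := by
      rw [hf, map_sub, map_smul, WithLp.sub_fst, WithLp.smul_fst, ha, hv]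
    have hf2 : (FormDomain.val H f).snd = w₂ - z • u₂ := by
      rw [hf, map_sub, map_smul, WithLp.sub_snd, WithLp.smul_snd, hw₂, hu₂]
    obtain ⟨g, hg⟩ : ∃ g, g = V (FormDomain.val H f).fst + (FormDomain.val H f).snd := ⟨_, rfl⟩
    have hgn : ‖g‖ ≤ ‖f‖ := hg ▸ h.norm_V_add_le f
    rw [← hf, ← hv]
    -- The components of f = (B − z)u enter only through g = V f₁ + f₂, whose L² norm is bounded by
    -- the energy norm of f.
    have e1 : L a - V (V a) = g - (2 : ℂ) • V v + z • v := by
      rw [hg, hf1, hf2, hL, hp2]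
      simp only [map_sub, map_smul, map_add]
      module
    -- Weakly, `v` solves p(z)v = zg + S f₁. Taking for `b` the solution of p(z)b = v bounds ‖v‖ by
    -- the energy norm of f, since (S b | f₁) is bounded by the form norm of `b` times that norm.
    have e2 : ∀ b : L.domain, ⟪pencilOp L V z b, v⟫_ℂ =
        z * ⟪(b : K), g⟫_ℂ + ⟪L b - V (V b), (FormDomain.val H f).fst⟫_ℂ := fun b => by
      rw [hf1, inner_sub_right _ v, inner_smul_right, h.inner_sub_V_V b a, e1, pencilOp_apply]
      simp only [inner_sub_left, inner_add_left, inner_add_right, inner_sub_right, inner_smul_left,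
        inner_smul_right, map_mul, map_pow, hzz, h.inner_V, map_ofNat]
      ring
    have hvn : ‖v‖ ≤ k₂ * ‖f‖ := by
      obtain ⟨hd, hM⟩ := hN1 v
      obtain ⟨b, hbeq⟩ : ∃ b : L.domain, b = ⟨N v, hd⟩ := ⟨_, rfl⟩
      have hMb : pencilOp L V z b = v := by rw [hbeq]; exact hM
      have h1 := e2 b
      rw [hMb] at h1
      have h2 : ‖v‖ ^ 2 ≤ (k₂ * ‖f‖) * ‖v‖ := by
        rw [← re_inner_self, h1]
        refine (Complex.re_le_norm _).trans ((norm_add_le _ _).trans ?_)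
        have h3 : ‖z * ⟪(b : K), g⟫_ℂ‖ ≤ ‖z‖ * ((c⁻¹ * ‖v‖) * ‖f‖) := by
          rw [norm_mul]
          gcongr
          refine (norm_inner_le_norm _ _).trans ?_
          have := hb' b
          rw [hMb] at this
          gcongr
        have h4 := h.norm_inner_sub_V_V_le f b
        have h5 := hq b
        rw [hMb] at h5
        have h6 := mul_le_mul_of_nonneg_right h5 (norm_nonneg f)
        rw [hk₂]
        refine (add_le_add h3 (h4.trans h6)).trans (le_of_eq ?_)
        ring
      rcases (norm_nonneg v).eq_or_lt with h0 | h0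
      · rw [← h0]; positivity
      · rw [sq] at h2
        exact le_of_mul_le_mul_right h2 h0
    refine ⟨hvn, ?_⟩
    rw [e1]
    have h1 := norm_add_le (g - (2 : ℂ) • V v) (z • v)
    have h2 := norm_sub_le g ((2 : ℂ) • V v)
    rw [norm_smul, RCLike.norm_ofNat] at h2
    rw [norm_smul] at h1
    have h3 := V.le_opNorm v
    have h4 : (2 * ‖V‖ + ‖z‖) * ‖v‖ ≤ (2 * ‖V‖ + ‖z‖) * (k₂ * ‖f‖) := by gcongr
    rw [hk₃]
    linarith
  -- The L² norm of f₁ is not controlled by the energy norm, so z a = v − f₁ does not bound `a`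
  -- directly. For z ≠ 0 that identity is paired with S a, which sees f₁ only through the form; the
  -- term linear in `s` is absorbed by completing the square. For z = 0 the pencil is S itself and
  -- the lower bound is applied directly.
  have hform : ∃ k₄ : ℝ, 0 ≤ k₄ ∧ ∀ u w : FormDomain H, IsWavePair L V u w → ∀ a : L.domain,
      (FormDomain.val H u).fst = a →
      (⟪(a : K), L a - V (V a)⟫_ℂ).re ≤ k₄ * ‖w - z • u‖ ^ 2 := by
    by_cases hz0 : z = 0
    · refine ⟨c⁻¹ * k₃ ^ 2, by positivity, fun u w hp a ha => ?_⟩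
      obtain ⟨-, h2⟩ := key u w hp a ha
      have h3 : L a - V (V a) = pencilOp L V z a := by rw [sub_V_V_eq (L := L) (V := V) z, hz0]; simp
      have h1 := hb' a
      rw [← h3] at h1
      calc _ ≤ ‖(a : K)‖ * ‖L a - V (V a)‖ := hq' a
        _ ≤ c⁻¹ * ‖L a - V (V a)‖ * ‖L a - V (V a)‖ := by gcongr
        _ ≤ c⁻¹ * (k₃ * ‖w - z • u‖) * (k₃ * ‖w - z • u‖) := by gcongr
        _ = _ := by ring
    · have hzn : 0 < ‖z‖ := norm_pos_iff.2 hz0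
      refine ⟨2 * ‖z‖⁻¹ * (k₃ * k₂ + (2 * ‖z‖)⁻¹), by positivity, fun u w hp a ha => ?_⟩
      obtain ⟨h1, h2⟩ := key u w hp a ha
      have h3 := h.norm_inner_sub_V_V_le (w - z • u) a
      have hf1 : (FormDomain.val H (w - z • u)).fst = (FormDomain.val H w).fst - z • (a : K) := by
        rw [map_sub, map_smul, WithLp.sub_fst, WithLp.smul_fst, ha]
      rw [hf1] at h3
      obtain ⟨s, hs⟩ : ∃ s, s = √(⟪(a : K), L a - V (V a)⟫_ℂ).re := ⟨_, rfl⟩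
      obtain ⟨n, hn⟩ : ∃ n, n = ‖w - z • u‖ := ⟨_, rfl⟩
      have hs2 : (⟪(a : K), L a - V (V a)⟫_ℂ).re = s ^ 2 := by
        rw [hs, Real.sq_sqrt (h.form_nonneg a)]
      rw [← hs, ← hn] at h3
      rw [← hn] at h1 h2 ⊢
      rw [hs2]
      have h4 : ‖z‖ * s ^ 2 ≤ (k₃ * n) * (k₂ * n) + s * n := by
        have e : z * ⟪L a - V (V a), (a : K)⟫_ℂ = ⟪L a - V (V a), (FormDomain.val H w).fst⟫_ℂ -
            ⟪L a - V (V a), (FormDomain.val H w).fst - z • (a : K)⟫_ℂ := by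
          rw [inner_sub_right _ (FormDomain.val H w).fst, inner_smul_right]; ring
        calc ‖z‖ * s ^ 2 ≤ ‖z‖ * ‖⟪L a - V (V a), (a : K)⟫_ℂ‖ := by
              rw [← hs2, h.inner_sub_V_V]
              gcongr
              exact Complex.re_le_norm _
          _ = ‖z * ⟪L a - V (V a), (a : K)⟫_ℂ‖ := (norm_mul _ _).symm
          _ ≤ _ := by
              rw [e]
              refine (norm_sub_le _ _).trans (add_le_add ?_ h3)
              exact (norm_inner_le_norm _ _).trans
                (mul_le_mul h2 h1 (norm_nonneg _) ((norm_nonneg _).trans h2))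
      have h5 : s * n ≤ ‖z‖ * s ^ 2 / 2 + (2 * ‖z‖)⁻¹ * n ^ 2 := by
        have e : ‖z‖ * s ^ 2 / 2 + (2 * ‖z‖)⁻¹ * n ^ 2 - s * n =
            (2 * ‖z‖)⁻¹ * (‖z‖ * s - n) ^ 2 := by field_simp; ring
        have : 0 ≤ (2 * ‖z‖)⁻¹ * (‖z‖ * s - n) ^ 2 := by positivity
        linarith
      have h6 : ‖z‖ / 2 * s ^ 2 ≤ (k₃ * k₂ + (2 * ‖z‖)⁻¹) * n ^ 2 := by linarith
      calc s ^ 2 = 2 * ‖z‖⁻¹ * (‖z‖ / 2 * s ^ 2) := by field_simp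
        _ ≤ 2 * ‖z‖⁻¹ * ((k₃ * k₂ + (2 * ‖z‖)⁻¹) * n ^ 2) := by gcongr
        _ = _ := by ring
  obtain ⟨k₄, hk₄0, hk₄⟩ := hform
  refine ⟨√(k₄ + k₂ ^ 2) + 1, by positivity, fun u w hp => ?_⟩
  have ha : (FormDomain.val H u).fst ∈ L.domain := (mk_mem_graph_iff.1 hp.1).1
  have h1 := h.norm_wavePair_sq hp ⟨_, ha⟩ rfl
  have h2 := hk₄ u w hp ⟨_, ha⟩ rfl
  have h3 := (key u w hp ⟨_, ha⟩ rfl).1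
  have h4 : ‖u‖ ≤ √(k₄ + k₂ ^ 2) * ‖w - z • u‖ := by
    refine (abs_le_of_sq_le_sq' ?_ (by positivity)).2
    rw [mul_pow, Real.sq_sqrt (by positivity), h1, add_mul]
    refine add_le_add h2 ?_
    rw [← mul_pow]
    gcongr
  exact h4.trans (by gcongr; linarith)

/-- If `B - z` is bounded from below in the energy space for a real `z`, then so is
`L - (V - z)²`. -/
theorem exists_bound_pencilOp {z : ℂ} (hz : z.im = 0) {c : ℝ} (hc : 0 < c)
    (hb : ∀ u w : FormDomain H, IsWavePair L V u w → (FormDomain.val H w).fst ∈ L.domain →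
      c * ‖u‖ ≤ ‖w - z • u‖) :
    ∃ d : ℝ, 0 < d ∧ ∀ a : L.domain, d * ‖(a : K)‖ ≤ ‖pencilOp L V z a‖ := by
  have hH := h.isNonnegSelfAdjoint_H
  have key : ∀ a : L.domain, c ^ 2 * ((⟪(a : K), L a - V (V a)⟫_ℂ).re + ‖z‖ ^ 2 * ‖(a : K)‖ ^ 2) ≤
      ‖pencilOp L V z a‖ ^ 2 := by
    intro a
    -- For u = (a, (z − V)a) the first component of (B − z)u vanishes and the second is p(z)a, so
    -- the energy norm of (B − z)u is just ‖p(z)a‖.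
    have hud := (h.mem_domain_iff (WithLp.toLp 2 ((a : K), z • (a : K) - V a))).2 a.2
    have hwd := (h.mem_domain_iff (WithLp.toLp 2 (z • (a : K), L a + V (z • (a : K) - V a)))).2
      (L.domain.smul_mem z a.2)
    obtain ⟨u, hu⟩ : ∃ u, u = hH.toForm ⟨_, hud⟩ := ⟨_, rfl⟩
    obtain ⟨w, hw⟩ : ∃ w, w = hH.toForm ⟨_, hwd⟩ := ⟨_, rfl⟩
    have hu' : FormDomain.val H u = WithLp.toLp 2 ((a : K), z • (a : K) - V a) := by
      rw [hu, hH.val_toForm]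
    have hw' : FormDomain.val H w =
        WithLp.toLp 2 (z • (a : K), L a + V (z • (a : K) - V a)) := by
      rw [hw, hH.val_toForm]
    have hp : IsWavePair L V u w := by
      refine ⟨?_, ?_⟩
      · rw [hu', hw']
        change ((a : K), L a + V (z • (a : K) - V a) - V (z • (a : K) - V a)) ∈ L.graph
        rw [add_sub_cancel_right]
        exact L.mem_graph a
      · rw [hu', hw']
        change z • (a : K) = V a + (z • (a : K) - V a)
        abel
    have h1 := hb u w hp (by rw [hw']; exact L.domain.smul_mem z a.2)
    have h2 := h.norm_wavePair_sq hp a (by rw [hu']; rfl)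
    have h3 : (FormDomain.val H w).fst = z • (a : K) := by rw [hw']; rfl
    rw [h3, norm_smul, mul_pow] at h2
    have h4 : ‖w - z • u‖ ^ 2 = ‖pencilOp L V z a‖ ^ 2 := by
      have hval : FormDomain.val H (w - z • u) = WithLp.toLp 2 (0, pencilOp L V z a) := by
        rw [map_sub, map_smul, hu', hw', pencilOp_apply]
        refine (WithLp.ofLp_injective 2) (Prod.ext ?_ ?_)
        · change z • (a : K) - z • (a : K) = 0
          abel
        · change L a + V (z • (a : K) - V a) - z • (z • (a : K) - V a) = _
          simp only [map_sub, map_smul]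
          module
      obtain ⟨hd, hH'⟩ := mk_mem_graph_iff.1
        (h.mem_graph (a := 0) (g := pencilOp L V z a) rfl rfl)
      have h5 : w - z • u = hH.toForm ⟨_, hd⟩ :=
        FormDomain.val_injective (by rw [hval, hH.val_toForm]; rfl)
      rw [h5, hH.norm_toForm_sq, hH', inner_prod, ← re_inner_self]
      simp
    rw [← h2, ← h4, ← mul_pow]
    gcongr
  by_cases hz0 : z = 0
  -- At z = 0 the term |z|²‖a‖² is lost. What remains is S² ≥ c²S in the sense of forms, which with
  -- Ker S = 0 separates S from zero.
  · have hS : IsSelfAdjoint (pencilOp L V z) := by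
      refine isSelfAdjoint_vadd h.isSelfAdjoint fun x y => ?_
      have := h.inner_sub_smul z x y
      rwa [Complex.conj_eq_iff_im.2 hz] at this
    have hMS : ∀ a : L.domain, pencilOp L V z a = L a - V (V a) := fun a => by
      rw [sub_V_V_eq (L := L) (V := V) z, hz0]; simp
    have hnn : ∀ a : L.domain, 0 ≤ (⟪(a : K), pencilOp L V z a⟫_ℂ).re := fun a => by
      rw [hMS]; exact h.form_nonneg a
    have hkey : ∀ a : L.domain,
        c ^ 2 * (⟪(a : K), pencilOp L V z a⟫_ℂ).re ≤ ‖pencilOp L V z a‖ ^ 2 := fun a => by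
      have h1 := key a
      rw [← hMS, hz0, norm_zero, ← hz0] at h1
      linarith
    exact (IsNonnegSelfAdjoint.mk hS hnn).exists_bound_of_form_bound (fun a ha =>
      h.eq_zero_of_sub_eq_zero a ((hMS a).symm.trans ha)) (c := c ^ 2) (by positivity) hkey
  · refine ⟨c * ‖z‖, mul_pos hc (norm_pos_iff.2 hz0), fun a => ?_⟩
    refine (abs_le_of_sq_le_sq' ?_ (norm_nonneg _)).2
    refine le_trans ?_ (key a)
    have := mul_nonneg (sq_nonneg c) (h.form_nonneg a)
    linarith [mul_pow (c * ‖z‖) ‖(a : K)‖ 2, mul_pow c ‖z‖ 2]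

end IsHamiltonian

namespace IsWaveSystem

variable {L₀ L : K →ₗ.[ℂ] K} {V : K →L[ℂ] K} {H : WithLp 2 (K × K) →ₗ.[ℂ] WithLp 2 (K × K)}
  (h : IsWaveSystem L₀ L V H)
include h

/-- For imaginary z ≠ 0 the equation (B − z)u = f is solved for `f` in Dom H, which is dense in the
energy space, and the pairs obtained lie in the closure of the graph. -/
theorem isEssentiallySelfAdjoint_waveOp :
    IsEssentiallySelfAdjoint (waveGraph L₀ V H).toLinearPMap := by
  refine isEssentiallySelfAdjoint_of_dense_range h.waveOp_symm h.dense_waveOp_domain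
    fun z hz hz0 => ?_
  have him : z.im ≠ 0 := fun him => hz0 (Complex.ext hz him)
  have h1 := h.isNonnegSelfAdjoint_H.dense_formDomain (D := Set.univ) (fun p hp =>
    subset_closure ⟨hp, trivial⟩)
  have h2 := UniformSpace.Completion.denseRange_coe.dense_image
    (UniformSpace.Completion.continuous_coe (FormDomain H)) h1
  refine h2.mono ?_
  rintro _ ⟨f, ⟨hf, -⟩, rfl⟩
  obtain ⟨u, w, hp, hw, rfl⟩ :=
    h.exists_isWavePair_sub_smul (h.isBoundedlyInvertible_pencilOp_of_im_ne_zero him) hf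
  refine ⟨((u : EnergySpace H), (w : EnergySpace H)), ?_, ?_⟩
  · rw [h.waveOp_graph]
    exact h.mem_closure_waveGraph hp hw
  · rw [UniformSpace.Completion.coe_sub, UniformSpace.Completion.coe_smul]

theorem closure_waveOp_graph : (waveGraph L₀ V H).toLinearPMap.closure.graph =
    (waveGraph L₀ V H).topologicalClosure := by
  rw [← h.isEssentiallySelfAdjoint_waveOp.1.graph_closure_eq_closure_graph, h.waveOp_graph]

theorem resolventSet_waveOp : resolventSet (waveGraph L₀ V H).toLinearPMap.closure =
    {z : ℂ | IsBoundedlyInvertible (compBounded (pencilOp L V z) (invSqrtOneAdd L))} := by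
  have hB := h.isEssentiallySelfAdjoint_waveOp.2
  have hgraph := h.closure_waveOp_graph
  have hnorm : ∀ (z : ℂ) (u w : FormDomain H),
      ‖(w : EnergySpace H) - z • (u : EnergySpace H)‖ = ‖w - z • u‖ := fun z u w => by
    rw [← UniformSpace.Completion.coe_smul, ← UniformSpace.Completion.coe_sub,
      UniformSpace.Completion.norm_coe]
  ext z
  rw [Set.mem_ofPred_eq, h.isBoundedlyInvertible_compBounded_iff]
  -- For real z invertibility on both sides is a matter of lower bounds. That of B − z is needed
  -- only on test functions, because it passes to the closure of the graph; non-real z belong to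
  -- both sets.
  by_cases hz : z.im = 0
  · rw [mem_resolventSet_iff_of_im_eq_zero hB hz]
    constructor
    · rintro ⟨c, hc, hcb⟩
      obtain ⟨d, hd, hdb⟩ := h.exists_bound_pencilOp hz hc fun u w hp hw => by
        have h1 := hcb _ (by rw [hgraph]; exact h.mem_closure_waveGraph hp hw)
        rwa [hnorm, UniformSpace.Completion.norm_coe] at h1
      exact h.isBoundedlyInvertible_pencilOp_of_bound hz hd hdb
    · intro hinv
      obtain ⟨c, hc, hcb⟩ := hinv.exists_bound
      obtain ⟨C, hC, hCb⟩ := h.exists_bound_wavePair hz hc hcb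
      refine ⟨C⁻¹, inv_pos.2 hC, ?_⟩
      rw [hgraph]
      refine bound_topologicalClosure _ fun p hq => ?_
      obtain ⟨u, w, hp, -, rfl⟩ := mem_waveGraph_iff.1 hq
      rw [hnorm, UniformSpace.Completion.norm_coe, inv_mul_le_iff₀ hC]
      exact hCb u w (h.isWavePair hp)
  · exact iff_of_true (mem_resolventSet_of_im_ne_zero hB hz)
      (h.isBoundedlyInvertible_pencilOp_of_im_ne_zero hz)

end IsWaveSystem

end Resolvent

end StaticKG

namespace StaticKG

/-! ### Regularity of the coefficients in a chart. -/

namespace StaticData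

variable {n : ℕ} {X : Type*} [TopologicalSpace X]
  [ChartedSpace (EuclideanSpace ℝ (Fin n)) X] [IsManifold (𝓡 n) ∞ X]
  {e e' : OpenPartialHomeomorph X (EuclideanSpace ℝ (Fin n))}

theorem contMDiffOn_chart_symm (he : e ∈ atlas (EuclideanSpace ℝ (Fin n)) X) :
    ContMDiffOn (𝓡 n) (𝓡 n) ∞ e.symm e.target :=
  contMDiffOn_symm_of_mem_maximalAtlas (IsManifold.subset_maximalAtlas he)

theorem contMDiffOn_chart (he : e ∈ atlas (EuclideanSpace ℝ (Fin n)) X) :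
    ContMDiffOn (𝓡 n) (𝓡 n) ∞ e e.source :=
  contMDiffOn_of_mem_maximalAtlas (IsManifold.subset_maximalAtlas he)

theorem mdifferentiable_chart (he : e ∈ atlas (EuclideanSpace ℝ (Fin n)) X) :
    e.MDifferentiable (𝓡 n) (𝓡 n) :=
  have : IsManifold (𝓡 n) 1 X := IsManifold.of_le (n := ∞) (by simp)
  mdifferentiable_of_mem_atlas he

theorem contDiffOn_comp_chart_symm {F : Type*} [NormedAddCommGroup F] [NormedSpace ℝ F]
    (he : e ∈ atlas (EuclideanSpace ℝ (Fin n)) X) {k : ℕ∞} {f : X → F}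
    (hf : ContMDiff (𝓡 n) 𝓘(ℝ, F) k f) :
    ContDiffOn ℝ k (fun y => f (e.symm y)) e.target := by
  have h := hf.comp_contMDiffOn ((contMDiffOn_chart_symm he).of_le (by exact_mod_cast le_top))
  exact h.contDiffOn

theorem contMDiffOn_coordVec (he : e ∈ atlas (EuclideanSpace ℝ (Fin n)) X) (j : Fin n) :
    ContMDiffOn (𝓡 n) ((𝓡 n).prod (𝓡 n)) 1
      (fun y => TotalSpace.mk' (EuclideanSpace ℝ (Fin n)) (E := (TangentSpace (𝓡 n) : X → Type _))
        (e.symm y) (coordVec e y j)) e.target := by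
  have : IsManifold (𝓡 n) 1 X := IsManifold.of_le (n := ∞) (by simp)
  have h := (contMDiffOn_chart_symm he).contMDiffOn_tangentMapWithin (m := 1)
    (by norm_cast) e.open_target.uniqueMDiffOn
  have hs : ContMDiff (𝓡 n) ((𝓡 n).prod (𝓡 n)) 1
      (fun y : EuclideanSpace ℝ (Fin n) => (⟨y, EuclideanSpace.single j (1 : ℝ)⟩ :
        TangentBundle (𝓡 n) (EuclideanSpace ℝ (Fin n)))) := by
    intro y
    exact contMDiffAt_vectorSpace_iff_contDiffAt.2 contDiffAt_const
  refine (h.comp hs.contMDiffOn (fun y hy => hy)).congr fun y hy => ?_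
  simp [tangentMapWithin, coordVec, mfderivWithin_of_isOpen e.open_target hy]

variable (D : StaticData n X)

theorem contDiffOn_gram (he : e ∈ atlas (EuclideanSpace ℝ (Fin n)) X) (i j : Fin n) :
    ContDiffOn ℝ 1 (fun y => D.gram e y i j) e.target := by
  rw [← contMDiffOn_iff_contDiffOn]
  intro y hy
  have hb : ContMDiffWithinAt (𝓡 n) (𝓡 n) 1 e.symm e.target y :=
    (contMDiffOn_chart_symm he y hy).of_le (by exact_mod_cast le_top)
  have : ContMDiffWithinAt (𝓡 n) ((𝓡 n).prod 𝓘(ℝ)) 1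
      (fun m ↦ TotalSpace.mk' ℝ (E := Bundle.Trivial X ℝ) (e.symm m)
        (D.g.inner (e.symm m) (coordVec e m i) (coordVec e m j))) e.target y := by
    apply ContMDiffWithinAt.clm_bundle_apply₂ (F₁ := EuclideanSpace ℝ (Fin n))
      (F₂ := EuclideanSpace ℝ (Fin n))
    · exact ContMDiffAt.comp_contMDiffWithinAt y
        ((D.g.contMDiff.of_le (by norm_num)).contMDiffAt) hb
    · exact contMDiffOn_coordVec he i y hy
    · exact contMDiffOn_coordVec he j y hy
  simp only [contMDiffWithinAt_totalSpace] at this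
  exact this.2

theorem contDiffOn_potential (he : e ∈ atlas (EuclideanSpace ℝ (Fin n)) X) (j : Fin n) :
    ContDiffOn ℝ 1 (fun y => (D.A (e.symm y) (coordVec e y j) : ℝ)) e.target := by
  rw [← contMDiffOn_iff_contDiffOn]
  intro y hy
  have hb : ContMDiffWithinAt (𝓡 n) (𝓡 n) 1 e.symm e.target y :=
    (contMDiffOn_chart_symm he y hy).of_le (by exact_mod_cast le_top)
  have : ContMDiffWithinAt (𝓡 n) ((𝓡 n).prod 𝓘(ℝ)) 1
      (fun m ↦ TotalSpace.mk' ℝ (E := Bundle.Trivial X ℝ) (e.symm m)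
        (D.A (e.symm m) (coordVec e m j))) e.target y := by
    apply ContMDiffWithinAt.clm_bundle_apply (F₁ := EuclideanSpace ℝ (Fin n))
    · exact ContMDiffAt.comp_contMDiffWithinAt y D.A_contMDiff.contMDiffAt hb
    · exact contMDiffOn_coordVec he j y hy
  simp only [contMDiffWithinAt_totalSpace] at this
  exact this.2

theorem gram_isSymm (y : EuclideanSpace ℝ (Fin n)) : (D.gram e y).IsSymm := by
  ext i j
  exact D.g.symm _ _ _

/-- The matrix applied to `v` twice is the metric on the image of `v` under the differential of the
inverse chart, and this differential is injective. -/
theorem posDef_gram (he : e ∈ atlas (EuclideanSpace ℝ (Fin n)) X)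
    {y : EuclideanSpace ℝ (Fin n)} (hy : y ∈ e.target) : (D.gram e y).PosDef := by
  refine Matrix.PosDef.of_dotProduct_mulVec_pos ?_ fun v hv => ?_
  · rw [Matrix.IsHermitian, Matrix.conjTranspose_eq_transpose_of_trivial]
    exact D.gram_isSymm y
  set w : TangentSpace (𝓡 n) (e.symm y) :=
    mfderiv (𝓡 n) (𝓡 n) e.symm y (WithLp.toLp 2 v : EuclideanSpace ℝ (Fin n)) with hw
  have hsum : w = ∑ i, v i • coordVec e y i := by
    have : (WithLp.toLp 2 v : EuclideanSpace ℝ (Fin n)) =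
        ∑ i, v i • EuclideanSpace.single i (1 : ℝ) := by
      ext k; simp [Finset.sum_apply, Pi.single_apply]
    rw [hw, this]
    erw [map_sum]
    refine Finset.sum_congr rfl fun i _ => ?_
    erw [map_smul]
    rfl
  have hne : w ≠ 0 := by
    have hinj := (mdifferentiable_chart he).symm.mfderiv_injective (x := y) hy
    intro h0
    apply hv
    have h1 : (WithLp.toLp 2 v : EuclideanSpace ℝ (Fin n)) = 0 := by
      apply hinj
      rw [← hw, h0]
      exact (map_zero _).symm
    simpa using congrArg (fun z : EuclideanSpace ℝ (Fin n) => z.ofLp) h1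
  have hpos := D.g.pos (e.symm y) w hne
  have : star v ⬝ᵥ (D.gram e y) *ᵥ v = D.g.inner (e.symm y) w w := by
    rw [hsum]
    simp only [map_sum, map_smul, sum_apply, smul_apply,
      dotProduct, Matrix.mulVec, gram, Matrix.of_apply, star_trivial, smul_eq_mul, Finset.mul_sum]
    rw [Finset.sum_comm]
    refine Finset.sum_congr rfl fun i _ => Finset.sum_congr rfl fun j _ => ?_
    ring
  rw [this]
  exact hpos

theorem det_gram_pos (he : e ∈ atlas (EuclideanSpace ℝ (Fin n)) X)
    {y : EuclideanSpace ℝ (Fin n)} (hy : y ∈ e.target) : 0 < (D.gram e y).det :=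
  (D.posDef_gram he hy).det_pos

theorem β_pos (x : X) : 0 < D.β x := by
  obtain ⟨C, hC, h⟩ := D.β_bounds
  exact hC.trans_le (h x).1

end StaticData

end StaticKG

namespace StaticKG

/-! ### Transformation rules under a change of charts. -/

namespace StaticData

variable {n : ℕ} {X : Type*} [TopologicalSpace X]
  [ChartedSpace (EuclideanSpace ℝ (Fin n)) X] [IsManifold (𝓡 n) ∞ X]
  {e e' : OpenPartialHomeomorph X (EuclideanSpace ℝ (Fin n))}

/-- The Jacobian matrix, at the point with coordinates `y'` in the chart `e'`, of the change of
coordinates from `e'` to `e`. -/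
noncomputable def jacobian (e e' : OpenPartialHomeomorph X (EuclideanSpace ℝ (Fin n)))
    (y' : EuclideanSpace ℝ (Fin n)) : Matrix (Fin n) (Fin n) ℝ :=
  Matrix.of fun i j =>
    fderiv ℝ (fun y => e (e'.symm y)) y' (EuclideanSpace.single j (1 : ℝ)) i

omit [ChartedSpace (EuclideanSpace ℝ (Fin n)) X] [IsManifold (𝓡 n) ∞ X] in
theorem symm_transition {y' : EuclideanSpace ℝ (Fin n)} (hy' : y' ∈ (e'.symm.trans e).source) :
    e.symm (e (e'.symm y')) = e'.symm y' :=
  e.left_inv hy'.2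

theorem contDiffOn_transition (he : e ∈ atlas (EuclideanSpace ℝ (Fin n)) X)
    (he' : e' ∈ atlas (EuclideanSpace ℝ (Fin n)) X) :
    ContDiffOn ℝ ∞ (fun y => e (e'.symm y)) (e'.symm.trans e).source := by
  have h := (contMDiffOn_chart he).comp ((contMDiffOn_chart_symm he').mono Set.inter_subset_left)
    (s := (e'.symm.trans e).source) (fun y hy => hy.2)
  exact h.contDiffOn

theorem differentiableAt_transition (he : e ∈ atlas (EuclideanSpace ℝ (Fin n)) X)
    (he' : e' ∈ atlas (EuclideanSpace ℝ (Fin n)) X) {y' : EuclideanSpace ℝ (Fin n)}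
    (hy' : y' ∈ (e'.symm.trans e).source) :
    DifferentiableAt ℝ (fun y => e (e'.symm y)) y' :=
  ((contDiffOn_transition he he').contDiffAt
    ((e'.symm.trans e).open_source.mem_nhds hy')).differentiableAt (by simp)

omit [ChartedSpace (EuclideanSpace ℝ (Fin n)) X] [IsManifold (𝓡 n) ∞ X] in
theorem fderiv_transition_single (y' : EuclideanSpace ℝ (Fin n)) (j : Fin n) :
    fderiv ℝ (fun y => e (e'.symm y)) y' (EuclideanSpace.single j (1 : ℝ)) =
      ∑ i, jacobian e e' y' i j • EuclideanSpace.single i (1 : ℝ) := by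
  ext k
  simp [jacobian, Finset.sum_apply, Pi.single_apply]

omit [ChartedSpace (EuclideanSpace ℝ (Fin n)) X] [IsManifold (𝓡 n) ∞ X] in
theorem det_fderiv_transition (y' : EuclideanSpace ℝ (Fin n)) :
    (fderiv ℝ (fun y => e (e'.symm y)) y').det = (jacobian e e' y').det := by
  rw [ContinuousLinearMap.det, ← LinearMap.det_toMatrix (EuclideanSpace.basisFun (Fin n) ℝ).toBasis]
  congr 1

theorem coordVec_eq_sum_jacobian (he : e ∈ atlas (EuclideanSpace ℝ (Fin n)) X)
    (he' : e' ∈ atlas (EuclideanSpace ℝ (Fin n)) X) {y' : EuclideanSpace ℝ (Fin n)}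
    (hy' : y' ∈ (e'.symm.trans e).source) (j : Fin n) :
    (coordVec e' y' j : EuclideanSpace ℝ (Fin n)) =
      ∑ i, jacobian e e' y' i j •
        (coordVec e (e (e'.symm y')) i : EuclideanSpace ℝ (Fin n)) := by
  have hev : (e'.symm : EuclideanSpace ℝ (Fin n) → X) =ᶠ[nhds y']
      e.symm ∘ (fun y => e (e'.symm y)) := by
    filter_upwards [(e'.symm.trans e).open_source.mem_nhds hy'] with y hy
    exact (e.left_inv hy.2).symm
  have hd : MDifferentiableAt (𝓡 n) (𝓡 n) (fun y => e (e'.symm y)) y' :=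
    (differentiableAt_transition he he' hy').mdifferentiableAt
  have hd2 : MDifferentiableAt (𝓡 n) (𝓡 n) e.symm (e (e'.symm y')) :=
    (mdifferentiable_chart he).mdifferentiableAt_symm (e.map_source hy'.2)
  have h1 : mfderiv (𝓡 n) (𝓡 n) e'.symm y' = (mfderiv (𝓡 n) (𝓡 n) e.symm (e (e'.symm y'))).comp
      (mfderiv (𝓡 n) (𝓡 n) (fun y => e (e'.symm y)) y') := by
    rw [hev.mfderiv_eq]
    exact mfderiv_comp (I' := 𝓡 n) y' hd2 hd
  have h2 : (coordVec e' y' j : EuclideanSpace ℝ (Fin n)) =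
      mfderiv (𝓡 n) (𝓡 n) e.symm (e (e'.symm y'))
        (fderiv ℝ (fun y => e (e'.symm y)) y' (EuclideanSpace.single j (1 : ℝ))) := by
    rw [coordVec, h1, mfderiv_eq_fderiv]
    rfl
  rw [h2, fderiv_transition_single]
  erw [map_sum]
  refine Finset.sum_congr rfl fun i _ => ?_
  erw [map_smul]
  rfl

theorem bilin_sum_smul_eq {W ι : Type*} [NormedAddCommGroup W] [NormedSpace ℝ W] [Fintype ι]
    (B : W →L[ℝ] W →L[ℝ] ℝ) (c : ι → W) (J G : Matrix ι ι ℝ)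
    (hG : ∀ i j, G i j = B (c i) (c j)) (i j : ι) :
    B (∑ k, J k i • c k) (∑ l, J l j • c l) = (Jᵀ * G * J) i j := by
  rw [Matrix.mul_assoc, Matrix.mul_apply, map_sum B, sum_apply]
  refine Finset.sum_congr rfl fun k _ => ?_
  rw [Matrix.mul_apply, Finset.mul_sum, map_sum]
  refine Finset.sum_congr rfl fun l _ => ?_
  rw [map_smul, map_smul, smul_apply, hG, Matrix.transpose_apply]
  simp only [smul_eq_mul]
  ring

variable (D : StaticData n X)

theorem gram_eq_jacobian (he : e ∈ atlas (EuclideanSpace ℝ (Fin n)) X)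
    (he' : e' ∈ atlas (EuclideanSpace ℝ (Fin n)) X) {y' : EuclideanSpace ℝ (Fin n)}
    (hy' : y' ∈ (e'.symm.trans e).source) :
    D.gram e' y' =
      (jacobian e e' y')ᵀ * D.gram e (e (e'.symm y')) * jacobian e e' y' := by
  -- The base points `e.symm (e (e'.symm y'))` and `e'.symm y'` are equal but not definitionally, so
  -- the point is generalized before substitution in the dependent types.
  have key : ∀ (x : X), x = e'.symm y' → ∀ i j, D.gram e (e (e'.symm y')) i j =
      D.g.inner x (coordVec e (e (e'.symm y')) i : EuclideanSpace ℝ (Fin n))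
        (coordVec e (e (e'.symm y')) j : EuclideanSpace ℝ (Fin n)) := by
    intro x hx i j
    have : x = e.symm (e (e'.symm y')) := by rw [symm_transition hy', hx]
    clear hx
    generalize e (e'.symm y') = z at this
    subst this
    rfl
  ext i j
  have h0 : D.gram e' y' i j = D.g.inner (e'.symm y')
      (coordVec e' y' i : EuclideanSpace ℝ (Fin n))
      (coordVec e' y' j : EuclideanSpace ℝ (Fin n)) := rfl
  rw [h0, coordVec_eq_sum_jacobian he he' hy', coordVec_eq_sum_jacobian he he' hy']
  exact bilin_sum_smul_eq (W := EuclideanSpace ℝ (Fin n)) (D.g.inner (e'.symm y'))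
    (fun i => coordVec e (e (e'.symm y')) i) (jacobian e e' y') (D.gram e (e (e'.symm y')))
    (key _ rfl) i j

theorem potential_eq_sum_jacobian (he : e ∈ atlas (EuclideanSpace ℝ (Fin n)) X)
    (he' : e' ∈ atlas (EuclideanSpace ℝ (Fin n)) X) {y' : EuclideanSpace ℝ (Fin n)}
    (hy' : y' ∈ (e'.symm.trans e).source) (j : Fin n) :
    (D.A (e'.symm y') (coordVec e' y' j) : ℝ) = ∑ i, jacobian e e' y' i j *
      (D.A (e.symm (e (e'.symm y'))) (coordVec e (e (e'.symm y')) i) : ℝ) := by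
  have key : ∀ (x : X), x = e'.symm y' → ∀ i,
      (D.A (e.symm (e (e'.symm y'))) (coordVec e (e (e'.symm y')) i) : ℝ) =
      D.A x (coordVec e (e (e'.symm y')) i : EuclideanSpace ℝ (Fin n)) := by
    intro x hx i
    have : x = e.symm (e (e'.symm y')) := by rw [symm_transition hy', hx]
    clear hx
    generalize e (e'.symm y') = z at this
    subst this
    rfl
  have h0 : (D.A (e'.symm y') (coordVec e' y' j) : ℝ) = D.A (e'.symm y')
      (coordVec e' y' j : EuclideanSpace ℝ (Fin n)) := rfl
  rw [h0, coordVec_eq_sum_jacobian he he' hy']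
  erw [map_sum]
  refine Finset.sum_congr rfl fun k _ => ?_
  erw [map_smul]
  rw [key _ rfl]
  rfl

theorem det_gram_eq_jacobian (he : e ∈ atlas (EuclideanSpace ℝ (Fin n)) X)
    (he' : e' ∈ atlas (EuclideanSpace ℝ (Fin n)) X) {y' : EuclideanSpace ℝ (Fin n)}
    (hy' : y' ∈ (e'.symm.trans e).source) :
    (D.gram e' y').det = (jacobian e e' y').det ^ 2 * (D.gram e (e (e'.symm y'))).det := by
  rw [D.gram_eq_jacobian he he' hy', Matrix.det_mul, Matrix.det_mul, Matrix.det_transpose]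
  ring

/-- Inversion of the covariant rule. The Jacobian is invertible because its squared determinant is a
factor of a positive Gram determinant. -/
theorem jacobian_mul_inv_gram_mul (he : e ∈ atlas (EuclideanSpace ℝ (Fin n)) X)
    (he' : e' ∈ atlas (EuclideanSpace ℝ (Fin n)) X) {y' : EuclideanSpace ℝ (Fin n)}
    (hy' : y' ∈ (e'.symm.trans e).source) :
    jacobian e e' y' * (D.gram e' y')⁻¹ * (jacobian e e' y')ᵀ =
      (D.gram e (e (e'.symm y')))⁻¹ := by
  have hdet : IsUnit (jacobian e e' y').det := by
    have h := D.det_gram_pos he' hy'.1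
    rw [D.det_gram_eq_jacobian he he' hy'] at h
    refine isUnit_iff_ne_zero.2 fun h0 => ?_
    simp [h0] at h
  have hdet' : IsUnit (jacobian e e' y')ᵀ.det := by rwa [Matrix.det_transpose]
  rw [D.gram_eq_jacobian he he' hy', Matrix.mul_inv_rev, Matrix.mul_inv_rev,
    Matrix.mul_nonsing_inv_cancel_left _ _ hdet, Matrix.mul_assoc,
    Matrix.nonsing_inv_mul _ hdet', Matrix.mul_one]

theorem magDeriv_eq_sum_jacobian (he : e ∈ atlas (EuclideanSpace ℝ (Fin n)) X)
    (he' : e' ∈ atlas (EuclideanSpace ℝ (Fin n)) X) {y' : EuclideanSpace ℝ (Fin n)}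
    (hy' : y' ∈ (e'.symm.trans e).source) {F : X → ℂ}
    (hF : DifferentiableAt ℝ (fun y => F (e.symm y)) (e (e'.symm y'))) (j : Fin n) :
    D.magDeriv e' j (fun y => F (e'.symm y)) y' = ∑ i, (jacobian e e' y' i j : ℂ) *
      D.magDeriv e i (fun y => F (e.symm y)) (e (e'.symm y')) := by
  have hev : (fun y => F (e'.symm y)) =ᶠ[nhds y']
      (fun y => F (e.symm y)) ∘ (fun y => e (e'.symm y)) := by
    filter_upwards [(e'.symm.trans e).open_source.mem_nhds hy'] with y hy
    simp only [Function.comp_apply]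
    rw [symm_transition hy]
  have h1 : fderiv ℝ (fun y => F (e'.symm y)) y' (EuclideanSpace.single j (1 : ℝ)) =
      ∑ i, (jacobian e e' y' i j : ℂ) *
        fderiv ℝ (fun y => F (e.symm y)) (e (e'.symm y')) (EuclideanSpace.single i (1 : ℝ)) := by
    rw [hev.fderiv_eq, fderiv_comp y' hF (differentiableAt_transition he he' hy'),
      ContinuousLinearMap.comp_apply, fderiv_transition_single, map_sum]
    refine Finset.sum_congr rfl fun i _ => ?_
    rw [map_smul, Complex.real_smul]
  have h2 : F (e.symm (e (e'.symm y'))) = F (e'.symm y') := by rw [symm_transition hy']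
  rw [magDeriv, h1, D.potential_eq_sum_jacobian he he' hy']
  simp only [magDeriv, h2]
  push_cast
  rw [Finset.mul_sum, Finset.sum_mul, ← Finset.sum_sub_distrib]
  refine Finset.sum_congr rfl fun i _ => ?_
  ring

end StaticData

end StaticKG

namespace StaticKG

/-! ### The volume measure and its expression in charts. -/

namespace StaticData

variable {n : ℕ} {X : Type*} [TopologicalSpace X]
  [ChartedSpace (EuclideanSpace ℝ (Fin n)) X] [IsManifold (𝓡 n) ∞ X]
  {e e' : OpenPartialHomeomorph X (EuclideanSpace ℝ (Fin n))} (D : StaticData n X)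

theorem contDiffOn_det_gram (he : e ∈ atlas (EuclideanSpace ℝ (Fin n)) X) :
    ContDiffOn ℝ 1 (fun y => (D.gram e y).det) e.target := by
  simp only [Matrix.det_apply']
  exact ContDiffOn.sum fun σ _ =>
    contDiffOn_const.mul (contDiffOn_prod fun i _ => D.contDiffOn_gram he _ _)

theorem contDiffOn_β (he : e ∈ atlas (EuclideanSpace ℝ (Fin n)) X) :
    ContDiffOn ℝ 1 (fun y => D.β (e.symm y)) e.target :=
  contDiffOn_comp_chart_symm he (k := 1) (D.β_contMDiff.of_le (by norm_num))

theorem contDiffOn_sqrtDet (he : e ∈ atlas (EuclideanSpace ℝ (Fin n)) X) :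
    ContDiffOn ℝ 1 (D.sqrtDet e) e.target :=
  ((D.contDiffOn_β he).mul (D.contDiffOn_det_gram he)).sqrt fun _ hy =>
    (mul_pos (D.β_pos _) (D.det_gram_pos he hy)).ne'

theorem sqrtDet_pos (he : e ∈ atlas (EuclideanSpace ℝ (Fin n)) X)
    {y : EuclideanSpace ℝ (Fin n)} (hy : y ∈ e.target) : 0 < D.sqrtDet e y :=
  Real.sqrt_pos.2 (mul_pos (D.β_pos _) (D.det_gram_pos he hy))

theorem sqrtDet_eq_mul (y : EuclideanSpace ℝ (Fin n)) :
    D.sqrtDet e y = √(D.β (e.symm y)) * √(D.gram e y).det :=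
  Real.sqrt_mul (D.β_pos _).le _

variable [MeasurableSpace X] [BorelSpace X]

omit [ChartedSpace (EuclideanSpace ℝ (Fin n)) X] [IsManifold (𝓡 n) ∞ X] in
theorem aemeasurable_chart_symm : AEMeasurable e.symm (volume.restrict e.target) :=
  e.continuousOn_symm.aemeasurable e.open_target.measurableSet

omit [MeasurableSpace X] [BorelSpace X] in
theorem aemeasurable_sqrt_det_gram (he : e ∈ atlas (EuclideanSpace ℝ (Fin n)) X) :
    AEMeasurable (fun y => ENNReal.ofReal √(D.gram e y).det) (volume.restrict e.target) :=
  ((D.contDiffOn_det_gram he).continuousOn.sqrt.aemeasurable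
    e.open_target.measurableSet).ennreal_ofReal

omit [MeasurableSpace X] [BorelSpace X] in
theorem aemeasurable_sqrtDet (he : e ∈ atlas (EuclideanSpace ℝ (Fin n)) X) :
    AEMeasurable (fun y => ENNReal.ofReal (D.sqrtDet e y)) (volume.restrict e.target) :=
  ((D.contDiffOn_sqrtDet he).continuousOn.aemeasurable
    e.open_target.measurableSet).ennreal_ofReal

omit [BorelSpace X] in
theorem chartVolume_eq : D.chartVolume e = Measure.map e.symm
    ((volume.restrict e.target).withDensity fun y => ENNReal.ofReal √(D.gram e y).det) := by
  rw [chartVolume, restrict_withDensity e.open_target.measurableSet]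

theorem lintegral_chartVolume (he : e ∈ atlas (EuclideanSpace ℝ (Fin n)) X) {h : X → ℝ≥0∞}
    (hh : Measurable h) : ∫⁻ x, h x ∂D.chartVolume e =
      ∫⁻ y in e.target, ENNReal.ofReal √(D.gram e y).det * h (e.symm y) := by
  have hs := aemeasurable_chart_symm (e := e)
  rw [chartVolume_eq, lintegral_map' hh.aemeasurable
    (hs.mono' (withDensity_absolutelyContinuous _ _)),
    lintegral_withDensity_eq_lintegral_mul₀ (D.aemeasurable_sqrt_det_gram he)
      (g := fun y => h (e.symm y)) (hh.comp_aemeasurable hs)]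
  rfl

-- Change of variables: the square root of the Gram determinant picks up the absolute value of the
-- Jacobian determinant. Vanishing of `h` off the overlap reduces both integrals to it.
omit [MeasurableSpace X] [BorelSpace X] in
theorem setLIntegral_target_eq (he : e ∈ atlas (EuclideanSpace ℝ (Fin n)) X)
    (he' : e' ∈ atlas (EuclideanSpace ℝ (Fin n)) X) (h : X → ℝ≥0∞)
    (hs : ∀ x, x ∉ e.source ∩ e'.source → h x = 0) :
    ∫⁻ y in e'.target, ENNReal.ofReal √(D.gram e' y).det * h (e'.symm y) =
      ∫⁻ y in e.target, ENNReal.ofReal √(D.gram e y).det * h (e.symm y) := by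
  set U := (e'.symm.trans e).source with hU
  have hUm : MeasurableSet U := (e'.symm.trans e).open_source.measurableSet
  have himage : (fun y => e (e'.symm y)) '' U = (e.symm.trans e').source := by
    have h1 := (e'.symm.trans e).image_source_eq_target
    rw [← OpenPartialHomeomorph.symm_source, OpenPartialHomeomorph.trans_symm_eq_symm_trans_symm,
      OpenPartialHomeomorph.symm_symm] at h1
    exact h1
  have hsub : ∀ {a b : OpenPartialHomeomorph X (EuclideanSpace ℝ (Fin n))},
      (∀ x, x ∉ b.source ∩ a.source → h x = 0) →
      ∫⁻ y in a.target, ENNReal.ofReal √(D.gram a y).det * h (a.symm y) =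
      ∫⁻ y in (a.symm.trans b).source, ENNReal.ofReal √(D.gram a y).det * h (a.symm y) := by
    intro a b hab
    rw [← lintegral_indicator a.open_target.measurableSet,
      ← lintegral_indicator (a.symm.trans b).open_source.measurableSet]
    refine lintegral_congr fun y => ?_
    by_cases hy : y ∈ a.target
    · by_cases hy' : a.symm y ∈ b.source
      · rw [Set.indicator_of_mem hy, Set.indicator_of_mem (show y ∈ (a.symm.trans b).source from
          ⟨hy, hy'⟩)]
      · rw [Set.indicator_of_mem hy, Set.indicator_of_notMem (fun h => hy' h.2),
          hab _ (fun h => hy' h.1), mul_zero]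
    · rw [Set.indicator_of_notMem hy, Set.indicator_of_notMem (fun h => hy h.1)]
  rw [hsub (b := e) hs, hsub (a := e) (b := e') (fun x hx => hs x (by rwa [Set.inter_comm])),
    ← himage]
  rw [lintegral_image_eq_lintegral_abs_det_fderiv_mul volume hUm
    (fun y hy => ((differentiableAt_transition he he' hy).hasFDerivAt).hasFDerivWithinAt)
    (e'.symm.trans e).injOn]
  refine setLIntegral_congr_fun hUm fun y hy => ?_
  rw [symm_transition hy, D.det_gram_eq_jacobian he he' hy, Real.sqrt_mul (sq_nonneg _),
    Real.sqrt_sq_eq_abs, ENNReal.ofReal_mul (abs_nonneg _), det_fderiv_transition, mul_assoc]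

theorem restrict_chartVolume_comm (he : e ∈ atlas (EuclideanSpace ℝ (Fin n)) X)
    (he' : e' ∈ atlas (EuclideanSpace ℝ (Fin n)) X) :
    (D.chartVolume e').restrict e.source = (D.chartVolume e).restrict e'.source := by
  have key : ∀ {a b : OpenPartialHomeomorph X (EuclideanSpace ℝ (Fin n))},
      a ∈ atlas (EuclideanSpace ℝ (Fin n)) X → ∀ s : Set X, MeasurableSet s →
      (D.chartVolume a).restrict b.source s = ∫⁻ y in a.target,
        ENNReal.ofReal √(D.gram a y).det *
          (s ∩ (b.source ∩ a.source)).indicator (fun _ => 1) (a.symm y) := by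
    intro a b ha s hs
    rw [Measure.restrict_apply hs, ← lintegral_indicator_one
      (hs.inter b.open_source.measurableSet), D.lintegral_chartVolume ha
      (measurable_one.indicator (hs.inter b.open_source.measurableSet))]
    refine setLIntegral_congr_fun a.open_target.measurableSet fun y hy => ?_
    have : a.symm y ∈ a.source := a.map_target hy
    have hiff : a.symm y ∈ s ∩ (b.source ∩ a.source) ↔ a.symm y ∈ s ∩ b.source :=
      ⟨fun h => ⟨h.1, h.2.1⟩, fun h => ⟨h.1, h.2, this⟩⟩
    by_cases h : a.symm y ∈ s ∩ b.source
    · rw [Set.indicator_of_mem h, Set.indicator_of_mem (hiff.2 h), Pi.one_apply]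
    · rw [Set.indicator_of_notMem h, Set.indicator_of_notMem (fun h' => h (hiff.1 h'))]
  refine Measure.ext fun s hs => ?_
  rw [key he' s hs, key he s hs, D.setLIntegral_target_eq he he']
  · rw [Set.inter_comm e.source]
  · intro x hx
    exact Set.indicator_of_notMem (fun h => hx h.2) _

theorem restrict_chartVolume_self :
    (D.chartVolume e).restrict e.source = D.chartVolume e := by
  refine Measure.restrict_eq_self_of_ae_mem ?_
  have hm : MeasurableSet {x | x ∈ e.source} := e.open_source.measurableSet
  rw [chartVolume_eq, ae_map_iff (aemeasurable_chart_symm.mono'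
    (withDensity_absolutelyContinuous _ _)) hm]
  refine (withDensity_absolutelyContinuous _ _).ae_le ?_
  filter_upwards [ae_restrict_mem e.open_target.measurableSet] with y hy using e.map_target hy

theorem restrict_riemannianVolume (x : X) :
    D.riemannianVolume.restrict (chartAt (EuclideanSpace ℝ (Fin n)) x).source =
      D.chartVolume (chartAt (EuclideanSpace ℝ (Fin n)) x) := by
  have hm := (chartAt (EuclideanSpace ℝ (Fin n)) x).open_source.measurableSet
  refine le_antisymm ?_ ?_
  -- It suffices to bound each chart measure. Inside the domain of the chart at `x` it agrees with a
  -- restriction of the chart measure at `x`; outside, it is part of the second summand, which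
  -- disappears on restriction.
  · have h : D.riemannianVolume ≤ D.chartVolume (chartAt (EuclideanSpace ℝ (Fin n)) x) +
        D.riemannianVolume.restrict (chartAt (EuclideanSpace ℝ (Fin n)) x).sourceᶜ := by
      refine iSup_le fun z => ?_
      rw [← Measure.restrict_add_restrict_compl (μ := D.chartVolume (chartAt _ z)) hm]
      refine add_le_add ?_ (Measure.restrict_mono le_rfl
        (le_iSup (fun z => D.chartVolume (chartAt (EuclideanSpace ℝ (Fin n)) z)) z))
      rw [D.restrict_chartVolume_comm (chart_mem_atlas _ x) (chart_mem_atlas _ z)]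
      exact Measure.restrict_le_self
    refine (Measure.restrict_mono le_rfl h).trans ?_
    rw [Measure.restrict_add, Measure.restrict_restrict hm, Set.inter_compl_self,
      Measure.restrict_empty, add_zero]
    exact Measure.restrict_le_self
  · rw [← D.restrict_chartVolume_self]
    exact Measure.restrict_mono le_rfl
      (le_iSup (fun z => D.chartVolume (chartAt (EuclideanSpace ℝ (Fin n)) z)) x)

theorem restrict_μ (x : X) :
    D.μ.restrict (chartAt (EuclideanSpace ℝ (Fin n)) x).source =
      Measure.map (chartAt (EuclideanSpace ℝ (Fin n)) x).symm
        ((volume.restrict (chartAt (EuclideanSpace ℝ (Fin n)) x).target).withDensity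
          fun y => ENNReal.ofReal (D.sqrtDet (chartAt (EuclideanSpace ℝ (Fin n)) x) y)) := by
  have he := chart_mem_atlas (EuclideanSpace ℝ (Fin n)) x
  have hβ : Measurable fun x => ENNReal.ofReal √(D.β x) :=
    (D.β_contMDiff.continuous.sqrt.measurable).ennreal_ofReal
  have hs := aemeasurable_chart_symm (e := chartAt (EuclideanSpace ℝ (Fin n)) x)
  rw [μ, restrict_withDensity (chartAt (EuclideanSpace ℝ (Fin n)) x).open_source.measurableSet,
    D.restrict_riemannianVolume]
  refine Measure.ext_of_lintegral _ fun f hf => ?_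
  rw [lintegral_withDensity_eq_lintegral_mul _ hβ hf, D.lintegral_chartVolume he (hβ.mul hf),
    lintegral_map' hf.aemeasurable (hs.mono' (withDensity_absolutelyContinuous _ _)),
    lintegral_withDensity_eq_lintegral_mul₀ (D.aemeasurable_sqrtDet he)
      (g := fun y => f ((chartAt (EuclideanSpace ℝ (Fin n)) x).symm y))
      (hf.comp_aemeasurable hs)]
  refine lintegral_congr fun y => ?_
  simp only [Pi.mul_apply]
  rw [sqrtDet_eq_mul, ENNReal.ofReal_mul (Real.sqrt_nonneg _), ← mul_assoc,
    mul_comm (ENNReal.ofReal √(D.β _))]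

theorem setIntegral_chart_source (x : X) {F : Type*} [NormedAddCommGroup F] [NormedSpace ℝ F]
    {f : X → F} (hf : AEStronglyMeasurable f D.μ) :
    ∫ p in (chartAt (EuclideanSpace ℝ (Fin n)) x).source, f p ∂D.μ =
      ∫ y in (chartAt (EuclideanSpace ℝ (Fin n)) x).target,
        D.sqrtDet (chartAt (EuclideanSpace ℝ (Fin n)) x) y •
          f ((chartAt (EuclideanSpace ℝ (Fin n)) x).symm y) := by
  have he := chart_mem_atlas (EuclideanSpace ℝ (Fin n)) x
  have hf' := hf.restrict (s := (chartAt (EuclideanSpace ℝ (Fin n)) x).source)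
  have hs := aemeasurable_chart_symm (e := chartAt (EuclideanSpace ℝ (Fin n)) x)
  rw [D.restrict_μ] at hf' ⊢
  rw [integral_map (hs.mono' (withDensity_absolutelyContinuous _ _)) hf',
    integral_withDensity_eq_integral_toReal_smul₀ (D.aemeasurable_sqrtDet he) (by simp)]
  refine integral_congr_ae (Filter.Eventually.of_forall fun y => ?_)
  dsimp only
  congr 1
  exact ENNReal.toReal_ofReal (Real.sqrt_nonneg _)

/-- This allows the passage from equality almost everywhere to equality of continuous functions. -/
theorem isOpenPosMeasure_μ : D.μ.IsOpenPosMeasure where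
  open_pos U hU hne := by
    obtain ⟨x, hx⟩ := hne
    set e := chartAt (EuclideanSpace ℝ (Fin n)) x with hedef
    have he : e ∈ atlas (EuclideanSpace ℝ (Fin n)) X := chart_mem_atlas _ x
    intro h0
    have h1 : D.μ.restrict e.source U = 0 :=
      le_antisymm ((Measure.le_iff'.1 Measure.restrict_le_self U).trans h0.le) bot_le
    rw [D.restrict_μ] at h1
    have h2 := le_antisymm ((Measure.le_map_apply (aemeasurable_chart_symm.mono'
      (withDensity_absolutelyContinuous _ _)) U).trans h1.le) bot_le
    rw [withDensity_apply_eq_zero' (D.aemeasurable_sqrtDet he)] at h2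
    have hopen : IsOpen (e.target ∩ e.symm ⁻¹' U) := e.symm.isOpen_inter_preimage hU
    have h3 : volume (e.target ∩ e.symm ⁻¹' U) = 0 := by
      rw [Measure.restrict_apply₀' e.open_target.measurableSet.nullMeasurableSet] at h2
      refine measure_mono_null ?_ h2
      intro y hy
      refine ⟨⟨?_, hy.2⟩, hy.1⟩
      simpa using D.sqrtDet_pos he hy.1
    exact (hopen.measure_pos volume ⟨e x, e.map_source (mem_chart_source _ x), by
      simpa [e.left_inv (mem_chart_source _ x)] using hx⟩).ne' h3

theorem isLocallyFiniteMeasure_μ : IsLocallyFiniteMeasure D.μ where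
  finiteAtNhds x := by
    set e := chartAt (EuclideanSpace ℝ (Fin n)) x with hedef
    have he : e ∈ atlas (EuclideanSpace ℝ (Fin n)) X := chart_mem_atlas _ x
    obtain ⟨K, hK, hxK, hKt⟩ := exists_compact_subset e.open_target
      (e.map_source (mem_chart_source _ x))
    refine ⟨e.source ∩ e ⁻¹' interior K, (e.isOpen_inter_preimage isOpen_interior).mem_nhds
      ⟨mem_chart_source _ x, hxK⟩, ?_⟩
    have hm : MeasurableSet (e.source ∩ e ⁻¹' interior K) :=
      (e.isOpen_inter_preimage isOpen_interior).measurableSet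
    have h1 : D.μ (e.source ∩ e ⁻¹' interior K) =
        D.μ.restrict e.source (e.source ∩ e ⁻¹' interior K) := by
      rw [Measure.restrict_apply hm, Set.inter_right_comm, Set.inter_self]
    rw [h1, D.restrict_μ, Measure.map_apply_of_aemeasurable (aemeasurable_chart_symm.mono'
      (withDensity_absolutelyContinuous _ _)) hm, ← restrict_withDensity e.open_target.measurableSet,
      Measure.restrict_apply₀' e.open_target.measurableSet.nullMeasurableSet]
    refine (measure_mono (t := K) ?_).trans_lt ?_
    · rintro y ⟨⟨-, hy⟩, hyt⟩
      have : e (e.symm y) ∈ interior K := hy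
      rw [e.right_inv hyt] at this
      exact interior_subset this
    · rw [withDensity_apply _ hK.measurableSet]
      exact (((D.contDiffOn_sqrtDet he).continuousOn.mono hKt).integrableOn_compact
        hK).lintegral_lt_top

end StaticData

end StaticKG

namespace StaticKG

/-! ### Integration by parts in a single chart. -/

section Euclidean

variable {W F : Type*} [NormedAddCommGroup W] [NormedSpace ℝ W] [NormedAddCommGroup F]

omit [NormedSpace ℝ W] in
theorem integrableOn_of_continuousOn_of_eq_zero [MeasurableSpace W] [BorelSpace W]
    {ν : Measure W} [IsFiniteMeasureOnCompacts ν] {U K : Set W} (hU : IsOpen U)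
    (hK : IsCompact K) (hKU : K ⊆ U) {G : W → F} (hG : ContinuousOn G U)
    (h0 : ∀ y ∈ U, y ∉ K → G y = 0) : IntegrableOn G U ν := by
  have h1 : IntegrableOn G K ν := (hG.mono hKU).integrableOn_compact hK
  exact h1.of_forall_sdiff_eq_zero hU.measurableSet fun y hy => h0 y hy.1 hy.2

variable [NormedSpace ℝ F] [FiniteDimensional ℝ W] [MeasurableSpace W] [BorelSpace W]

/-- Extended by zero, `G` is C¹ with compact support on the whole space, where the integral of a
derivative vanishes. -/
theorem setIntegral_fderiv_eq_zero (ν : Measure W) [ν.IsAddHaarMeasure] {U K : Set W}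
    (hU : IsOpen U) (hK : IsCompact K) (hKU : K ⊆ U) {G : W → F} (hG : ContDiffOn ℝ 1 G U)
    (h0 : ∀ y ∈ U, y ∉ K → G y = 0) (v : W) : ∫ y in U, fderiv ℝ G y v ∂ν = 0 := by
  classical
  set H : W → F := U.indicator G with hH
  have hHU : ∀ y ∈ U, H =ᶠ[nhds y] G := fun y hy => by
    filter_upwards [hU.mem_nhds hy] with z hz using Set.indicator_of_mem hz G
  have hHK : ∀ y ∉ K, H y = 0 := fun y hy => by
    by_cases hyU : y ∈ U
    · rw [hH, Set.indicator_of_mem hyU, h0 y hyU hy]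
    · exact Set.indicator_of_notMem hyU G
  have hHK' : ∀ y ∉ K, H =ᶠ[nhds y] fun _ => 0 := fun y hy => by
    filter_upwards [hK.isClosed.isOpen_compl.mem_nhds hy] with z hz using hHK z hz
  have hsmooth : ContDiff ℝ 1 H := by
    rw [contDiff_iff_contDiffAt]
    intro y
    by_cases hy : y ∈ U
    · exact (hG.contDiffAt (hU.mem_nhds hy)).congr_of_eventuallyEq (hHU y hy)
    · exact contDiffAt_const.congr_of_eventuallyEq (hHK' y fun h => hy (hKU h))
  have hsupp : HasCompactSupport H := HasCompactSupport.intro hK fun y hy => hHK y hy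
  have hd : Continuous fun y => fderiv ℝ H y v :=
    (hsmooth.continuous_fderiv one_ne_zero).clm_apply continuous_const
  have hdsupp : HasCompactSupport fun y => fderiv ℝ H y v :=
    hsupp.fderiv_apply ℝ v
  have h1 : ∫ y, fderiv ℝ H y v ∂ν = 0 := by
    have h := integral_smul_fderiv_eq_neg_fderiv_smul_of_integrable (μ := ν) (𝕜 := ℝ)
      (f := fun _ => (1 : ℝ)) (g := H) (v := v) (by simp)
      (by simpa using hd.integrable_of_hasCompactSupport hdsupp)
      (by simpa using hsmooth.continuous.integrable_of_hasCompactSupport hsupp)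
      (fun _ _ => differentiableAt_const _)
      (fun y _ => (hsmooth.differentiable one_ne_zero) y)
    simpa using h
  rw [← h1, ← setIntegral_eq_integral_of_forall_compl_eq_zero (s := U)
    (f := fun y => fderiv ℝ H y v)]
  · refine setIntegral_congr_fun hU.measurableSet fun y hy => ?_
    rw [(hHU y hy).fderiv_eq]
  · intro y hy
    rw [(hHK' y fun h => hy (hKU h)).fderiv_eq]
    simp

end Euclidean

namespace StaticData

variable {n : ℕ} {X : Type*} [TopologicalSpace X]
  [ChartedSpace (EuclideanSpace ℝ (Fin n)) X] [IsManifold (𝓡 n) ∞ X]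
  {e e' : OpenPartialHomeomorph X (EuclideanSpace ℝ (Fin n))} (D : StaticData n X)

/-- The function `β^{1/2} φ`. -/
noncomputable def weighted (φ : X → ℂ) (x : X) : ℂ := ((√(D.β x) : ℝ) : ℂ) * φ x

theorem contMDiff_weighted {k : ℕ∞} (hk : (k : ℕ∞ω) ≤ 2) {φ : X → ℂ}
    (hφ : ContMDiff (𝓡 n) 𝓘(ℝ, ℂ) k φ) : ContMDiff (𝓡 n) 𝓘(ℝ, ℂ) k (D.weighted φ) := by
  have h : ContMDiff (𝓡 n) 𝓘(ℝ, ℝ) k (fun x => √(D.β x)) := fun x =>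
    (Real.contDiffAt_sqrt (D.β_pos x).ne').contMDiffAt.comp x
      ((D.β_contMDiff.of_le hk).contMDiffAt)
  have h2 := h.smul hφ
  refine h2.congr fun x => ?_
  simp [weighted, Complex.real_smul]

theorem flux_eq (φ : X → ℂ) (i : Fin n) (y : EuclideanSpace ℝ (Fin n)) :
    D.flux e φ i y = (D.sqrtDet e y : ℂ) * ∑ j : Fin n, (((D.gram e y)⁻¹ i j : ℝ) : ℂ) *
      D.magDeriv e j (fun y' => D.weighted φ (e.symm y')) y := rfl

/-- The part of `L φ` without the scalar potential, in the chart `e`. -/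
noncomputable def principalPart (e : OpenPartialHomeomorph X (EuclideanSpace ℝ (Fin n)))
    (φ : X → ℂ) (y : EuclideanSpace ℝ (Fin n)) : ℂ :=
  ((√(D.β (e.symm y)) : ℝ) : ℂ) * ((D.sqrtDet e y : ℂ)⁻¹ *
    ∑ i : Fin n, D.magDeriv e i (D.flux e φ i) y)

/-- The density of the quadratic form of the principal part of `L`, in the chart `e`. -/
noncomputable def chartForm (e : OpenPartialHomeomorph X (EuclideanSpace ℝ (Fin n))) (f ψ : X → ℂ)
    (y : EuclideanSpace ℝ (Fin n)) : ℂ :=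
  ∑ i : Fin n, ∑ j : Fin n, (((D.gram e y)⁻¹ i j : ℝ) : ℂ) *
    ((starRingEnd ℂ) (D.magDeriv e i (fun y' => D.weighted f (e.symm y')) y) *
      D.magDeriv e j (fun y' => D.weighted ψ (e.symm y')) y)

theorem contDiffOn_ofReal {W : Type*} [NormedAddCommGroup W] [NormedSpace ℝ W] {s : Set W}
    {k : ℕ∞ω} {f : W → ℝ} (hf : ContDiffOn ℝ k f s) : ContDiffOn ℝ k (fun y => (f y : ℂ)) s :=
  Complex.ofRealCLM.contDiff.comp_contDiffOn hf

theorem contDiffOn_inv_gram (he : e ∈ atlas (EuclideanSpace ℝ (Fin n)) X) (i j : Fin n) :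
    ContDiffOn ℝ 1 (fun y => (D.gram e y)⁻¹ i j) e.target := by
  have hadj : ContDiffOn ℝ 1 (fun y => (D.gram e y).adjugate i j) e.target := by
    simp only [Matrix.adjugate_apply, Matrix.det_apply']
    refine ContDiffOn.sum fun σ _ => contDiffOn_const.mul (contDiffOn_prod fun k _ => ?_)
    by_cases hk : σ k = j
    · simp only [hk, Matrix.updateRow_self]
      exact contDiffOn_const
    · simp only [Matrix.updateRow_ne hk]
      exact D.contDiffOn_gram he _ _
  have hdet := (D.contDiffOn_det_gram he).inv fun y hy => (D.det_gram_pos he hy).ne'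
  refine (hdet.mul hadj).congr fun y hy => ?_
  rw [Matrix.inv_def, Matrix.smul_apply, smul_eq_mul, Ring.inverse_eq_inv']
  rfl

theorem continuousOn_magDeriv (he : e ∈ atlas (EuclideanSpace ℝ (Fin n)) X) (j : Fin n)
    {w : EuclideanSpace ℝ (Fin n) → ℂ} (hw : ContDiffOn ℝ 1 w e.target) :
    ContinuousOn (D.magDeriv e j w) e.target := by
  have h1 := (hw.continuousOn_fderiv_of_isOpen e.open_target le_rfl).clm_apply
    (continuousOn_const (c := (EuclideanSpace.single j (1 : ℝ) : EuclideanSpace ℝ (Fin n))))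
  have h2 := (contDiffOn_ofReal (D.contDiffOn_potential he j)).continuousOn
  exact (continuousOn_const.mul h1).sub (h2.mul hw.continuousOn)

theorem contDiffOn_magDeriv (he : e ∈ atlas (EuclideanSpace ℝ (Fin n)) X) (j : Fin n)
    {w : EuclideanSpace ℝ (Fin n) → ℂ} (hw : ContDiffOn ℝ 2 w e.target) :
    ContDiffOn ℝ 1 (D.magDeriv e j w) e.target := by
  have h1 := (hw.fderiv_of_isOpen (m := 1) e.open_target (by norm_num)).clm_apply
    (contDiffOn_const (c := (EuclideanSpace.single j (1 : ℝ) : EuclideanSpace ℝ (Fin n))))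
  have h2 := contDiffOn_ofReal (D.contDiffOn_potential he j)
  exact (contDiffOn_const.mul h1).sub (h2.mul (hw.of_le (by norm_num)))

theorem contDiffOn_weighted (he : e ∈ atlas (EuclideanSpace ℝ (Fin n)) X) {k : ℕ∞}
    (hk : (k : ℕ∞ω) ≤ 2) {φ : X → ℂ} (hφ : ContMDiff (𝓡 n) 𝓘(ℝ, ℂ) k φ) :
    ContDiffOn ℝ k (fun y => D.weighted φ (e.symm y)) e.target :=
  contDiffOn_comp_chart_symm he (D.contMDiff_weighted hk hφ)

theorem contDiffOn_flux (he : e ∈ atlas (EuclideanSpace ℝ (Fin n)) X) {φ : X → ℂ}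
    (hφ : ContMDiff (𝓡 n) 𝓘(ℝ, ℂ) 2 φ) (i : Fin n) :
    ContDiffOn ℝ 1 (D.flux e φ i) e.target :=
  (contDiffOn_ofReal (D.contDiffOn_sqrtDet he)).mul (ContDiffOn.sum fun j _ =>
    (contDiffOn_ofReal (D.contDiffOn_inv_gram he i j)).mul
      (D.contDiffOn_magDeriv he j (D.contDiffOn_weighted he (k := 2) le_rfl hφ)))

theorem continuousOn_principalPart (he : e ∈ atlas (EuclideanSpace ℝ (Fin n)) X) {φ : X → ℂ}
    (hφ : ContMDiff (𝓡 n) 𝓘(ℝ, ℂ) 2 φ) : ContinuousOn (D.principalPart e φ) e.target := by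
  refine (contDiffOn_ofReal ((D.contDiffOn_β he).sqrt fun y _ =>
    (D.β_pos _).ne')).continuousOn.mul (((contDiffOn_ofReal
      (D.contDiffOn_sqrtDet he)).continuousOn.inv₀ fun y hy => ?_).mul ?_)
  · exact_mod_cast (D.sqrtDet_pos he hy).ne'
  · exact continuousOn_finsetSum _ fun i _ => D.continuousOn_magDeriv he i
      (D.contDiffOn_flux he hφ i)

theorem continuousOn_chartForm (he : e ∈ atlas (EuclideanSpace ℝ (Fin n)) X) {f ψ : X → ℂ}
    (hf : ContMDiff (𝓡 n) 𝓘(ℝ, ℂ) 1 f) (hψ : ContMDiff (𝓡 n) 𝓘(ℝ, ℂ) 1 ψ) :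
    ContinuousOn (D.chartForm e f ψ) e.target := by
  refine continuousOn_finsetSum _ fun i _ => continuousOn_finsetSum _ fun j _ =>
    (contDiffOn_ofReal (D.contDiffOn_inv_gram he i j)).continuousOn.mul
      (ContinuousOn.mul ?_ ?_)
  · exact Complex.continuous_conj.comp_continuousOn (D.continuousOn_magDeriv he i
      (D.contDiffOn_weighted he (k := 1) (by norm_num) hf))
  · exact D.continuousOn_magDeriv he j (D.contDiffOn_weighted he (k := 1) (by norm_num) hψ)

theorem chartForm_eq_sum_flux (f ψ : X → ℂ) (y : EuclideanSpace ℝ (Fin n)) :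
    (D.sqrtDet e y : ℂ) * D.chartForm e f ψ y = ∑ i : Fin n,
      (starRingEnd ℂ) (D.magDeriv e i (fun y' => D.weighted f (e.symm y')) y) *
        D.flux e ψ i y := by
  simp only [chartForm, flux_eq, Finset.mul_sum]
  refine Finset.sum_congr rfl fun i _ => Finset.sum_congr rfl fun j _ => ?_
  ring

/-- This is the Leibniz rule for the product of the conjugate of β^{1/2} f with the flux. The
potential is real, so its terms combine without remainder, and multiplication by |g|^{1/2} removes
the inverse density. -/
theorem conj_mul_principalPart (he : e ∈ atlas (EuclideanSpace ℝ (Fin n)) X) {f ψ : X → ℂ}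
    (hf : ContMDiff (𝓡 n) 𝓘(ℝ, ℂ) 1 f) (hψ : ContMDiff (𝓡 n) 𝓘(ℝ, ℂ) 2 ψ)
    {y : EuclideanSpace ℝ (Fin n)} (hy : y ∈ e.target) :
    (D.sqrtDet e y : ℂ) * ((starRingEnd ℂ) (f (e.symm y)) * D.principalPart e ψ y) =
      (D.sqrtDet e y : ℂ) * D.chartForm e f ψ y + ∑ i : Fin n, -Complex.I *
        fderiv ℝ (fun y' => (starRingEnd ℂ) (D.weighted f (e.symm y')) * D.flux e ψ i y') y
          (EuclideanSpace.single i (1 : ℝ)) := by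
  have hs : (D.sqrtDet e y : ℂ) ≠ 0 := by exact_mod_cast (D.sqrtDet_pos he hy).ne'
  have hF : DifferentiableAt ℝ (fun y' => D.weighted f (e.symm y')) y :=
    ((D.contDiffOn_weighted he (k := 1) (by norm_num) hf).contDiffAt
      (e.open_target.mem_nhds hy)).differentiableAt (by simp)
  have hflux : ∀ i, DifferentiableAt ℝ (D.flux e ψ i) y := fun i =>
    ((D.contDiffOn_flux he hψ i).contDiffAt (e.open_target.mem_nhds hy)).differentiableAt (by simp)
  rw [D.chartForm_eq_sum_flux, ← Finset.sum_add_distrib]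
  have hlhs : (D.sqrtDet e y : ℂ) * ((starRingEnd ℂ) (f (e.symm y)) * D.principalPart e ψ y) =
      ∑ i : Fin n, (starRingEnd ℂ) (D.weighted f (e.symm y)) * D.magDeriv e i (D.flux e ψ i) y := by
    rw [principalPart, weighted, map_mul, Complex.conj_ofReal, ← Finset.mul_sum]
    field_simp
  rw [hlhs]
  refine Finset.sum_congr rfl fun i _ => ?_
  have hconj : HasFDerivAt (fun y' => (starRingEnd ℂ) (D.weighted f (e.symm y')))
      ((Complex.conjCLE : ℂ →L[ℝ] ℂ).comp (fderiv ℝ (fun y' => D.weighted f (e.symm y')) y)) y :=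
    (Complex.conjCLE : ℂ →L[ℝ] ℂ).hasFDerivAt.comp y hF.hasFDerivAt
  have hprod : HasFDerivAt
      (fun y' => (starRingEnd ℂ) (D.weighted f (e.symm y')) * D.flux e ψ i y') _ y :=
    hconj.mul (hflux i).hasFDerivAt
  rw [hprod.fderiv]
  simp only [magDeriv, add_apply, smul_apply, ContinuousLinearMap.comp_apply, smul_eq_mul,
    map_sub, map_mul, map_neg, Complex.conj_I, Complex.conj_ofReal,
    ContinuousLinearEquiv.coe_coe, Complex.conjCLE_apply]
  ring

end StaticData

end StaticKG

/-! ### The quadratic form density on the manifold. -/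

namespace StaticKG

theorem sum_sum_conj_mul_congr {ι : Type*} [Fintype ι] (J G : Matrix ι ι ℝ) (a b : ι → ℂ) :
    ∑ i, ∑ j, ((G i j : ℝ) : ℂ) * ((starRingEnd ℂ) (∑ k, (J k i : ℂ) * a k) *
        ∑ l, (J l j : ℂ) * b l) =
      ∑ k, ∑ l, (((J * G * Jᵀ) k l : ℝ) : ℂ) * ((starRingEnd ℂ) (a k) * b l) := by
  have h1 : ∀ i j : ι, ((G i j : ℝ) : ℂ) * ((starRingEnd ℂ) (∑ k, (J k i : ℂ) * a k) *
      ∑ l, (J l j : ℂ) * b l) = ∑ k, ∑ l, (J k i : ℂ) * (G i j : ℂ) * (J l j : ℂ) *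
        ((starRingEnd ℂ) (a k) * b l) := fun i j => by
    rw [map_sum, Finset.sum_mul_sum, Finset.mul_sum]
    refine Finset.sum_congr rfl fun k _ => ?_
    rw [Finset.mul_sum]
    refine Finset.sum_congr rfl fun l _ => ?_
    rw [map_mul, Complex.conj_ofReal]
    ring
  have h2 : ∀ k l : ι, (((J * G * Jᵀ) k l : ℝ) : ℂ) * ((starRingEnd ℂ) (a k) * b l) =
      ∑ j, ∑ i, (J k i : ℂ) * (G i j : ℂ) * (J l j : ℂ) * ((starRingEnd ℂ) (a k) * b l) :=
    fun k l => by
      simp only [Matrix.mul_apply, Matrix.transpose_apply, Complex.ofReal_sum, Complex.ofReal_mul,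
        Finset.sum_mul]
  simp only [h1, h2]
  rw [Finset.sum_comm]
  have h3 : ∀ t : ι → ι → ι → ι → ℂ,
      ∑ j, ∑ i, ∑ k, ∑ l, t i j k l = ∑ k, ∑ l, ∑ j, ∑ i, t i j k l := fun t => by
    calc _ = ∑ j, ∑ k, ∑ i, ∑ l, t i j k l := Finset.sum_congr rfl fun j _ => Finset.sum_comm
      _ = ∑ k, ∑ j, ∑ i, ∑ l, t i j k l := Finset.sum_comm
      _ = ∑ k, ∑ j, ∑ l, ∑ i, t i j k l := Finset.sum_congr rfl fun k _ =>
        Finset.sum_congr rfl fun j _ => Finset.sum_comm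
      _ = _ := Finset.sum_congr rfl fun k _ => Finset.sum_comm
  exact h3 fun i j k l => (J k i : ℂ) * (G i j : ℂ) * (J l j : ℂ) * ((starRingEnd ℂ) (a k) * b l)

namespace StaticData

variable {n : ℕ} {X : Type*} [TopologicalSpace X]
  [ChartedSpace (EuclideanSpace ℝ (Fin n)) X] [IsManifold (𝓡 n) ∞ X]
  {e e' : OpenPartialHomeomorph X (EuclideanSpace ℝ (Fin n))} (D : StaticData n X)

/-- Only first derivatives occur: D − A transforms as a covector and the inverse metric
contravariantly, so the Jacobians cancel. -/
theorem chartForm_eq_chartForm (he : e ∈ atlas (EuclideanSpace ℝ (Fin n)) X)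
    (he' : e' ∈ atlas (EuclideanSpace ℝ (Fin n)) X) {f ψ : X → ℂ}
    (hf : ContMDiff (𝓡 n) 𝓘(ℝ, ℂ) 1 f) (hψ : ContMDiff (𝓡 n) 𝓘(ℝ, ℂ) 1 ψ) {x : X}
    (hx : x ∈ e.source) (hx' : x ∈ e'.source) :
    D.chartForm e' f ψ (e' x) = D.chartForm e f ψ (e x) := by
  have hy : e' x ∈ (e'.symm.trans e).source :=
    ⟨e'.map_source hx', by simpa [e'.left_inv hx'] using hx⟩
  have hd : ∀ {φ : X → ℂ}, ContMDiff (𝓡 n) 𝓘(ℝ, ℂ) 1 φ →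
      DifferentiableAt ℝ (fun y => D.weighted φ (e.symm y)) (e (e'.symm (e' x))) := fun hφ =>
    ((D.contDiffOn_weighted he (k := 1) (by norm_num) hφ).contDiffAt
      (e.open_target.mem_nhds (e.map_source hy.2))).differentiableAt (by simp)
  have hex : e (e'.symm (e' x)) = e x := by rw [e'.left_inv hx']
  rw [chartForm, chartForm]
  simp only [D.magDeriv_eq_sum_jacobian he he' hy (hd hf),
    D.magDeriv_eq_sum_jacobian he he' hy (hd hψ)]
  rw [sum_sum_conj_mul_congr, D.jacobian_mul_inv_gram_mul he he' hy, hex]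

/-- The density of the quadratic form of the principal part of `L`. -/
noncomputable def formDensity (f ψ : X → ℂ) (x : X) : ℂ :=
  D.chartForm (chartAt (EuclideanSpace ℝ (Fin n)) x) f ψ (chartAt (EuclideanSpace ℝ (Fin n)) x x)

theorem formDensity_eq_chartForm (he : e ∈ atlas (EuclideanSpace ℝ (Fin n)) X) {f ψ : X → ℂ}
    (hf : ContMDiff (𝓡 n) 𝓘(ℝ, ℂ) 1 f) (hψ : ContMDiff (𝓡 n) 𝓘(ℝ, ℂ) 1 ψ) {x : X}
    (hx : x ∈ e.source) : D.formDensity f ψ x = D.chartForm e f ψ (e x) :=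
  D.chartForm_eq_chartForm he (chart_mem_atlas _ x) hf hψ hx (mem_chart_source _ x)

theorem continuous_formDensity {f ψ : X → ℂ}
    (hf : ContMDiff (𝓡 n) 𝓘(ℝ, ℂ) 1 f) (hψ : ContMDiff (𝓡 n) 𝓘(ℝ, ℂ) 1 ψ) :
    Continuous (D.formDensity f ψ) := by
  rw [continuous_iff_continuousAt]
  intro x
  set e := chartAt (EuclideanSpace ℝ (Fin n)) x with hedef
  have he : e ∈ atlas (EuclideanSpace ℝ (Fin n)) X := chart_mem_atlas _ x
  have hx : x ∈ e.source := mem_chart_source _ x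
  have h : ContinuousOn (fun z => D.chartForm e f ψ (e z)) e.source :=
    (D.continuousOn_chartForm he hf hψ).comp e.continuousOn fun z hz => e.map_source hz
  refine (h.continuousAt (e.open_source.mem_nhds hx)).congr ?_
  filter_upwards [e.open_source.mem_nhds hx] with z hz
  exact (D.formDensity_eq_chartForm he hf hψ hz).symm

theorem magDeriv_eq_zero {w : EuclideanSpace ℝ (Fin n) → ℂ} {y : EuclideanSpace ℝ (Fin n)}
    (hw : w =ᶠ[nhds y] fun _ => 0) (i : Fin n) : D.magDeriv e i w y = 0 := by
  rw [magDeriv, hw.fderiv_eq, hw.eq_of_nhds]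
  simp

theorem weighted_comp_symm_eventuallyEq_zero {f : X → ℂ} {y : EuclideanSpace ℝ (Fin n)}
    (hy : y ∈ e.target) (hf : e.symm y ∉ tsupport f) :
    (fun y' => D.weighted f (e.symm y')) =ᶠ[nhds y] fun _ => 0 := by
  have h1 := (e.continuousAt_symm hy).eventually
    ((isClosed_tsupport f).isOpen_compl.mem_nhds hf)
  filter_upwards [h1] with z hz
  rw [weighted, image_eq_zero_of_notMem_tsupport hz, mul_zero]

theorem chartForm_eq_zero {f : X → ℂ} (ψ : X → ℂ) {y : EuclideanSpace ℝ (Fin n)}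
    (hy : y ∈ e.target) (hf : e.symm y ∉ tsupport f) : D.chartForm e f ψ y = 0 := by
  refine Finset.sum_eq_zero fun i _ => Finset.sum_eq_zero fun j _ => ?_
  rw [D.magDeriv_eq_zero (D.weighted_comp_symm_eventuallyEq_zero hy hf)]
  simp

theorem formDensity_eq_zero {f : X → ℂ} (ψ : X → ℂ) {x : X} (hf : x ∉ tsupport f) :
    D.formDensity f ψ x = 0 :=
  D.chartForm_eq_zero ψ (mem_chart_target _ x)
    (by rwa [OpenPartialHomeomorph.left_inv _ (mem_chart_source _ x)])

theorem continuous_mul_of_tsupport_subset {f g : X → ℂ} {O : Set X} (hO : IsOpen O)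
    (hf : Continuous f) (hfO : tsupport f ⊆ O) (hg : ContinuousOn g O) :
    Continuous fun x => f x * g x := by
  rw [continuous_iff_continuousAt]
  intro x
  by_cases hx : x ∈ O
  · exact hf.continuousAt.mul (hg.continuousAt (hO.mem_nhds hx))
  · refine continuousAt_const (y := (0 : ℂ)) |>.congr ?_
    filter_upwards [(isClosed_tsupport f).isOpen_compl.mem_nhds fun h => hx (hfO h)] with z hz
    rw [image_eq_zero_of_notMem_tsupport hz, zero_mul]

theorem setIntegral_target_conj_mul_principalPart (he : e ∈ atlas (EuclideanSpace ℝ (Fin n)) X)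
    {f ψ : X → ℂ} (hf : ContMDiff (𝓡 n) 𝓘(ℝ, ℂ) 1 f) (hfc : HasCompactSupport f)
    (hfe : tsupport f ⊆ e.source) (hψ : ContMDiff (𝓡 n) 𝓘(ℝ, ℂ) 2 ψ) :
    ∫ y in e.target, (D.sqrtDet e y : ℂ) *
        ((starRingEnd ℂ) (f (e.symm y)) * D.principalPart e ψ y) =
      ∫ y in e.target, (D.sqrtDet e y : ℂ) * D.chartForm e f ψ y := by
  have hK : IsCompact (e '' tsupport f) := hfc.isCompact.image_of_continuousOn
    (e.continuousOn.mono hfe)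
  have hKt : e '' tsupport f ⊆ e.target := by
    rintro _ ⟨x, hx, rfl⟩
    exact e.map_source (hfe hx)
  have hKf : ∀ y ∈ e.target, y ∉ e '' tsupport f → e.symm y ∉ tsupport f := fun y hy hyK hs =>
    hyK ⟨e.symm y, hs, e.right_inv hy⟩
  have hG : ∀ i, ContDiffOn ℝ 1 (fun y' => (starRingEnd ℂ) (D.weighted f (e.symm y')) *
      D.flux e ψ i y') e.target := fun i =>
    ((Complex.conjCLE : ℂ →L[ℝ] ℂ).contDiff.comp_contDiffOn
      (D.contDiffOn_weighted he (k := 1) (by norm_num) hf)).mul (D.contDiffOn_flux he hψ i)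
  have hG0 : ∀ i, ∀ y ∈ e.target, y ∉ e '' tsupport f →
      (fun y' => (starRingEnd ℂ) (D.weighted f (e.symm y')) * D.flux e ψ i y') =ᶠ[nhds y]
        fun _ => 0 := fun i y hy hyK => by
    filter_upwards [D.weighted_comp_symm_eventuallyEq_zero hy (hKf y hy hyK)] with z hz
    rw [hz, map_zero, zero_mul]
  have hint1 : IntegrableOn (fun y => (D.sqrtDet e y : ℂ) * D.chartForm e f ψ y) e.target :=
    integrableOn_of_continuousOn_of_eq_zero e.open_target hK hKt
      ((contDiffOn_ofReal (D.contDiffOn_sqrtDet he)).continuousOn.mul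
        (D.continuousOn_chartForm he hf (hψ.of_le (by norm_num)))) fun y hy hyK => by
      rw [D.chartForm_eq_zero ψ hy (hKf y hy hyK), mul_zero]
  have hint2 : ∀ i : Fin n, IntegrableOn (fun y => -Complex.I *
      fderiv ℝ (fun y' => (starRingEnd ℂ) (D.weighted f (e.symm y')) * D.flux e ψ i y') y
        (EuclideanSpace.single i (1 : ℝ))) e.target := fun i =>
    integrableOn_of_continuousOn_of_eq_zero e.open_target hK hKt
      (continuousOn_const.mul (((hG i).continuousOn_fderiv_of_isOpen e.open_target
        le_rfl).clm_apply continuousOn_const)) fun y hy hyK => by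
      rw [(hG0 i y hy hyK).fderiv_eq]
      simp
  rw [setIntegral_congr_fun e.open_target.measurableSet
    fun y hy => D.conj_mul_principalPart he hf hψ hy,
    integral_add hint1 (integrable_finsetSum _ fun i _ => hint2 i),
    integral_finsetSum _ fun i _ => hint2 i, add_eq_left]
  refine Finset.sum_eq_zero fun i _ => ?_
  rw [integral_const_mul, setIntegral_fderiv_eq_zero volume e.open_target hK hKt (hG i)
    (fun y hy hyK => (hG0 i y hy hyK).eq_of_nhds), mul_zero]

variable [MeasurableSpace X] [BorelSpace X]

theorem integral_conj_mul_principalPart (x₀ : X) {f ψ : X → ℂ}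
    (hf : ContMDiff (𝓡 n) 𝓘(ℝ, ℂ) 1 f) (hfc : HasCompactSupport f)
    (hfe : tsupport f ⊆ (chartAt (EuclideanSpace ℝ (Fin n)) x₀).source)
    (hψ : ContMDiff (𝓡 n) 𝓘(ℝ, ℂ) 2 ψ) :
    ∫ x, (starRingEnd ℂ) (f x) * D.principalPart (chartAt (EuclideanSpace ℝ (Fin n)) x₀) ψ
        (chartAt (EuclideanSpace ℝ (Fin n)) x₀ x) ∂D.μ = ∫ x, D.formDensity f ψ x ∂D.μ := by
  set e := chartAt (EuclideanSpace ℝ (Fin n)) x₀ with hedef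
  have he : e ∈ atlas (EuclideanSpace ℝ (Fin n)) X := chart_mem_atlas _ x₀
  have hψ1 : ContMDiff (𝓡 n) 𝓘(ℝ, ℂ) 1 ψ := hψ.of_le (by norm_num)
  have h0 : ∀ x ∉ e.source, x ∉ tsupport f := fun x hx h => hx (hfe h)
  have hc : Continuous fun x => (starRingEnd ℂ) (f x) * D.principalPart e ψ (e x) := by
    refine continuous_mul_of_tsupport_subset e.open_source
      (Complex.continuous_conj.comp hf.continuous)
      ((tsupport_comp_subset (map_zero (starRingEnd ℂ)) f).trans hfe) ?_
    exact (D.continuousOn_principalPart he hψ).comp e.continuousOn fun z hz => e.map_source hz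
  rw [← setIntegral_eq_integral_of_forall_compl_eq_zero (s := e.source)
      (f := fun x => D.formDensity f ψ x) fun x hx => D.formDensity_eq_zero ψ (h0 x hx),
    ← setIntegral_eq_integral_of_forall_compl_eq_zero (s := e.source) (fun x hx => by
      rw [image_eq_zero_of_notMem_tsupport (h0 x hx), map_zero, zero_mul]),
    D.setIntegral_chart_source x₀ hc.measurable.aestronglyMeasurable,
    D.setIntegral_chart_source x₀
      (D.continuous_formDensity hf hψ1).measurable.aestronglyMeasurable]
  refine Eq.trans ?_ ((D.setIntegral_target_conj_mul_principalPart he hf hfc hfe hψ).trans ?_)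
  · refine setIntegral_congr_fun e.open_target.measurableSet fun y hy => ?_
    simp only [← hedef]
    rw [e.right_inv hy, Complex.real_smul]
  · refine setIntegral_congr_fun e.open_target.measurableSet fun y hy => ?_
    simp only [← hedef]
    rw [D.formDensity_eq_chartForm he hf hψ1 (e.map_target hy), e.right_inv hy, Complex.real_smul]

end StaticData

end StaticKG

/-! ### Chart independence of L and global integration by parts. -/

namespace StaticKG

theorem sigmaCompactSpace_of_chartedSpace (n : ℕ) (X : Type*) [TopologicalSpace X]
    [SecondCountableTopology X] [ChartedSpace (EuclideanSpace ℝ (Fin n)) X] :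
    SigmaCompactSpace X := by
  have : LocallyCompactSpace X := ChartedSpace.locallyCompactSpace (EuclideanSpace ℝ (Fin n)) X
  infer_instance

namespace StaticData

variable {n : ℕ} {X : Type*} [TopologicalSpace X]
  [ChartedSpace (EuclideanSpace ℝ (Fin n)) X] [IsManifold (𝓡 n) ∞ X]
  {e e' : OpenPartialHomeomorph X (EuclideanSpace ℝ (Fin n))} (D : StaticData n X)

theorem magDeriv_sum {ι : Type*} (s : Finset ι) {w : ι → EuclideanSpace ℝ (Fin n) → ℂ}
    {y : EuclideanSpace ℝ (Fin n)} (hw : ∀ k ∈ s, DifferentiableAt ℝ (w k) y) (i : Fin n) :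
    D.magDeriv e i (fun y' => ∑ k ∈ s, w k y') y = ∑ k ∈ s, D.magDeriv e i (w k) y := by
  simp only [magDeriv]
  rw [fderiv_fun_sum hw, sum_apply, Finset.mul_sum, Finset.mul_sum, Finset.sum_sub_distrib]

theorem formDensity_sum {ι : Type*} (s : Finset ι) {f : ι → X → ℂ} (ψ : X → ℂ)
    (hf : ∀ k ∈ s, ContMDiff (𝓡 n) 𝓘(ℝ, ℂ) 1 (f k)) (x : X) :
    D.formDensity (fun x => ∑ k ∈ s, f k x) ψ x = ∑ k ∈ s, D.formDensity (f k) ψ x := by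
  set e := chartAt (EuclideanSpace ℝ (Fin n)) x with hedef
  have he : e ∈ atlas (EuclideanSpace ℝ (Fin n)) X := chart_mem_atlas _ x
  have hy : e x ∈ e.target := mem_chart_target _ x
  have hd : ∀ k ∈ s, DifferentiableAt ℝ (fun y => D.weighted (f k) (e.symm y)) (e x) :=
    fun k hk => ((D.contDiffOn_weighted he (k := 1) (by norm_num) (hf k hk)).contDiffAt
      (e.open_target.mem_nhds hy)).differentiableAt (by simp)
  have hw : (fun y' => D.weighted (fun x => ∑ k ∈ s, f k x) (e.symm y')) =
      fun y' => ∑ k ∈ s, D.weighted (f k) (e.symm y') := by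
    funext y'
    simp only [weighted, Finset.mul_sum]
  simp only [formDensity, ← hedef, chartForm]
  rw [hw, Finset.sum_comm' (t' := Finset.univ) (s' := fun _ => s) (by simp)]
  refine Finset.sum_congr rfl fun i _ => ?_
  rw [Finset.sum_comm' (t' := Finset.univ) (s' := fun _ => s) (by simp)]
  refine Finset.sum_congr rfl fun j _ => ?_
  rw [D.magDeriv_sum s hd, map_sum, Finset.sum_mul, Finset.mul_sum]

/-- The part of `L φ` without the scalar potential. -/
noncomputable def principal (φ : X → ℂ) (x : X) : ℂ :=
  D.principalPart (chartAt (EuclideanSpace ℝ (Fin n)) x) φ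
    (chartAt (EuclideanSpace ℝ (Fin n)) x x)

theorem applyL_eq (φ : X → ℂ) (x : X) :
    D.applyL φ x = D.principal φ x + (D.β x : ℂ) * (D.Y x : ℂ) * φ x := by
  simp only [applyL, principal, principalPart]
  rw [OpenPartialHomeomorph.left_inv _ (mem_chart_source _ x)]

theorem principal_eq_zero {φ : X → ℂ} {x : X} (hx : x ∉ tsupport φ) : D.principal φ x = 0 := by
  set e := chartAt (EuclideanSpace ℝ (Fin n)) x with hedef
  have hxs : x ∈ e.source := mem_chart_source _ x
  have hev : ∀ᶠ y in nhds (e x), y ∈ e.target ∧ e.symm y ∉ tsupport φ := by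
    refine Filter.Eventually.and (e.open_target.mem_nhds (e.map_source hxs)) ?_
    refine (e.continuousAt_symm (e.map_source hxs)).eventually
      ((isClosed_tsupport φ).isOpen_compl.mem_nhds ?_)
    rw [e.left_inv hxs]
    exact hx
  have hflux : ∀ i, D.flux e φ i =ᶠ[nhds (e x)] fun _ => 0 := fun i => by
    filter_upwards [hev] with y hy
    rw [flux_eq]
    simp only [D.magDeriv_eq_zero (D.weighted_comp_symm_eventuallyEq_zero hy.1 hy.2), mul_zero,
      Finset.sum_const_zero]
  simp only [principal, principalPart, ← hedef, D.magDeriv_eq_zero (hflux _),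
    Finset.sum_const_zero, mul_zero]

variable [MeasurableSpace X] [BorelSpace X] [T2Space X] [SecondCountableTopology X]

/-- A second order chain rule is avoided. Against any test function supported in the overlap, both
expressions integrate to the integral of the invariant form density. They therefore agree almost
everywhere, and everywhere by continuity. -/
theorem principalPart_eq_principalPart (x₀ x₁ : X) {φ : X → ℂ}
    (hφ : ContMDiff (𝓡 n) 𝓘(ℝ, ℂ) 2 φ) {x : X}
    (hx₀ : x ∈ (chartAt (EuclideanSpace ℝ (Fin n)) x₀).source)
    (hx₁ : x ∈ (chartAt (EuclideanSpace ℝ (Fin n)) x₁).source) :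
    D.principalPart (chartAt (EuclideanSpace ℝ (Fin n)) x₀) φ
        (chartAt (EuclideanSpace ℝ (Fin n)) x₀ x) =
      D.principalPart (chartAt (EuclideanSpace ℝ (Fin n)) x₁) φ
        (chartAt (EuclideanSpace ℝ (Fin n)) x₁ x) := by
  have := D.isLocallyFiniteMeasure_μ
  have := D.isOpenPosMeasure_μ
  have := sigmaCompactSpace_of_chartedSpace n X
  set e₀ := chartAt (EuclideanSpace ℝ (Fin n)) x₀ with he₀
  set e₁ := chartAt (EuclideanSpace ℝ (Fin n)) x₁ with he₁
  have hO : IsOpen (e₀.source ∩ e₁.source) := e₀.open_source.inter e₁.open_source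
  have hc₀ : ContinuousOn (fun x => D.principalPart e₀ φ (e₀ x)) (e₀.source ∩ e₁.source) :=
    (D.continuousOn_principalPart (chart_mem_atlas _ x₀) hφ).comp
      (e₀.continuousOn.mono Set.inter_subset_left) fun z hz => e₀.map_source hz.1
  have hc₁ : ContinuousOn (fun x => D.principalPart e₁ φ (e₁ x)) (e₀.source ∩ e₁.source) :=
    (D.continuousOn_principalPart (chart_mem_atlas _ x₁) hφ).comp
      (e₁.continuousOn.mono Set.inter_subset_right) fun z hz => e₁.map_source hz.2
  have hae := hO.ae_eq_zero_of_integral_contMDiff_smul_eq_zero (𝓡 n) (μ := D.μ)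
    (f := fun x => D.principalPart e₀ φ (e₀ x) - D.principalPart e₁ φ (e₁ x))
    ((hc₀.sub hc₁).locallyIntegrableOn hO.measurableSet) fun g hg hgc hgs => by
      have hf : ContMDiff (𝓡 n) 𝓘(ℝ, ℂ) 1 (fun x => (g x : ℂ)) :=
        (Complex.ofRealCLM.contDiff (n := 1)).contMDiff.comp (hg.of_le (by exact_mod_cast le_top))
      have hts : tsupport (fun x => (g x : ℂ)) ⊆ e₀.source ∩ e₁.source :=
        (tsupport_comp_subset Complex.ofReal_zero g).trans hgs
      have hfc : HasCompactSupport fun x => (g x : ℂ) := hgc.comp_left Complex.ofReal_zero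
      have h₀ := D.integral_conj_mul_principalPart x₀ hf hfc
        (hts.trans Set.inter_subset_left) hφ
      have h₁ := D.integral_conj_mul_principalPart x₁ hf hfc
        (hts.trans Set.inter_subset_right) hφ
      simp only [Complex.conj_ofReal] at h₀ h₁
      have hi : ∀ {p : X → ℂ}, ContinuousOn p (e₀.source ∩ e₁.source) →
          Integrable (fun x => (g x : ℂ) * p x) D.μ := fun hp =>
        (continuous_mul_of_tsupport_subset hO hf.continuous hts hp).integrable_of_hasCompactSupport
          hfc.mul_right
      simp only [Complex.real_smul, mul_sub]
      rw [integral_sub (hi hc₀) (hi hc₁), h₀, h₁, sub_self]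
  have hae' : (fun x => D.principalPart e₀ φ (e₀ x)) =ᵐ[D.μ.restrict (e₀.source ∩ e₁.source)]
      fun x => D.principalPart e₁ φ (e₁ x) := by
    rw [Filter.EventuallyEq, ae_restrict_iff' hO.measurableSet]
    filter_upwards [hae] with z hz hzO using sub_eq_zero.1 (hz hzO)
  exact Measure.eqOn_open_of_ae_eq hae' hO hc₀ hc₁ ⟨hx₀, hx₁⟩

theorem principal_eq_principalPart (x₀ : X) {φ : X → ℂ} (hφ : ContMDiff (𝓡 n) 𝓘(ℝ, ℂ) 2 φ)
    {x : X} (hx : x ∈ (chartAt (EuclideanSpace ℝ (Fin n)) x₀).source) :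
    D.principal φ x = D.principalPart (chartAt (EuclideanSpace ℝ (Fin n)) x₀) φ
        (chartAt (EuclideanSpace ℝ (Fin n)) x₀ x) :=
  D.principalPart_eq_principalPart x x₀ hφ (mem_chart_source _ x) hx

/-- The preferred chart changes from point to point, so continuity depends on chart independence:
near a point one fixed chart may be used. -/
theorem continuous_principal {φ : X → ℂ} (hφ : ContMDiff (𝓡 n) 𝓘(ℝ, ℂ) 2 φ) :
    Continuous (D.principal φ) := by
  rw [continuous_iff_continuousAt]
  intro x
  set e := chartAt (EuclideanSpace ℝ (Fin n)) x with hedef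
  have h : ContinuousOn (fun z => D.principalPart e φ (e z)) e.source :=
    (D.continuousOn_principalPart (chart_mem_atlas _ x) hφ).comp e.continuousOn
      fun z hz => e.map_source hz
  refine (h.continuousAt (e.open_source.mem_nhds (mem_chart_source _ x))).congr ?_
  filter_upwards [e.open_source.mem_nhds (mem_chart_source _ x)] with z hz
  exact (D.principal_eq_principalPart x hφ hz).symm

omit [MeasurableSpace X] [BorelSpace X] in
theorem exists_eq_sum_tsupport_subset_chart {f : X → ℂ}
    (hf : ContMDiff (𝓡 n) 𝓘(ℝ, ℂ) 1 f) (hfc : HasCompactSupport f) :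
    ∃ (t : Finset X) (F : t → X → ℂ), (f = fun x => ∑ i, F i x) ∧
      (∀ i, ContMDiff (𝓡 n) 𝓘(ℝ, ℂ) 1 (F i)) ∧ (∀ i, HasCompactSupport (F i)) ∧
      ∀ i, tsupport (F i) ⊆ (chartAt (EuclideanSpace ℝ (Fin n)) (i : X)).source := by
  have := sigmaCompactSpace_of_chartedSpace n X
  obtain ⟨t, ht⟩ := hfc.isCompact.elim_finite_subcover
    (fun i : X => (chartAt (EuclideanSpace ℝ (Fin n)) i).source)
    (fun i => (chartAt (EuclideanSpace ℝ (Fin n)) i).open_source)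
    (fun x _ => Set.mem_iUnion.2 ⟨x, mem_chart_source _ x⟩)
  obtain ⟨ρ, hρ⟩ := SmoothPartitionOfUnity.exists_isSubordinate (𝓡 n) (isClosed_tsupport f)
    (fun i : t => (chartAt (EuclideanSpace ℝ (Fin n)) (i : X)).source)
    (fun i => (chartAt (EuclideanSpace ℝ (Fin n)) (i : X)).open_source)
    (fun x hx => by
      obtain ⟨i, hi, hxi⟩ := Set.mem_iUnion₂.1 (ht hx)
      exact Set.mem_iUnion.2 ⟨⟨i, hi⟩, hxi⟩)
  refine ⟨t, fun i x => ρ i x • f x, ?_, fun i =>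
    ((ρ i).contMDiff.of_le (by exact_mod_cast le_top)).smul hf, fun i =>
    HasCompactSupport.intro hfc.isCompact fun x hx => ?_,
    fun i => (tsupport_smul_subset_left _ _).trans (hρ i)⟩
  swap
  · change ρ i x • f x = 0
    rw [image_eq_zero_of_notMem_tsupport hx, smul_zero]
  funext x
  by_cases hx : x ∈ tsupport f
  · have h1 := ρ.sum_eq_one hx
    rw [finsum_eq_sum_of_fintype] at h1
    rw [← Finset.sum_smul, h1, one_smul]
  · simp [image_eq_zero_of_notMem_tsupport hx]

/-- Integration by parts for the principal part of `L`. -/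
theorem integral_conj_mul_principal {f ψ : X → ℂ}
    (hf : ContMDiff (𝓡 n) 𝓘(ℝ, ℂ) 1 f) (hfc : HasCompactSupport f)
    (hψ : ContMDiff (𝓡 n) 𝓘(ℝ, ℂ) 2 ψ) :
    ∫ x, (starRingEnd ℂ) (f x) * D.principal ψ x ∂D.μ = ∫ x, D.formDensity f ψ x ∂D.μ := by
  have := D.isLocallyFiniteMeasure_μ
  obtain ⟨t, F, hsum, hsm, hcs, hts⟩ := exists_eq_sum_tsupport_subset_chart hf hfc
  have hpart : ∀ i, ∫ x, (starRingEnd ℂ) (F i x) * D.principal ψ x ∂D.μ =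
      ∫ x, D.formDensity (F i) ψ x ∂D.μ := fun i => by
    rw [← D.integral_conj_mul_principalPart (i : X) (hsm i) (hcs i) (hts i) hψ]
    refine integral_congr_ae (Filter.Eventually.of_forall fun x => ?_)
    by_cases hx : x ∈ (chartAt (EuclideanSpace ℝ (Fin n)) (i : X)).source
    · simp only [D.principal_eq_principalPart (i : X) hψ hx]
    · have h0 : F i x = 0 := image_eq_zero_of_notMem_tsupport fun h => hx (hts i h)
      simp only [h0, map_zero, zero_mul]
  have hi1 : ∀ i ∈ (Finset.univ : Finset t),
      Integrable (fun x => (starRingEnd ℂ) (F i x) * D.principal ψ x) D.μ := fun i _ =>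
    ((Complex.continuous_conj.comp (hsm i).continuous).mul
      (D.continuous_principal hψ)).integrable_of_hasCompactSupport
        (((hcs i).comp_left (map_zero (starRingEnd ℂ))).mul_right)
  have hi2 : ∀ i ∈ (Finset.univ : Finset t),
      Integrable (D.formDensity (F i) ψ) D.μ := fun i _ =>
    (D.continuous_formDensity (hsm i) (hψ.of_le (by norm_num))).integrable_of_hasCompactSupport
      (HasCompactSupport.intro (hcs i).isCompact fun x hx => D.formDensity_eq_zero ψ hx)
  rw [hsum]
  simp only [D.formDensity_sum Finset.univ ψ (fun i _ => hsm i), map_sum, Finset.sum_mul]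
  rw [integral_finsetSum _ hi1, integral_finsetSum _ hi2]
  exact Finset.sum_congr rfl fun i _ => hpart i

end StaticData

end StaticKG

/-! ### Positivity and Cauchy–Schwarz for the form of L. -/

namespace StaticKG

/-- Turns weighted pointwise inequalities, once integrated, into the Cauchy–Schwarz inequality. -/
theorem le_sqrt_mul_sqrt_of_forall_two_mul_le {a b c : ℝ} (hb : 0 ≤ b) (hc : 0 ≤ c)
    (h : ∀ t : ℝ, 0 < t → 2 * a ≤ t * b + t⁻¹ * c) : a ≤ √b * √c := by
  refine le_of_forall_pos_le_add fun ε hε => ?_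
  have key : ∀ δ : ℝ, 0 < δ → a ≤ (√b + δ) * (√c + δ) := fun δ hδ => by
    have hb' : 0 < √b + δ := by positivity
    have hc' : 0 < √c + δ := by positivity
    -- The optimal weight is the quotient of √c and √b; the shift by δ keeps it meaningful when one
    -- of them vanishes, and δ → 0 afterwards.
    have h1 := h ((√c + δ) / (√b + δ)) (by positivity)
    have h2 : b ≤ (√b + δ) ^ 2 := by nlinarith [Real.sq_sqrt hb, Real.sqrt_nonneg b]
    have h3 : c ≤ (√c + δ) ^ 2 := by nlinarith [Real.sq_sqrt hc, Real.sqrt_nonneg c]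
    have h4 : (√c + δ) / (√b + δ) * b ≤ (√b + δ) * (√c + δ) := by
      calc (√c + δ) / (√b + δ) * b ≤ (√c + δ) / (√b + δ) * (√b + δ) ^ 2 := by gcongr
        _ = _ := by field_simp
    have h5 : ((√c + δ) / (√b + δ))⁻¹ * c ≤ (√b + δ) * (√c + δ) := by
      calc ((√c + δ) / (√b + δ))⁻¹ * c ≤ ((√c + δ) / (√b + δ))⁻¹ * (√c + δ) ^ 2 := by gcongr
        _ = _ := by field_simp
    linarith
  have hlim : Filter.Tendsto (fun δ : ℝ => (√b + δ) * (√c + δ)) (nhdsWithin 0 (Set.Ioi 0))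
      (nhds ((√b + 0) * (√c + 0))) := by
    refine Filter.Tendsto.mono_left ?_ nhdsWithin_le_nhds
    exact Continuous.tendsto (by fun_prop) 0
  have h6 := ge_of_tendsto hlim (by
    filter_upwards [self_mem_nhdsWithin] with δ hδ using key δ hδ)
  simp only [add_zero] at h6
  linarith

theorem two_mul_norm_mul_le {z w : ℂ} {t : ℝ} (ht : 0 < t) :
    2 * ‖(starRingEnd ℂ) z * w‖ ≤ t * ‖z‖ ^ 2 + t⁻¹ * ‖w‖ ^ 2 := by
  rw [norm_mul, RCLike.norm_conj]
  have h : 0 ≤ t⁻¹ * (t * ‖z‖ - ‖w‖) ^ 2 := by positivity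
  have h2 : t⁻¹ * (t * ‖z‖ - ‖w‖) ^ 2 = t * ‖z‖ ^ 2 + t⁻¹ * ‖w‖ ^ 2 - 2 * (‖z‖ * ‖w‖) := by
    field_simp
    ring
  linarith

theorem sum_sum_conj_mul_self_eq {ι : Type*} [Fintype ι] [DecidableEq ι] (R : Matrix ι ι ℝ)
    (a b : ι → ℂ) : ∑ i, ∑ j, (((Rᵀ * R) i j : ℝ) : ℂ) * ((starRingEnd ℂ) (a i) * b j) =
      ∑ k, (starRingEnd ℂ) (∑ i, (R k i : ℂ) * a i) * ∑ j, (R k j : ℂ) * b j := by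
  have h := sum_sum_conj_mul_congr Rᵀ (1 : Matrix ι ι ℝ) a b
  rw [Matrix.mul_one, Matrix.transpose_transpose] at h
  rw [← h]
  refine Finset.sum_congr rfl fun k _ => ?_
  rw [Finset.sum_eq_single k (fun j _ hj => by simp [Matrix.one_apply_ne hj.symm])
    (fun h => absurd (Finset.mem_univ k) h)]
  simp

open scoped MatrixOrder in
theorem exists_eq_transpose_mul_self {ι : Type*} [Fintype ι] [DecidableEq ι] {G : Matrix ι ι ℝ}
    (hG : G.PosSemidef) : ∃ R : Matrix ι ι ℝ, G = Rᵀ * R := by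
  obtain ⟨R, hR, -, rfl⟩ := CFC.exists_sqrt_of_isSelfAdjoint_of_quasispectrumRestricts
    hG.isHermitian (QuasispectrumRestricts.nnreal_of_nonneg hG.nonneg)
  refine ⟨R, ?_⟩
  have h : Rᴴ = R := hR.star_eq
  rw [← Matrix.conjTranspose_eq_transpose_of_trivial, h]

namespace StaticData

variable {n : ℕ} {X : Type*} [TopologicalSpace X]
  [ChartedSpace (EuclideanSpace ℝ (Fin n)) X] [IsManifold (𝓡 n) ∞ X] (D : StaticData n X)

/-- Factoring the inverse Gram matrix as RᵀR turns the density at one point into a standard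
hermitian product. The vector `a` depends on one function at a time, which gives hermitian symmetry,
positivity and Cauchy–Schwarz. -/
theorem exists_formDensity_eq_sum (x : X) : ∃ a : (X → ℂ) → Fin n → ℂ, ∀ f ψ : X → ℂ,
    D.formDensity f ψ x = ∑ k, (starRingEnd ℂ) (a f k) * a ψ k := by
  set e := chartAt (EuclideanSpace ℝ (Fin n)) x with hedef
  have he : e ∈ atlas (EuclideanSpace ℝ (Fin n)) X := chart_mem_atlas _ x
  have hG := (D.posDef_gram he (mem_chart_target _ x)).inv.posSemidef
  obtain ⟨R, hR⟩ := exists_eq_transpose_mul_self hG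
  refine ⟨fun f k => ∑ i, (R k i : ℂ) *
    D.magDeriv e i (fun y' => D.weighted f (e.symm y')) (e x), fun f ψ => ?_⟩
  rw [← sum_sum_conj_mul_self_eq, ← hR]
  rfl

theorem conj_formDensity (f ψ : X → ℂ) (x : X) :
    (starRingEnd ℂ) (D.formDensity f ψ x) = D.formDensity ψ f x := by
  obtain ⟨a, ha⟩ := D.exists_formDensity_eq_sum x
  rw [ha, ha, map_sum]
  refine Finset.sum_congr rfl fun k _ => ?_
  rw [map_mul, Complex.conj_conj, mul_comm]

theorem formDensity_self_re (f : X → ℂ) (x : X) : 0 ≤ (D.formDensity f f x).re := by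
  obtain ⟨a, ha⟩ := D.exists_formDensity_eq_sum x
  rw [ha, Complex.re_sum]
  refine Finset.sum_nonneg fun k _ => ?_
  rw [← Complex.normSq_eq_conj_mul_self, Complex.ofReal_re]
  exact Complex.normSq_nonneg _

theorem two_mul_norm_formDensity_le (f ψ : X → ℂ) (x : X) {t : ℝ} (ht : 0 < t) :
    2 * ‖D.formDensity f ψ x‖ ≤
      t * (D.formDensity f f x).re + t⁻¹ * (D.formDensity ψ ψ x).re := by
  obtain ⟨a, ha⟩ := D.exists_formDensity_eq_sum x
  have hre : ∀ f, (D.formDensity f f x).re = ∑ k, ‖a f k‖ ^ 2 := fun f => by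
    rw [ha, Complex.re_sum]
    refine Finset.sum_congr rfl fun k _ => ?_
    rw [← Complex.normSq_eq_conj_mul_self, Complex.ofReal_re, Complex.normSq_eq_norm_sq]
  rw [hre, hre, ha, Finset.mul_sum, Finset.mul_sum, ← Finset.sum_add_distrib]
  calc 2 * ‖∑ k, (starRingEnd ℂ) (a f k) * a ψ k‖
      ≤ 2 * ∑ k, ‖(starRingEnd ℂ) (a f k) * a ψ k‖ := by gcongr; exact norm_sum_le _ _
    _ = ∑ k, 2 * ‖(starRingEnd ℂ) (a f k) * a ψ k‖ := Finset.mul_sum _ _ _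
    _ ≤ _ := Finset.sum_le_sum fun k _ => two_mul_norm_mul_le ht

/-- The density of the quadratic form of `L`. -/
noncomputable def energyDensity (f ψ : X → ℂ) (x : X) : ℂ :=
  D.formDensity f ψ x + (starRingEnd ℂ) (f x) * ((D.β x : ℂ) * (D.Y x : ℂ) * ψ x)

theorem conj_energyDensity (f ψ : X → ℂ) (x : X) :
    (starRingEnd ℂ) (D.energyDensity f ψ x) = D.energyDensity ψ f x := by
  simp only [energyDensity, map_add, conj_formDensity, map_mul, Complex.conj_conj,
    Complex.conj_ofReal]
  ring

theorem energyDensity_self_re (f : X → ℂ) (x : X) : (D.energyDensity f f x).re =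
    (D.formDensity f f x).re + D.β x * D.Y x * ‖f x‖ ^ 2 := by
  have h : (starRingEnd ℂ) (f x) * ((D.β x : ℂ) * (D.Y x : ℂ) * f x) =
      ((D.β x * D.Y x * ‖f x‖ ^ 2 : ℝ) : ℂ) := by
    rw [← Complex.normSq_eq_norm_sq]
    push_cast
    rw [Complex.normSq_eq_conj_mul_self]
    ring
  rw [energyDensity, Complex.add_re, h, Complex.ofReal_re]

theorem two_mul_norm_energyDensity_le (f ψ : X → ℂ) {x : X} (hY : 0 ≤ D.Y x) {t : ℝ}
    (ht : 0 < t) : 2 * ‖D.energyDensity f ψ x‖ ≤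
      t * (D.energyDensity f f x).re + t⁻¹ * (D.energyDensity ψ ψ x).re := by
  have h1 := D.two_mul_norm_formDensity_le f ψ x ht
  have h2 : ‖(starRingEnd ℂ) (f x) * ((D.β x : ℂ) * (D.Y x : ℂ) * ψ x)‖ =
      D.β x * D.Y x * ‖(starRingEnd ℂ) (f x) * ψ x‖ := by
    rw [norm_mul, norm_mul, norm_mul, norm_mul, Complex.norm_real, Complex.norm_real,
      Real.norm_of_nonneg (D.β_pos x).le, Real.norm_of_nonneg hY]
    ring
  have h3 := mul_le_mul_of_nonneg_left (two_mul_norm_mul_le (z := f x) (w := ψ x) ht)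
    (mul_nonneg (D.β_pos x).le hY)
  have h4 := norm_add_le (D.formDensity f ψ x)
    ((starRingEnd ℂ) (f x) * ((D.β x : ℂ) * (D.Y x : ℂ) * ψ x))
  rw [h2] at h4
  rw [energyDensity_self_re, energyDensity_self_re]
  rw [energyDensity]
  nlinarith

theorem energyDensity_self_nonneg (f : X → ℂ) {x : X} (hY : 0 ≤ D.Y x) :
    0 ≤ (D.energyDensity f f x).re := by
  rw [energyDensity_self_re]
  have := D.β_pos x
  have := D.formDensity_self_re f x
  positivity

variable [MeasurableSpace X] [BorelSpace X]

omit [IsManifold (𝓡 n) ∞ X] [MeasurableSpace X] [BorelSpace X] in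
theorem IsTestFunction.contMDiff_two {φ : X → ℂ} (hφ : IsTestFunction (n := n) φ) :
    ContMDiff (𝓡 n) 𝓘(ℝ, ℂ) 2 φ :=
  hφ.1.of_le (by norm_cast)

omit [IsManifold (𝓡 n) ∞ X] [MeasurableSpace X] [BorelSpace X] in
theorem IsTestFunction.contMDiff_one {φ : X → ℂ} (hφ : IsTestFunction (n := n) φ) :
    ContMDiff (𝓡 n) 𝓘(ℝ, ℂ) 1 φ :=
  hφ.1.of_le (by norm_cast)

theorem memLp_of_hasCompactSupport {f : X → ℂ} (hf : Continuous f) (hfc : HasCompactSupport f) :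
    MemLp f 2 D.μ :=
  have := D.isLocallyFiniteMeasure_μ
  hf.memLp_of_hasCompactSupport hfc

variable {D}

omit [BorelSpace X] in
theorem ScalarPotentialAdmissible.ae_nonneg (hY : D.ScalarPotentialAdmissible) :
    ∀ᵐ x ∂D.μ, 0 ≤ D.Y x :=
  (withDensity_absolutelyContinuous _ _).ae_le hY.2

/-- Square integrability of `Y` on the support of `φ` passes from the Riemannian measure to `D.μ` by
the upper bound on β, and βφ is bounded. -/
theorem ScalarPotentialAdmissible.memLp_mul (hY : D.ScalarPotentialAdmissible) {φ : X → ℂ}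
    (hφ : Continuous φ) (hφc : HasCompactSupport φ) :
    MemLp (fun x => (D.β x : ℂ) * (D.Y x : ℂ) * φ x) 2 D.μ := by
  obtain ⟨C, hC, hβ⟩ := D.β_bounds
  have hle : D.μ.restrict (tsupport φ) ≤
      ENNReal.ofReal √C⁻¹ • D.riemannianVolume.restrict (tsupport φ) := by
    have h1 : D.μ ≤ ENNReal.ofReal √C⁻¹ • D.riemannianVolume := by
      rw [← withDensity_const]
      exact withDensity_mono (Filter.Eventually.of_forall fun x =>
        ENNReal.ofReal_le_ofReal (Real.sqrt_le_sqrt (hβ x).2))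
    exact (Measure.restrict_mono le_rfl h1).trans (by rw [Measure.restrict_smul])
  have h2 : MemLp D.Y 2 (D.μ.restrict (tsupport φ)) :=
    (hY.1 _ hφc.isCompact).of_measure_le_smul ENNReal.ofReal_ne_top hle
  have hβc : Continuous fun x => (D.β x : ℂ) :=
    Complex.continuous_ofReal.comp D.β_contMDiff.continuous
  obtain ⟨M, hM⟩ := (hβc.mul hφ).bounded_above_of_compact_support hφc.mul_left
  have h3 : MemLp (fun x => (D.β x : ℂ) * (D.Y x : ℂ) * φ x) 2 (D.μ.restrict (tsupport φ)) := by
    refine h2.of_le_mul (c := M) ?_ (Filter.Eventually.of_forall fun x => ?_)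
    · exact ((hβc.measurable.aestronglyMeasurable).mul
        (Complex.measurable_ofReal.comp_aemeasurable
          h2.aestronglyMeasurable.aemeasurable).aestronglyMeasurable).mul
        hφ.measurable.aestronglyMeasurable
    · rw [mul_right_comm, norm_mul, Complex.norm_real]
      exact mul_le_mul_of_nonneg_right (hM x) (norm_nonneg _)
  have h4 := (memLp_indicator_iff_restrict (isClosed_tsupport φ).measurableSet).2 h3
  rwa [Set.indicator_eq_self.2] at h4
  intro x hx
  by_contra h
  exact hx (by
    dsimp only
    rw [image_eq_zero_of_notMem_tsupport h, mul_zero])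

variable [T2Space X] [SecondCountableTopology X]

theorem ScalarPotentialAdmissible.memLp_applyL (hY : D.ScalarPotentialAdmissible) {φ : X → ℂ}
    (hφ : IsTestFunction (n := n) φ) : MemLp (D.applyL φ) 2 D.μ := by
  have h1 := D.memLp_of_hasCompactSupport (D.continuous_principal hφ.contMDiff_two)
    (HasCompactSupport.intro hφ.2.isCompact fun x hx => D.principal_eq_zero hx)
  refine (h1.add (hY.memLp_mul hφ.1.continuous hφ.2)).ae_eq
    (Filter.Eventually.of_forall fun x => ?_)
  rw [applyL_eq]
  rfl

omit [SecondCountableTopology X] in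
theorem ScalarPotentialAdmissible.integrable_energyDensity (hY : D.ScalarPotentialAdmissible)
    {f ψ : X → ℂ} (hf : ContMDiff (𝓡 n) 𝓘(ℝ, ℂ) 1 f) (hfc : HasCompactSupport f)
    (hψ : ContMDiff (𝓡 n) 𝓘(ℝ, ℂ) 1 ψ) (hψc : HasCompactSupport ψ) :
    Integrable (D.energyDensity f ψ) D.μ := by
  have := D.isLocallyFiniteMeasure_μ
  have h1 : Integrable (D.formDensity f ψ) D.μ :=
    (D.continuous_formDensity hf hψ).integrable_of_hasCompactSupport
      (HasCompactSupport.intro hfc.isCompact fun x hx => D.formDensity_eq_zero ψ hx)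
  have h2 := (D.memLp_of_hasCompactSupport (Complex.continuous_conj.comp hf.continuous)
    (hfc.comp_left (map_zero (starRingEnd ℂ)))).integrable_mul (hY.memLp_mul hψ.continuous hψc)
  exact h1.add h2

theorem ScalarPotentialAdmissible.integral_conj_mul_applyL (hY : D.ScalarPotentialAdmissible)
    {f ψ : X → ℂ} (hf : ContMDiff (𝓡 n) 𝓘(ℝ, ℂ) 1 f) (hfc : HasCompactSupport f)
    (hψ : IsTestFunction (n := n) ψ) :
    ∫ x, (starRingEnd ℂ) (f x) * D.applyL ψ x ∂D.μ = ∫ x, D.energyDensity f ψ x ∂D.μ := by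
  have := D.isLocallyFiniteMeasure_μ
  have hf2 := D.memLp_of_hasCompactSupport (Complex.continuous_conj.comp hf.continuous)
    (hfc.comp_left (map_zero (starRingEnd ℂ)))
  have h2 := hf2.integrable_mul (hY.memLp_mul hψ.1.continuous hψ.2)
  have h3 := hf2.integrable_mul
    (D.memLp_of_hasCompactSupport (D.continuous_principal hψ.contMDiff_two)
    (HasCompactSupport.intro hψ.2.isCompact fun x hx => D.principal_eq_zero hx))
  have h1 : Integrable (D.formDensity f ψ) D.μ :=
    (D.continuous_formDensity hf hψ.contMDiff_one).integrable_of_hasCompactSupport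
      (HasCompactSupport.intro hfc.isCompact fun x hx => D.formDensity_eq_zero ψ hx)
  simp only [applyL_eq, energyDensity, mul_add]
  refine (integral_add h3 h2).trans ?_
  refine Eq.trans ?_ (integral_add h1 h2).symm
  congr 1
  exact D.integral_conj_mul_principal hf hfc hψ.contMDiff_two

theorem ScalarPotentialAdmissible.integral_conj_mul_applyL_comm
    (hY : D.ScalarPotentialAdmissible) {φ ψ : X → ℂ} (hφ : IsTestFunction (n := n) φ)
    (hψ : IsTestFunction (n := n) ψ) : ∫ x, (starRingEnd ℂ) (φ x) * D.applyL ψ x ∂D.μ =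
      (starRingEnd ℂ) (∫ x, (starRingEnd ℂ) (ψ x) * D.applyL φ x ∂D.μ) := by
  rw [hY.integral_conj_mul_applyL hφ.contMDiff_one hφ.2 hψ,
    hY.integral_conj_mul_applyL hψ.contMDiff_one hψ.2 hφ, ← integral_conj]
  simp only [conj_energyDensity]

/-- The constant is the square root of the form at `f`. Only C¹ regularity of `f` is required,
because the estimate is meant for products of `V` with a test function. -/
theorem ScalarPotentialAdmissible.norm_integral_conj_mul_applyL_le
    (hY : D.ScalarPotentialAdmissible) {f : X → ℂ} (hf : ContMDiff (𝓡 n) 𝓘(ℝ, ℂ) 1 f)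
    (hfc : HasCompactSupport f) : ∃ C : ℝ, 0 ≤ C ∧ ∀ ψ : X → ℂ, IsTestFunction (n := n) ψ →
      ‖∫ x, (starRingEnd ℂ) (f x) * D.applyL ψ x ∂D.μ‖ ≤
        C * √(∫ x, (starRingEnd ℂ) (ψ x) * D.applyL ψ x ∂D.μ).re := by
  refine ⟨√(∫ x, (D.energyDensity f f x).re ∂D.μ), Real.sqrt_nonneg _, fun ψ hψ => ?_⟩
  have hψ1 := hψ.contMDiff_one
  have hi := hY.integrable_energyDensity hf hfc hψ1 hψ.2
  have hif := (hY.integrable_energyDensity hf hfc hf hfc).re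
  have hiψ := (hY.integrable_energyDensity hψ1 hψ.2 hψ1 hψ.2).re
  have hre : (∫ x, (starRingEnd ℂ) (ψ x) * D.applyL ψ x ∂D.μ).re =
      ∫ x, (D.energyDensity ψ ψ x).re ∂D.μ := by
    rw [hY.integral_conj_mul_applyL hψ1 hψ.2 hψ]
    exact (integral_re (hY.integrable_energyDensity hψ1 hψ.2 hψ1 hψ.2)).symm
  have hnn : ∀ g : X → ℂ, 0 ≤ ∫ x, (D.energyDensity g g x).re ∂D.μ := fun g =>
    integral_nonneg_of_ae (by
      filter_upwards [hY.ae_nonneg] with x hx using D.energyDensity_self_nonneg g hx)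
  rw [hre, hY.integral_conj_mul_applyL hf hfc hψ]
  refine le_sqrt_mul_sqrt_of_forall_two_mul_le (hnn f) (hnn ψ) fun t ht => ?_
  calc 2 * ‖∫ x, D.energyDensity f ψ x ∂D.μ‖ ≤ 2 * ∫ x, ‖D.energyDensity f ψ x‖ ∂D.μ := by
        gcongr; exact norm_integral_le_integral_norm _
    _ = ∫ x, 2 * ‖D.energyDensity f ψ x‖ ∂D.μ := (integral_const_mul _ _).symm
    _ ≤ ∫ x, t * (D.energyDensity f f x).re + t⁻¹ * (D.energyDensity ψ ψ x).re ∂D.μ := by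
        refine integral_mono_ae (hi.norm.const_mul 2) ((hif.const_mul t).add (hiψ.const_mul t⁻¹)) ?_
        filter_upwards [hY.ae_nonneg] with x hx using D.two_mul_norm_energyDensity_le f ψ hx ht
    _ = _ := by
        rw [← integral_const_mul, ← integral_const_mul]
        exact integral_add (hif.const_mul t) (hiψ.const_mul t⁻¹)

end StaticData

end StaticKG

/-! ### The concrete operators L and B as an instance of the abstract system. -/

namespace StaticKG

namespace StaticData

variable {n : ℕ} {X : Type*} [TopologicalSpace X]
  [ChartedSpace (EuclideanSpace ℝ (Fin n)) X]

theorem isTestFunction_zero : IsTestFunction (n := n) (fun _ : X => (0 : ℂ)) :=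
  ⟨contMDiff_const, HasCompactSupport.zero⟩

theorem IsTestFunction.add {φ ψ : X → ℂ} (hφ : IsTestFunction (n := n) φ)
    (hψ : IsTestFunction (n := n) ψ) : IsTestFunction (n := n) (fun x => φ x + ψ x) :=
  ⟨hφ.1.add hψ.1, hφ.2.add hψ.2⟩

theorem IsTestFunction.const_mul {φ : X → ℂ} (hφ : IsTestFunction (n := n) φ) (c : ℂ) :
    IsTestFunction (n := n) (fun x => c * φ x) :=
  ⟨((ContinuousLinearMap.mul ℝ ℂ c).contDiff (n := ∞)).contMDiff.comp hφ.1,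
    hφ.2.comp_left (g := fun z => c * z) (mul_zero c)⟩

variable [IsManifold (𝓡 n) ∞ X] [MeasurableSpace X] {D : StaticData n X}

theorem inner_eq_integral {f g : D.L2} {φ ψ : X → ℂ} (hf : f =ᵐ[D.μ] φ) (hg : g =ᵐ[D.μ] ψ) :
    ⟪f, g⟫_ℂ = ∫ x, (starRingEnd ℂ) (φ x) * ψ x ∂D.μ := by
  rw [L2.inner_def]
  refine integral_congr_ae ?_
  filter_upwards [hf, hg] with x h1 h2
  rw [h1, h2, RCLike.inner_apply, mul_comm]

variable [BorelSpace X]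

variable (D) in
theorem coeFn_mulV (f : D.L2) : D.mulV f =ᵐ[D.μ] fun x => (D.V x : ℂ) * f x := by
  have h := (ContinuousLinearMap.mul ℂ ℂ).coeFn_holder (r := 2) (D.memLp_V.toLp _) f
  filter_upwards [h, D.memLp_V.coeFn_toLp] with x h1 h2
  rw [← h2]
  exact h1

theorem mulV_ae_eq {f : D.L2} {φ : X → ℂ} (hf : f =ᵐ[D.μ] φ) :
    D.mulV f =ᵐ[D.μ] fun x => (D.V x : ℂ) * φ x := by
  filter_upwards [D.coeFn_mulV f, hf] with x h1 h2
  rw [h1, h2]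

variable (D) in
theorem inner_mulV (f g : D.L2) : ⟪D.mulV f, g⟫_ℂ = ⟪f, D.mulV g⟫_ℂ := by
  rw [inner_eq_integral (D.coeFn_mulV f) (Filter.EventuallyEq.refl _ _),
    inner_eq_integral (Filter.EventuallyEq.refl _ _) (D.coeFn_mulV g)]
  refine integral_congr_ae (Filter.Eventually.of_forall fun x => ?_)
  simp only [map_mul, Complex.conj_ofReal]
  ring

variable (D) in
theorem mem_graph_H (u w : D.L2Sum) : (u, w) ∈ D.H.graph ↔
    (u.fst, w.fst - D.mulV u.snd) ∈ D.L.graph ∧ w.snd = D.mulV u.fst + u.snd := by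
  rw [mk_mem_graph_iff, mk_mem_graph_iff]
  constructor
  · rintro ⟨h, rfl⟩
    exact ⟨⟨h, (add_sub_cancel_right _ _).symm⟩, rfl⟩
  · rintro ⟨⟨h, h1⟩, h2⟩
    refine ⟨h, ?_⟩
    change WithLp.toLp 2 (D.L ⟨u.fst, h⟩ + D.mulV u.snd, D.mulV u.fst + u.snd) = w
    rw [h1, sub_add_cancel, ← h2]
    rfl

variable (D) in
/-- The graph of the operator `L` on `C_c^∞(X)`. -/
def graphL₀ : Set (D.L2 × D.L2) :=
  {p : D.L2 × D.L2 | ∃ φ : X → ℂ, IsTestFunction (n := n) φ ∧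
    p.1 =ᵐ[D.μ] φ ∧ p.2 =ᵐ[D.μ] D.applyL φ}

theorem representsB_of_ae_eq {u w : FormDomain D.H} {φ₁ φ₂ : X → ℂ}
    (h₁ : (FormDomain.val D.H u).fst =ᵐ[D.μ] φ₁) (h₂ : (FormDomain.val D.H u).snd =ᵐ[D.μ] φ₂)
    (hL : ((FormDomain.val D.H w).snd - D.mulV (FormDomain.val D.H u).snd : D.L2) =ᵐ[D.μ]
      D.applyL φ₁)
    (hw : (FormDomain.val D.H w).fst =
      D.mulV (FormDomain.val D.H u).fst + (FormDomain.val D.H u).snd) :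
    D.RepresentsB φ₁ φ₂ ((u : D.Hen), (w : D.Hen)) := by
  refine ⟨u, w, h₁, h₂, ?_, ?_, rfl⟩
  · rw [hw]
    filter_upwards [Lp.coeFn_add (D.mulV (FormDomain.val D.H u).fst)
      (FormDomain.val D.H u).snd, mulV_ae_eq h₁, h₂] with x h7 h8 h9
    rw [h7, Pi.add_apply, h8, h9]
  · filter_upwards [Lp.coeFn_sub (FormDomain.val D.H w).snd
      (D.mulV (FormDomain.val D.H u).snd), hL, mulV_ae_eq h₂] with x h7 h8 h9
    have h10 := h7.symm.trans h8
    rw [Pi.sub_apply, h9] at h10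
    exact sub_eq_iff_eq_add.1 h10

variable [T2Space X] [SecondCountableTopology X]

namespace ScalarPotentialAdmissible

variable (hY : D.ScalarPotentialAdmissible)

omit [T2Space X] [SecondCountableTopology X] [BorelSpace X] in
theorem exists_testFunction_ae_eq {p : D.L2 × D.L2}
    (hp : p ∈ Submodule.span ℂ D.graphL₀) :
    ∃ φ : X → ℂ, IsTestFunction (n := n) φ ∧ p.1 =ᵐ[D.μ] φ := by
  induction hp using Submodule.span_induction with
  | mem q hq =>
    obtain ⟨φ, hφ, h1, -⟩ := hq
    exact ⟨φ, hφ, h1⟩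
  | zero => exact ⟨_, isTestFunction_zero, Lp.coeFn_zero _ _ _⟩
  | add x y _ _ hx hy =>
    obtain ⟨φ, hφ, h1⟩ := hx
    obtain ⟨ψ, hψ, h2⟩ := hy
    refine ⟨_, hφ.add hψ, ?_⟩
    filter_upwards [Lp.coeFn_add x.1 y.1, h1, h2] with z h3 h4 h5
    rw [Prod.fst_add, h3, Pi.add_apply, h4, h5]
  | smul c x _ hx =>
    obtain ⟨φ, hφ, h1⟩ := hx
    refine ⟨_, hφ.const_mul c, ?_⟩
    filter_upwards [Lp.coeFn_smul c x.1, h1] with z h3 h4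
    rw [Prod.smul_fst, h3, Pi.smul_apply, h4, smul_eq_mul]

section

include hY

theorem inner_snd_eq_inner_fst {p q : D.L2 × D.L2} (hp : p ∈ D.graphL₀)
    (hq : q ∈ Submodule.span ℂ D.graphL₀) : ⟪p.1, q.2⟫_ℂ = ⟪p.2, q.1⟫_ℂ := by
  induction hq using Submodule.span_induction with
  | mem q hq =>
    obtain ⟨φ, hφ, h1, h2⟩ := hp
    obtain ⟨ψ, hψ, h3, h4⟩ := hq
    rw [inner_eq_integral h1 h4, hY.integral_conj_mul_applyL_comm hφ hψ,
      ← inner_eq_integral h3 h2, inner_conj_symm]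
  | zero => simp
  | add x y _ _ hx hy => rw [Prod.snd_add, Prod.fst_add, inner_add_right, inner_add_right, hx, hy]
  | smul c x _ hx => rw [Prod.smul_snd, Prod.smul_fst, inner_smul_right, inner_smul_right, hx]

theorem exists_mem_graphL₀ {φ : X → ℂ} (hφ : IsTestFunction (n := n) φ) :
    ∃ p ∈ D.graphL₀, p.1 =ᵐ[D.μ] φ ∧ p.2 =ᵐ[D.μ] D.applyL φ := by
  have h1 := D.memLp_of_hasCompactSupport hφ.1.continuous hφ.2
  have h2 := hY.memLp_applyL hφ
  exact ⟨(h1.toLp _, h2.toLp _), ⟨φ, hφ, h1.coeFn_toLp, h2.coeFn_toLp⟩,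
    h1.coeFn_toLp, h2.coeFn_toLp⟩

end

variable (hL : IsEssentiallySelfAdjoint D.L₀)

section

omit [T2Space X] [SecondCountableTopology X]
include hL

omit [BorelSpace X] in
theorem _root_.StaticKG.IsEssentiallySelfAdjoint.graph_L :
    D.L.graph = D.L₀.graph.topologicalClosure :=
  hL.1.graph_closure_eq_closure_graph.symm

omit [BorelSpace X] in
theorem _root_.StaticKG.IsEssentiallySelfAdjoint.dense_domain_L₀ :
    Dense (D.L₀.domain : Set D.L2) := by
  have hd : Dense (D.L.domain : Set D.L2) := hL.2.dense_domain
  refine dense_closure.1 (hd.mono ?_)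
  intro x hx
  obtain ⟨y, hy⟩ := (D.L.mem_domain_iff).1 hx
  rw [hL.graph_L, ← SetLike.mem_coe, Submodule.topologicalClosure_coe] at hy
  have h := image_closure_subset_closure_image continuous_fst (Set.mem_image_of_mem Prod.fst hy)
  refine closure_mono ?_ h
  rintro _ ⟨⟨u, w⟩, hu, rfl⟩
  exact (mk_mem_graph_iff.1 hu).1

end

include hY hL

/-- The domain of `L₀` is the projection of the span even before the graph is known to be single
valued. It is dense because the closure is densely defined, and symmetry of the pairs makes `p.2`
orthogonal to it. -/
theorem snd_eq_zero_of_fst_eq_zero (p : D.L2 × D.L2)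
    (hp : p ∈ Submodule.span ℂ D.graphL₀) (h0 : p.1 = 0) : p.2 = 0 := by
  have h : ∀ x ∈ D.L₀.domain, ⟪x, p.2⟫_ℂ = 0 := by
    rintro _ ⟨q, hq, rfl⟩
    change q ∈ Submodule.span ℂ D.graphL₀ at hq
    change ⟪q.1, p.2⟫_ℂ = 0
    induction hq using Submodule.span_induction with
    | mem q hq => rw [hY.inner_snd_eq_inner_fst hq hp, h0, inner_zero_right]
    | zero => exact inner_zero_left _
    | add x y _ _ hx hy => rw [Prod.fst_add, inner_add_left, hx, hy, add_zero]
    | smul c x _ hx => rw [Prod.smul_fst, inner_smul_left, hx, mul_zero]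
  exact hL.dense_domain_L₀.eq_zero_of_mem_orthogonal fun x hx => h x hx

/-- An element of the span has the class of a test function as first component; single-valuedness
identifies it with the pair of that function. -/
theorem coe_graph_L₀ : (D.L₀.graph : Set (D.L2 × D.L2)) = D.graphL₀ := by
  have hg : D.L₀.graph = Submodule.span ℂ D.graphL₀ :=
    Submodule.toLinearPMap_graph_eq _ (hY.snd_eq_zero_of_fst_eq_zero hL)
  rw [hg]
  refine Set.Subset.antisymm (fun p hp => ?_) Submodule.subset_span
  obtain ⟨φ, hφ, h1⟩ := exists_testFunction_ae_eq hp
  obtain ⟨q, hq, h2, h3⟩ := hY.exists_mem_graphL₀ hφ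
  have hfst : p.1 = q.1 := Lp.ext (h1.trans h2.symm)
  have hsnd := hY.snd_eq_zero_of_fst_eq_zero hL (p - q)
    (sub_mem hp (Submodule.subset_span hq)) (by rw [Prod.fst_sub, hfst, sub_self])
  rw [Prod.snd_sub, sub_eq_zero] at hsnd
  rwa [Prod.ext hfst hsnd]

theorem mem_graph_L₀ {p : D.L2 × D.L2} : p ∈ D.L₀.graph ↔ p ∈ D.graphL₀ := by
  rw [← SetLike.mem_coe, hY.coe_graph_L₀ hL]

theorem mem_domain_L₀ {x : D.L2} :
    x ∈ D.L₀.domain ↔ ∃ φ : X → ℂ, IsTestFunction (n := n) φ ∧ x =ᵐ[D.μ] φ := by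
  rw [D.L₀.mem_domain_iff]
  simp only [hY.mem_graph_L₀ hL]
  constructor
  · rintro ⟨y, φ, hφ, h1, -⟩
    exact ⟨φ, hφ, h1⟩
  · rintro ⟨φ, hφ, h1⟩
    obtain ⟨q, hq, h2, h3⟩ := hY.exists_mem_graphL₀ hφ
    exact ⟨q.2, φ, hφ, h1, h3⟩

/-- The product of V and a test function is only C¹ with compact support, so it need not lie in Dom
L; the Cauchy–Schwarz bound still places it in the form domain. -/
theorem exists_invSqrtOneAdd_eq_mulV (hT : IsNonnegSelfAdjoint D.L) {x : D.L2}
    (hx : x ∈ D.L₀.domain) : ∃ f, invSqrtOneAdd D.L f = D.mulV x := by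
  obtain ⟨φ, hφ, hxφ⟩ := (hY.mem_domain_L₀ hL).1 hx
  have hf : ContMDiff (𝓡 n) 𝓘(ℝ, ℂ) 1 (fun x => D.V x • φ x) :=
    D.V_contMDiff.smul hφ.contMDiff_one
  have hfc : HasCompactSupport (fun x => D.V x • φ x) :=
    HasCompactSupport.intro hφ.2.isCompact fun z hz => by
      rw [image_eq_zero_of_notMem_tsupport hz, smul_zero]
  obtain ⟨C, hC0, hC⟩ := hY.norm_integral_conj_mul_applyL_le hf hfc
  have hae : D.mulV x =ᵐ[D.μ] fun x => D.V x • φ x := by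
    filter_upwards [mulV_ae_eq hxφ] with z hz
    rw [hz, Complex.real_smul]
  set g := D.mulV x
  -- The estimate is known on pairs of test functions. Both sides are continuous in the pair, so it
  -- extends to the closure, which is the graph of `L`.
  have hbound : ∀ p ∈ D.L.graph, ‖⟪g, p.1 + p.2⟫_ℂ‖ ≤
      (‖g‖ + C) * √(‖p.1‖ ^ 2 + (⟪p.1, p.2⟫_ℂ).re) := by
    have hclosed : IsClosed {p : D.L2 × D.L2 | ‖⟪g, p.1 + p.2⟫_ℂ‖ ≤
        (‖g‖ + C) * √(‖p.1‖ ^ 2 + (⟪p.1, p.2⟫_ℂ).re)} := by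
      refine isClosed_le (by fun_prop) ?_
      refine continuous_const.mul (Real.continuous_sqrt.comp (Continuous.add (by fun_prop) ?_))
      exact Complex.continuous_re.comp (continuous_fst.inner continuous_snd)
    intro p hp
    rw [hL.graph_L, ← SetLike.mem_coe, Submodule.topologicalClosure_coe] at hp
    refine closure_minimal ?_ hclosed hp
    intro q hq
    have hqL : 0 ≤ (⟪q.1, q.2⟫_ℂ).re := by
      have hq' : q ∈ D.L.graph := by
        rw [hL.graph_L]
        exact Submodule.le_topologicalClosure _ hq
      obtain ⟨h1, h2⟩ := mk_mem_graph_iff.1 hq'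
      have := hT.nonneg ⟨q.1, h1⟩
      rw [h2] at this
      exact this
    obtain ⟨ψ, hψ, h1, h2⟩ := (hY.mem_graph_L₀ hL).1 hq
    have h3 := hC ψ hψ
    rw [← inner_eq_integral hae h2, ← inner_eq_integral h1 h2] at h3
    have h4 : ‖⟪g, q.1⟫_ℂ‖ ≤ ‖g‖ * ‖q.1‖ := norm_inner_le_norm _ _
    have h5 : ‖q.1‖ ≤ √(‖q.1‖ ^ 2 + (⟪q.1, q.2⟫_ℂ).re) :=
      Real.le_sqrt_of_sq_le (by linarith)
    have h6 : √(⟪q.1, q.2⟫_ℂ).re ≤ √(‖q.1‖ ^ 2 + (⟪q.1, q.2⟫_ℂ).re) :=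
      Real.sqrt_le_sqrt (by nlinarith [sq_nonneg ‖q.1‖])
    change ‖⟪g, q.1 + q.2⟫_ℂ‖ ≤ _
    rw [inner_add_right]
    calc ‖⟪g, q.1⟫_ℂ + ⟪g, q.2⟫_ℂ‖ ≤ ‖g‖ * ‖q.1‖ + C * √(⟪q.1, q.2⟫_ℂ).re :=
          (norm_add_le _ _).trans (add_le_add h4 h3)
      _ ≤ ‖g‖ * √(‖q.1‖ ^ 2 + (⟪q.1, q.2⟫_ℂ).re) + C * √(‖q.1‖ ^ 2 + (⟪q.1, q.2⟫_ℂ).re) := by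
          gcongr
      _ = _ := (add_mul _ _ _).symm
  obtain ⟨f, hf, -⟩ := hT.exists_invSqrt_eq_of_bound (x := g) (C := ‖g‖ + C) (by positivity)
    fun v => hbound (v, D.L v) (D.L.mem_graph v)
  exact ⟨f, hf⟩

theorem isWaveSystem (hH : IsPositiveInjective D.H) : IsWaveSystem D.L₀ D.L D.mulV D.H :=
  have h : IsHamiltonian D.L D.mulV D.H := ⟨hL.2, D.inner_mulV, D.mem_graph_H, hH⟩
  { h with
    graph_eq := hL.graph_L
    V_mem := fun _ hφ => hY.exists_invSqrtOneAdd_eq_mulV hL h.isNonnegSelfAdjoint_L hφ }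

theorem representsB_iff {p : D.Hen × D.Hen} : (∃ φ₁ φ₂ : X → ℂ, IsTestFunction (n := n) φ₁ ∧
    IsTestFunction (n := n) φ₂ ∧ D.RepresentsB φ₁ φ₂ p) ↔ p ∈ waveGraph D.L₀ D.mulV D.H := by
  rw [mem_waveGraph_iff]
  constructor
  · rintro ⟨φ₁, φ₂, hφ₁, hφ₂, u, w, h1, h2, h3, h4, rfl⟩
    refine ⟨u, w, ⟨(hY.mem_graph_L₀ hL).2 ⟨φ₁, hφ₁, h1, ?_⟩, Lp.ext ?_⟩,
      (hY.mem_domain_L₀ hL).2 ⟨φ₂, hφ₂, h2⟩, rfl⟩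
    · filter_upwards [Lp.coeFn_sub (FormDomain.val D.H w).snd
        (D.mulV (FormDomain.val D.H u).snd), h4, mulV_ae_eq h2] with x h5 h6 h7
      rw [h5, Pi.sub_apply, h6, h7, add_sub_cancel_right]
    · filter_upwards [Lp.coeFn_add (D.mulV (FormDomain.val D.H u).fst)
        (FormDomain.val D.H u).snd, h3, mulV_ae_eq h1, h2] with x h5 h6 h7 h8
      rw [h5, Pi.add_apply, h6, h7, h8]
  · rintro ⟨u, w, ⟨h1, h2⟩, h3, rfl⟩
    obtain ⟨φ₁, hφ₁, h4, h5⟩ := (hY.mem_graph_L₀ hL).1 h1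
    obtain ⟨φ₂, hφ₂, h6⟩ := (hY.mem_domain_L₀ hL).1 h3
    exact ⟨φ₁, φ₂, hφ₁, hφ₂, representsB_of_ae_eq h4 h6 h5 h2⟩

/-- The defining set of pairs is already the submodule `waveGraph`, so the abstract results apply to
`B₀` without change. -/
theorem B₀_eq : D.B₀ = (waveGraph D.L₀ D.mulV D.H).toLinearPMap := by
  have h : {p : D.Hen × D.Hen | ∃ φ₁ φ₂ : X → ℂ, IsTestFunction (n := n) φ₁ ∧
      IsTestFunction (n := n) φ₂ ∧ D.RepresentsB φ₁ φ₂ p} = waveGraph D.L₀ D.mulV D.H :=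
    Set.ext fun p => hY.representsB_iff hL
  rw [B₀, h, Submodule.span_eq]

theorem exists_mem_graph_B₀ (hH : IsPositiveInjective D.H) {φ₁ φ₂ : X → ℂ}
    (hφ₁ : IsTestFunction (n := n) φ₁) (hφ₂ : IsTestFunction (n := n) φ₂) :
    ∃ p ∈ D.B₀.graph, D.RepresentsB φ₁ φ₂ p := by
  have h := hY.isWaveSystem hL hH
  obtain ⟨q₁, hq₁, h1, h1'⟩ := hY.exists_mem_graphL₀ hφ₁
  obtain ⟨q₂, hq₂, h2, -⟩ := hY.exists_mem_graphL₀ hφ₂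
  have hd₁ : q₁.1 ∈ D.L₀.domain := (hY.mem_domain_L₀ hL).2 ⟨φ₁, hφ₁, h1⟩
  have hd₂ : q₂.1 ∈ D.L₀.domain := (hY.mem_domain_L₀ hL).2 ⟨φ₂, hφ₂, h2⟩
  obtain ⟨u, w, huw, hu⟩ := h.exists_isWavePair hd₁ hd₂
  have hu₁ : (FormDomain.val D.H u).fst = q₁.1 := by
    rw [hu]
    rfl
  have hu₂ : (FormDomain.val D.H u).snd = q₂.1 := by
    rw [hu]
    rfl
  refine ⟨((u : D.Hen), (w : D.Hen)), ?_,
    representsB_of_ae_eq (by rwa [hu₁]) (by rwa [hu₂]) ?_ huw.2⟩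
  · rw [hY.B₀_eq hL, h.waveOp_graph, mem_waveGraph_iff]
    exact ⟨u, w, huw, by rwa [hu₂], rfl⟩
  · rw [D.L₀.mem_graph_snd_inj huw.1 ((hY.mem_graph_L₀ hL).2 hq₁) hu₁]
    exact h1'

end ScalarPotentialAdmissible

end StaticData

end StaticKG

theorem mainTheorem4 {n : ℕ} {X : Type*} [TopologicalSpace X] [T2Space X]
    [SecondCountableTopology X] [ChartedSpace (EuclideanSpace ℝ (Fin n)) X]
    [IsManifold (𝓡 n) ∞ X] [MeasurableSpace X] [BorelSpace X]
    (D : StaticKG.StaticData n X) (hY : D.ScalarPotentialAdmissible)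
    (hL : StaticKG.IsEssentiallySelfAdjoint D.L₀)
    (hH : StaticKG.IsPositiveInjective D.H) :
    (∀ φ₁ φ₂ : X → ℂ, StaticKG.StaticData.IsTestFunction (n := n) φ₁ →
      StaticKG.StaticData.IsTestFunction (n := n) φ₂ →
      ∃ p ∈ D.B₀.graph, D.RepresentsB φ₁ φ₂ p) ∧
    StaticKG.IsEssentiallySelfAdjoint D.B₀ ∧
    StaticKG.resolventSet D.B =
      {z : ℂ | StaticKG.IsBoundedlyInvertible
        (StaticKG.compBounded (D.pencil z) (StaticKG.invSqrtOneAdd D.L))} := by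
  have h := hY.isWaveSystem hL hH
  have hB := hY.B₀_eq hL
  refine ⟨fun φ₁ φ₂ hφ₁ hφ₂ => ?_, ?_, ?_⟩
  · exact hY.exists_mem_graph_B₀ hL hH hφ₁ hφ₂
  · rw [hB]
    exact h.isEssentiallySelfAdjoint_waveOp
  · rw [StaticKG.StaticData.B, hB]
    exact h.resolventSet_waveOp
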